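/- Let $T>0$, $\mathcal U\subset\mathbb R^{d}$, $Q=[0,T)\times\mathbb R^n$, $\bar Q=[0,T]\times\mathbb R^n$. Let $w=(w_t)_{0\le t\le T}$ be an $m$-dimensional Brownian motion on a probability space with augmented natural filtration $\mathbb F$. Let $b:\bar Q\times\mathcal U\to\mathbb R^n$ and $\sigma:\bar Q\to\mathbb R^{n\times m}$ be continuous and, for some constants $C_1,C_2>0$, satisfy $\|b(t,x,u)\|+\|\sigma(t,x)\|\le C_1(1+\|x\|+\|u\|)$ and $\|b(t,x,u)-b(s,y,u)\|+\|\sigma(t,x)-\sigma(s,y)\|\le C_2(|t-s|+\|x-y\|)$. Let $\Lambda:\mathbb R^n\to\mathbb R$ and $g:\bar Q\times\mathcal U\to\mathbb R$ satisfy $|\Lambda(x)|\le C_\Lambda(1+\|x\|^{c_\Lambda})$ and $|g(t,x,u)|\le C_g(1+\|x\|^{c_g}+\|u\|^{c_g})$ for some positive constants. A strategy $\mathbf u=(u_s)_{s\in[t,T]}$ is admissible at time $t$ for the initial condition $x_t=x$ if it is $\mathbb F$-progressively measurable and $\mathcal U$-valued with $\mathbb E\int_t^T\|u_s\|^2ds<\infty$,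 and the ($\mathbb F$-progressively measurable, a.s. continuous) solution of $dx_s=b(s,x_s,u_s)\,ds+\sigma(s,x_s)\,dw_s$, $x_t=x$, satisfies $\mathbb E\sup_{s\in[t,T]}\|x_s\|^2<\infty$. Put $J(t,x;\mathbf u)=\mathbb E\big[\Lambda(x_T)+\int_t^Tg(s,x_s,u_s)\,ds\big]$ and let the value function $V(t,x)$ be the supremum of $J(t,x;\mathbf u)$ over the strategies that are admissible at time $t$ (and for which $J$ is well defined). For $L\in C^{1,2}(Q)$ put $$A^uL(t,x)=L_t(t,x)+L_x(t,x)^\top b(t,x,u)+\tfrac12\operatorname{tr}\big(L_{xx}(t,x)\,\sigma\sigma^\top(t,x)\big).$$ **Proposition.** Suppose that $V$ is real-valued, is $C^{1,2}$ on $Q$, and is continuous on $\bar Q$ with polynomial growth in $x$; that $V(T,x)=\Lambda(x)$ for all $x$; and that there is a function $u^*:\bar Q\to\mathcal U$ such that, for all $(t,x)\in Q$, $$g(t,x,u^*(t,x))+A^{u^*(t,x)}V(t,x)=\max_{u\in\mathcal U}\{g(t,x,u)+A^uV(t,x)\}=0.$$ Let $x\in\mathbb R^n$, and let $x^*$ with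 $x^*_0=x$ be the state process under the strategy $\mathbf u^*=(u^*_t)_{t\in[0,T]}$, $u^*_t=u^*(t,x^*_t)$, which is assumed to be admissible at time $0$; suppose that the running reward is well defined along it, i.e. $\int_0^T|g(t,x^*_t,u^*_t)|\,dt<\infty$ a.s. Then $\int_0^T\|V_x(t,x^*_t)^\top\sigma(t,x^*_t)\|^2dt<\infty$ a.s., so that the Itô integral below exists, and the penalty $h^*(\mathbf u,\mathbf w)=\Lambda(x_T)+\int_0^Tg(t,x_t,u_t)\,dt-V(0,x)$ evaluated at $\mathbf u^*$ satisfies, almost surely, $$h^*(\mathbf u^*,\mathbf w)=\Lambda(x^*_T)+\int_0^Tg(t,x^*_t,u^*_t)\,dt-V(0,x)=\int_0^TV_x(t,x^*_t)^\top\sigma(t,x^*_t)\,dw_t.$$ -/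

import Mathlib

open MeasureTheory ProbabilityTheory Set Filter Topology
open scoped ENNReal

/-- `ℝᵏ` with the Euclidean norm. -/
abbrev Vec (k : ℕ) : Type := EuclideanSpace ℝ (Fin k)

/-! ### Brownian motion and its augmented natural filtration -/

section Brownian

variable {Ω : Type*} {m : ℕ}

/-- The `σ`-algebra generated by `W_r`, `0 ≤ r ≤ t`. -/
@[reducible] def naturalSigma (W : ℝ → Ω → Vec m) (t : ℝ) : MeasurableSpace Ω :=
  ⨆ r ∈ Icc (0 : ℝ) t, MeasurableSpace.comap (W r) inferInstance

/-- The augmented natural filtration of `W`: at time `t`, the `σ`-algebra generated by `W_r`,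
`0 ≤ r ≤ t`, and by the `P`-null events. -/
@[reducible] def augmentedSigma [MeasurableSpace Ω] (W : ℝ → Ω → Vec m) (P : Measure Ω) (t : ℝ) :
    MeasurableSpace Ω :=
  naturalSigma W t ⊔ MeasurableSpace.generateFrom {N : Set Ω | MeasurableSet N ∧ P N = 0}

/-- `W` is a standard `m`-dimensional Brownian motion on the time interval `[0, T]`
(its values at other times play no role). -/
structure IsBrownianMotion [MeasurableSpace Ω] (W : ℝ → Ω → Vec m) (P : Measure Ω) (T : ℝ) :
    Prop where
  measurable : ∀ t ∈ Icc (0 : ℝ) T, Measurable (W t)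
  start : ∀ᵐ ω ∂P, W 0 ω = 0
  law_increment : ∀ s t : ℝ, 0 ≤ s → s ≤ t → t ≤ T →
    P.map (fun ω => W t ω - W s ω)
      = multivariateGaussian (0 : Vec m) ((t - s) • (1 : Matrix (Fin m) (Fin m) ℝ))
  indep_increment : ∀ s t : ℝ, 0 ≤ s → s ≤ t → t ≤ T →
    Indep (naturalSigma W s)
      (MeasurableSpace.comap (fun ω => W t ω - W s ω) inferInstance) P
  continuous_paths : ∀ᵐ ω ∂P, ContinuousOn (fun t => W t ω) (Icc 0 T)

/-- `Y` is progressively measurable on the time interval `[a, b]` with respect to the increasing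
family of `σ`-algebras `𝓕`: for every `t ∈ [a, b]`, the restriction of `(s, ω) ↦ Y_s(ω)` to
`[a, t] × Ω` is `𝓑([a, t]) ⊗ 𝓕_t`-measurable. -/
def IsProgressiveOn {E : Type*} [MeasurableSpace E] (𝓕 : ℝ → MeasurableSpace Ω) (a b : ℝ)
    (Y : ℝ → Ω → E) : Prop :=
  ∀ t ∈ Icc a b,
    Measurable[MeasurableSpace.prod (inferInstance : MeasurableSpace (Icc a t)) (𝓕 t)]
      (fun p : Icc a t × Ω => Y p.1 p.2)

end Brownian

/-! ### The Itô integral -/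

section Ito

variable {Ω : Type*} {m : ℕ}

/-- A simple (elementary) `𝓕`-adapted `ℝᵐ`-valued process on `[a, b]`:
`∑_{k < N} ξ_k 1_{(τ_k, τ_{k+1}]}` with deterministic times `τ_0 ≤ τ_1 ≤ ⋯` in `[a, b]` and
bounded `𝓕_{τ_k}`-measurable `ξ_k`. -/
structure SimpleProcess (𝓕 : ℝ → MeasurableSpace Ω) (m : ℕ) (a b : ℝ) where
  N : ℕ
  τ : ℕ → ℝ
  τ_mono : Monotone τ
  τ_mem : ∀ k, τ k ∈ Icc a b
  ξ : ℕ → Ω → Vec m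
  ξ_measurable : ∀ k, Measurable[𝓕 (τ k)] (ξ k)
  ξ_bounded : ∃ C : ℝ, ∀ k ω, ‖ξ k ω‖ ≤ C

/-- The value at time `s` of a simple process. -/
noncomputable def SimpleProcess.process {𝓕 : ℝ → MeasurableSpace Ω} {a b : ℝ}
    (S : SimpleProcess 𝓕 m a b) (s : ℝ) (ω : Ω) : Vec m :=
  ∑ k ∈ Finset.range S.N, (Ioc (S.τ k) (S.τ (k + 1))).indicator (fun _ => S.ξ k ω) s

/-- The elementary stochastic integral `∑_{k < N} ξ_k ⬝ (W_{τ_{k+1}} - W_{τ_k})`. -/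
noncomputable def SimpleProcess.integral {𝓕 : ℝ → MeasurableSpace Ω} {a b : ℝ}
    (S : SimpleProcess 𝓕 m a b) (W : ℝ → Ω → Vec m) (ω : Ω) : ℝ :=
  ∑ k ∈ Finset.range S.N, inner ℝ (S.ξ k ω) (W (S.τ (k + 1)) ω - W (S.τ k) ω)

/-- `I` is (a version of) the Itô integral `∫_a^b φ_sᵀ dW_s`, where `𝓕` is the augmented natural
filtration of `W`: the integrand `φ` is `𝓕`-progressively measurable with `∫_a^b ‖φ_s‖² ds < ∞`
almost surely, and `I` is the limit in probability of the elementary integrals of simple processes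
`S_k` such that `∫_a^b ‖(S_k)_s - φ_s‖² ds → 0` in probability. -/
structure IsItoIntegral [MeasurableSpace Ω] (W : ℝ → Ω → Vec m) (P : Measure Ω) (a b : ℝ)
    (φ : ℝ → Ω → Vec m) (I : Ω → ℝ) : Prop where
  progressive : IsProgressiveOn (augmentedSigma W P) a b φ
  sq_integrable : ∀ᵐ ω ∂P, ∫⁻ s in Icc a b, ‖φ s ω‖ₑ ^ 2 < ∞
  limit : ∃ S : ℕ → SimpleProcess (augmentedSigma W P) m a b,
    (∀ ε : ℝ≥0∞, 0 < ε → Tendsto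
      (fun k => P {ω | ε ≤ ∫⁻ s in Icc a b, ‖(S k).process s ω - φ s ω‖ₑ ^ 2})
      atTop (𝓝 0)) ∧
    TendstoInMeasure P (fun k => (S k).integral W) atTop I

end Ito

/-! ### Controlled Markov diffusions -/

/-- The data of a controlled diffusion problem: horizon `T`, control set `U ⊆ ℝᵈ`, drift `b`,
diffusion matrix `σ`, final reward `Λ` and intermediate reward `g`.  Only times in `[0, T]` and
controls in `U` matter. -/
structure ControlProblem (n m d : ℕ) where
  T : ℝ
  U : Set (Vec d)
  b : ℝ → Vec n → Vec d → Vec n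
  σ : ℝ → Vec n → Matrix (Fin n) (Fin m) ℝ
  Λ : Vec n → ℝ
  g : ℝ → Vec n → Vec d → ℝ

/-- The Euclidean (Frobenius) norm of a matrix. -/
noncomputable def frobNorm {n m : ℕ} (A : Matrix (Fin n) (Fin m) ℝ) : ℝ :=
  √(∑ i, ∑ j, A i j ^ 2)

namespace ControlProblem

variable {n m d : ℕ} {Ω : Type*}

/-- The standing assumptions on the coefficients and the rewards. -/
structure StandingAssumptions (M : ControlProblem n m d) : Prop where
  T_pos : 0 < M.T
  b_continuous : ContinuousOn (fun p : ℝ × Vec n × Vec d => M.b p.1 p.2.1 p.2.2)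
    (Icc 0 M.T ×ˢ univ ×ˢ M.U)
  σ_continuous : ContinuousOn (fun p : ℝ × Vec n => M.σ p.1 p.2) (Icc 0 M.T ×ˢ univ)
  linear_growth : ∃ C₁ : ℝ, 0 < C₁ ∧ ∀ t ∈ Icc (0 : ℝ) M.T, ∀ x, ∀ u ∈ M.U,
    ‖M.b t x u‖ + frobNorm (M.σ t x) ≤ C₁ * (1 + ‖x‖ + ‖u‖)
  lipschitz : ∃ C₂ : ℝ, 0 < C₂ ∧ ∀ t ∈ Icc (0 : ℝ) M.T, ∀ s ∈ Icc (0 : ℝ) M.T, ∀ x y,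
    ∀ u ∈ M.U,
    ‖M.b t x u - M.b s y u‖ + frobNorm (M.σ t x - M.σ s y) ≤ C₂ * (|t - s| + ‖x - y‖)
  Λ_growth : ∃ C c : ℝ, 0 < C ∧ 0 < c ∧ ∀ x, |M.Λ x| ≤ C * (1 + ‖x‖ ^ c)
  g_growth : ∃ C c : ℝ, 0 < C ∧ 0 < c ∧ ∀ t ∈ Icc (0 : ℝ) M.T, ∀ x, ∀ u ∈ M.U,
    |M.g t x u| ≤ C * (1 + ‖x‖ ^ c + ‖u‖ ^ c)

/-- `X` solves `dX_s = b(s, X_s, u_s) ds + σ(s, X_s) dW_s` on `[t, T]` with `X_t = x`: it is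
progressively measurable with almost surely continuous paths, and for every `s ∈ [t, T]`, almost
surely, `X_s = x + ∫_t^s b(r, X_r, u_r) dr + ∫_t^s σ(r, X_r) dW_r` (read in each coordinate). -/
structure IsSolution [MeasurableSpace Ω] (M : ControlProblem n m d) (W : ℝ → Ω → Vec m)
    (P : Measure Ω) (t : ℝ) (x : Vec n) (u : ℝ → Ω → Vec d) (X : ℝ → Ω → Vec n) : Prop where
  progressive : IsProgressiveOn (augmentedSigma W P) t M.T X
  continuous_paths : ∀ᵐ ω ∂P, ContinuousOn (fun s => X s ω) (Icc t M.T)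
  start : ∀ᵐ ω ∂P, X t ω = x
  sde : ∀ s ∈ Icc t M.T, ∀ i : Fin n,
    IsItoIntegral W P t s (fun r ω => WithLp.toLp 2 (M.σ r (X r ω) i))
      (fun ω => X s ω i - x i - ∫ r in t..s, M.b r (X r ω) (u r ω) i)

/-- `u` is an admissible strategy at time `t` for the initial condition `X_t = x`, and `X` is the
corresponding state process. -/
structure IsAdmissible [MeasurableSpace Ω] (M : ControlProblem n m d) (W : ℝ → Ω → Vec m)
    (P : Measure Ω) (t : ℝ) (x : Vec n) (u : ℝ → Ω → Vec d) (X : ℝ → Ω → Vec n) : Prop where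
  progressive : IsProgressiveOn (augmentedSigma W P) t M.T u
  mem_U : ∀ s ∈ Icc t M.T, ∀ ω, u s ω ∈ M.U
  control_sq_integrable : ∫⁻ ω, (∫⁻ s in Icc t M.T, ‖u s ω‖ₑ ^ 2) ∂P < ∞
  solution : M.IsSolution W P t x u X
  state_sq_integrable : ∫⁻ ω, (⨆ s ∈ Icc t M.T, ‖X s ω‖ₑ ^ 2) ∂P < ∞

/-- The total reward `Λ(X_T) + ∫_t^T g(s, X_s, u_s) ds`. -/
noncomputable def totalReward (M : ControlProblem n m d) (t : ℝ) (u : ℝ → Ω → Vec d)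
    (X : ℝ → Ω → Vec n) (ω : Ω) : ℝ :=
  M.Λ (X M.T ω) + ∫ s in t..M.T, M.g s (X s ω) (u s ω)

/-- The running reward `∫_t^T g(s, X_s, u_s) ds` is almost surely a convergent integral. -/
def RunningRewardDefined [MeasurableSpace Ω] (M : ControlProblem n m d) (P : Measure Ω)
    (t : ℝ) (u : ℝ → Ω → Vec d) (X : ℝ → Ω → Vec n) : Prop :=
  ∀ᵐ ω ∂P, IntervalIntegrable (fun s => M.g s (X s ω) (u s ω)) volume t M.T

/-- The expected total reward is a well-defined extended real number. -/
structure RewardDefined [MeasurableSpace Ω] (M : ControlProblem n m d) (P : Measure Ω)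
    (t : ℝ) (u : ℝ → Ω → Vec d) (X : ℝ → Ω → Vec n) : Prop where
  running : M.RunningRewardDefined P t u X
  aemeasurable : AEMeasurable (M.totalReward t u X) P
  finite_part : ∫⁻ ω, ENNReal.ofReal (M.totalReward t u X ω) ∂P < ∞ ∨
    ∫⁻ ω, ENNReal.ofReal (-M.totalReward t u X ω) ∂P < ∞

/-- The reward functional `J(t, x; u) = E_{t,x}[Λ(X_T) + ∫_t^T g(s, X_s, u_s) ds]`, as the
expectation of the positive part minus the expectation of the negative part. -/
noncomputable def reward [MeasurableSpace Ω] (M : ControlProblem n m d) (P : Measure Ω)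
    (t : ℝ) (u : ℝ → Ω → Vec d) (X : ℝ → Ω → Vec n) : EReal :=
  ((∫⁻ ω, ENNReal.ofReal (M.totalReward t u X ω) ∂P : ℝ≥0∞) : EReal) -
    ((∫⁻ ω, ENNReal.ofReal (-M.totalReward t u X ω) ∂P : ℝ≥0∞) : EReal)

/-- The value function `V(t, x) = sup_u J(t, x; u)`, the supremum over the admissible strategies
at time `t` (whose expected reward makes sense). -/
noncomputable def valueFunction [MeasurableSpace Ω] (M : ControlProblem n m d)
    (W : ℝ → Ω → Vec m) (P : Measure Ω) (t : ℝ) (x : Vec n) : EReal :=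
  sSup {J : EReal | ∃ (u : ℝ → Ω → Vec d) (X : ℝ → Ω → Vec n),
    M.IsAdmissible W P t x u X ∧ M.RewardDefined P t u X ∧ J = M.reward P t u X}

/-- The penalty `h*(u, w) = Λ(X_T) + ∫_0^T g(t, X_t, u_t) dt - V(0, x)`. -/
noncomputable def penalty (M : ControlProblem n m d) (V : ℝ → Vec n → ℝ) (x : Vec n)
    (u : ℝ → Ω → Vec d) (X : ℝ → Ω → Vec n) (ω : Ω) : ℝ :=
  M.Λ (X M.T ω) + (∫ t in (0 : ℝ)..M.T, M.g t (X t ω) (u t ω)) - V 0 x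

end ControlProblem

/-! ### The Hamilton-Jacobi-Bellman equation -/

section HJB

variable {n m d : ℕ}

/-- The time derivative `L_t` of a function on `[0, T) × ℝⁿ` (one-sided at time `0`). -/
noncomputable def timeDeriv (T : ℝ) (L : ℝ → Vec n → ℝ) (t : ℝ) (x : Vec n) : ℝ :=
  derivWithin (fun s => L s x) (Ico 0 T) t

/-- The gradient `L_x` in the space variable. -/
noncomputable def spaceGrad (L : ℝ → Vec n → ℝ) (t : ℝ) (x : Vec n) : Vec n :=
  gradient (L t) x

/-- The Hessian `L_xx` in the space variable. -/
noncomputable def spaceHess (L : ℝ → Vec n → ℝ) (t : ℝ) (x : Vec n) :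
    Matrix (Fin n) (Fin n) ℝ :=
  fun i j => fderiv ℝ (fderiv ℝ (L t)) x (EuclideanSpace.single i 1) (EuclideanSpace.single j 1)

/-- `L` is of class `C^{1,2}` on `Q = [0, T) × ℝⁿ`. -/
structure IsC12 (T : ℝ) (L : ℝ → Vec n → ℝ) : Prop where
  differentiable_time : ∀ x, DifferentiableOn ℝ (fun t => L t x) (Ico 0 T)
  contDiff_space : ∀ t ∈ Ico (0 : ℝ) T, ContDiff ℝ 2 (L t)
  continuousOn : ContinuousOn (fun p : ℝ × Vec n => L p.1 p.2) (Ico 0 T ×ˢ univ)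
  continuousOn_timeDeriv :
    ContinuousOn (fun p : ℝ × Vec n => timeDeriv T L p.1 p.2) (Ico 0 T ×ˢ univ)
  continuousOn_spaceGrad :
    ContinuousOn (fun p : ℝ × Vec n => spaceGrad L p.1 p.2) (Ico 0 T ×ˢ univ)
  continuousOn_spaceHess :
    ContinuousOn (fun p : ℝ × Vec n => spaceHess L p.1 p.2) (Ico 0 T ×ˢ univ)

/-- `L ∈ C_p`: `L` is continuous on `[0, T] × ℝⁿ` with polynomial growth in `x`. -/
structure IsCp (T : ℝ) (L : ℝ → Vec n → ℝ) : Prop where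
  continuousOn : ContinuousOn (fun p : ℝ × Vec n => L p.1 p.2) (Icc 0 T ×ˢ univ)
  growth : ∃ C c : ℝ, 0 ≤ c ∧ ∀ t ∈ Icc (0 : ℝ) T, ∀ x, |L t x| ≤ C * (1 + ‖x‖ ^ c)

/-- The operator `A^u L = L_t + L_xᵀ b(t, x, u) + ½ tr(L_xx σσᵀ(t, x))`. -/
noncomputable def ControlProblem.generator (M : ControlProblem n m d) (u : Vec d)
    (L : ℝ → Vec n → ℝ) (t : ℝ) (x : Vec n) : ℝ :=
  timeDeriv M.T L t x + inner ℝ (spaceGrad L t x) (M.b t x u)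
    + (1 / 2) * (spaceHess L t x * (M.σ t x * (M.σ t x).transpose)).trace

/-- The analytic hypotheses of the verification theorem: `L ∈ C^{1,2}(Q) ∩ C_p(Q̄)` solves
`sup_{u ∈ U} {g + A^u L} = 0` on `Q` with `L(T, ·) = Λ`, and the supremum is attained, for every
`(t, x) ∈ Q`, at the point `ustar t x` given by a function `ustar : Q̄ → U`. -/
structure ControlProblem.SolvesHJB (M : ControlProblem n m d) (L : ℝ → Vec n → ℝ)
    (ustar : ℝ → Vec n → Vec d) : Prop where
  c12 : IsC12 M.T L
  cp : IsCp M.T L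
  terminal : ∀ x, L M.T x = M.Λ x
  ustar_mem : ∀ t ∈ Icc (0 : ℝ) M.T, ∀ x, ustar t x ∈ M.U
  hjb : ∀ t ∈ Ico (0 : ℝ) M.T, ∀ x,
    IsGreatest ((fun u => M.g t x u + M.generator u L t x) '' M.U) 0
  ustar_max : ∀ t ∈ Ico (0 : ℝ) M.T, ∀ x,
    M.g t x (ustar t x) + M.generator (ustar t x) L t x = 0

end HJB

/-! Itô's formula writes `V(s, X_s)`, for `s < T`, as `V(0, x)` plus a drift integral plus a
martingale part, `itoRemainder`. Along the optimal path the HJB equation turns the drift into `-g`,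
so the martingale part equals `V(s, X_s) - V(0, x) + ∫_0^s g`. Since `V` is continuous up to time
`T` and `V(T, ·) = Λ`, this process extends continuously to `T`, with the penalty as its terminal
value. It remains to prove that the terminal value is the Itô integral of `V_xᵀ σ` over all of `[0,
T]`. The difficulty is that `V` is `C^{1,2}` only before `T`, so that nothing prevents `V_x` a
priori from blowing up at `T`.

Finiteness of `∫_0^T ‖V_xᵀ σ‖²` comes from the principle that a continuous local martingale which
stays bounded has finite quadratic variation. Left-point discretizations of `V_xᵀ σ` are stopped
when the state or the left-point sum exceeds a level `l`. By the isometry for simple processes their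
expected energy is the second moment of a stopped sum, which is at most `2 l² + 3` on fine grids,
whatever the horizon `t < T`. On the event where the state and the martingale part stay bounded,
stopping eventually does not occur, and Fatou's lemma, used along the grids and along horizons
increasing to `T`, bounds the energy of `V_xᵀ σ` there (`ae_lintegral_lt_top_of_bounded`). Almost
every path belongs to such an event for all large `l`.

Itô's formula itself is proved by Taylor expansion along uniform grids (`IsC12.tendsto_ito_sum`,
pathwise; `exists_grid_tendsto`, almost surely along a subsequence). Two probabilistic estimates
feed it: `∫ σ dW` over a cell is close to `σ ΔW`, and the products of coordinates of `ΔW`, once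
centred, are orthogonal from cell to cell. The first requires that the integrals in the SDE, defined
as limits in probability, be limits in `L²` of elementary integrals (`IsItoIntegral.isL2Ito`).
Finally, a diagonal choice of grids with Borel–Cantelli (`IsItoDiffusion.isItoIntegral`) produces
simple processes that satisfy the definition of the integral on `[0, T]`. -/

/-! ### Moments and independence of Brownian increments. -/

section BrownianBasics

set_option linter.unusedSectionVars false

variable {Ω : Type*} {m : ℕ} [mΩ : MeasurableSpace Ω] {W : ℝ → Ω → Vec m} {P : Measure Ω} {T : ℝ}

lemma naturalSigma_mono {s t : ℝ} (h : s ≤ t) : naturalSigma W s ≤ naturalSigma W t :=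
  biSup_mono fun _ hr => ⟨hr.1, hr.2.trans h⟩

lemma augmentedSigma_mono {s t : ℝ} (h : s ≤ t) :
    augmentedSigma W P s ≤ augmentedSigma W P t :=
  sup_le_sup_right (naturalSigma_mono h) _

lemma measurable_augmentedSigma {s t : ℝ} (hs : 0 ≤ s) (h : s ≤ t) :
    Measurable[augmentedSigma W P t] (W s) := by
  have h1 : MeasurableSpace.comap (W s) inferInstance ≤ augmentedSigma W P t :=
    le_sup_of_le_left (le_biSup (fun r => MeasurableSpace.comap (W r) inferInstance)
      (show s ∈ Icc 0 t from ⟨hs, h⟩))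
  exact (comap_measurable (W s)).mono h1 le_rfl

namespace IsBrownianMotion

lemma naturalSigma_le (hW : IsBrownianMotion W P T) {s : ℝ} (h : s ≤ T) :
    naturalSigma W s ≤ mΩ :=
  iSup₂_le fun r hr => (hW.measurable r ⟨hr.1, hr.2.trans h⟩).comap_le

lemma augmentedSigma_le (hW : IsBrownianMotion W P T) {s : ℝ} (h : s ≤ T) :
    augmentedSigma W P s ≤ mΩ :=
  sup_le (hW.naturalSigma_le h) (MeasurableSpace.generateFrom_le fun _ hN => hN.1)

/-- The sets almost surely equal to an event of the natural `σ`-algebra form a `σ`-algebra, and it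
contains both families that generate the augmentation. Independence of increments therefore survives
the augmentation. -/
lemma exists_ae_eq_naturalSigma {s : ℝ} {A : Set Ω}
    (hA : MeasurableSet[augmentedSigma W P s] A) :
    ∃ B, MeasurableSet[naturalSigma W s] B ∧ A =ᵐ[P] B := by
  have h : augmentedSigma W P s ≤ eventuallyMeasurableSpace (naturalSigma W s) (ae P) := by
    refine sup_le le_eventuallyMeasurableSpace (MeasurableSpace.generateFrom_le fun N hN => ?_)
    exact ⟨∅, @MeasurableSet.empty _ (naturalSigma W s), ae_eq_empty.2 hN.2⟩
  exact h A hA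

lemma indep_augmentedSigma (hW : IsBrownianMotion W P T) {s t : ℝ} (hs : 0 ≤ s) (hst : s ≤ t)
    (ht : t ≤ T) :
    Indep (augmentedSigma W P s)
      (MeasurableSpace.comap (fun ω => W t ω - W s ω) inferInstance) P := by
  rw [Indep_iff]
  intro A B hA hB
  obtain ⟨A', hA', hAA'⟩ := exists_ae_eq_naturalSigma hA
  have h := (Indep_iff _ _ _).1 (hW.indep_increment s t hs hst ht) A' B hA' hB
  rw [measure_congr hAA', ← h]
  exact measure_congr (hAA'.inter (ae_eq_refl B))

lemma measurable_increment (hW : IsBrownianMotion W P T) {s t : ℝ} (hs : 0 ≤ s) (hst : s ≤ t)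
    (ht : t ≤ T) : Measurable (fun ω => W t ω - W s ω) :=
  (hW.measurable t ⟨hs.trans hst, ht⟩).sub (hW.measurable s ⟨hs, hst.trans ht⟩)

/-- Brownian scaling, by comparison of characteristic functions. It reduces every moment of an
increment to one of the standard Gaussian vector and exhibits its power of `t - s`. -/
lemma map_increment (hW : IsBrownianMotion W P T) {s t : ℝ} (hs : 0 ≤ s) (hst : s ≤ t)
    (ht : t ≤ T) :
    P.map (fun ω => W t ω - W s ω) = (stdGaussian (Vec m)).map (fun x => √(t - s) • x) := by
  have h0 : 0 ≤ t - s := sub_nonneg.2 hst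
  have hpsd : ((t - s) • (1 : Matrix (Fin m) (Fin m) ℝ)).PosSemidef :=
    Matrix.PosSemidef.one.smul h0
  rw [hW.law_increment s t hs hst ht]
  have : IsFiniteMeasure ((stdGaussian (Vec m)).map (fun x : Vec m => √(t - s) • x)) :=
    Measure.isFiniteMeasure_map _ _
  refine Measure.ext_of_charFun ?_
  ext x
  rw [charFun_multivariateGaussian hpsd, charFun_map_smul, charFun_stdGaussian]
  congr 1
  have h1 : x.ofLp ⬝ᵥ ((t - s) • (1 : Matrix (Fin m) (Fin m) ℝ)).mulVec x.ofLp
      = (t - s) * ‖x‖ ^ 2 := by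
    rw [Matrix.smul_mulVec, Matrix.one_mulVec, dotProduct_smul, EuclideanSpace.norm_sq_eq]
    simp [dotProduct, pow_two]
  have h2 : (‖√(t - s) • x‖ : ℝ) ^ 2 = (t - s) * ‖x‖ ^ 2 := by
    rw [norm_smul, mul_pow, Real.norm_eq_abs, sq_abs, Real.sq_sqrt h0]
  rw [h1, ← Complex.ofReal_pow, h2, inner_zero_right]
  push_cast; ring

lemma integral_comp_increment (hW : IsBrownianMotion W P T) {s t : ℝ} (hs : 0 ≤ s) (hst : s ≤ t)
    (ht : t ≤ T) {f : Vec m → ℝ} (hf : Measurable f) :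
    ∫ ω, f (W t ω - W s ω) ∂P = ∫ x, f (√(t - s) • x) ∂(stdGaussian (Vec m)) := by
  rw [← integral_map (f := f) (hW.measurable_increment hs hst ht).aemeasurable
    hf.aestronglyMeasurable, hW.map_increment hs hst ht,
    integral_map (by fun_prop) hf.aestronglyMeasurable]

lemma memLp_increment (hW : IsBrownianMotion W P T) {s t : ℝ} (hs : 0 ≤ s) (hst : s ≤ t)
    (ht : t ≤ T) {p : ℝ≥0∞} (hp : p ≠ ∞) : MemLp (fun ω => W t ω - W s ω) p P := by
  have h : MemLp (id : Vec m → Vec m) p (P.map (fun ω => W t ω - W s ω)) := by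
    rw [hW.law_increment s t hs hst ht]
    exact IsGaussian.memLp_id _ p hp
  exact (memLp_map_measure_iff aestronglyMeasurable_id
    (hW.measurable_increment hs hst ht).aemeasurable).1 h

lemma integral_increment_apply (hW : IsBrownianMotion W P T) {s t : ℝ} (hs : 0 ≤ s)
    (hst : s ≤ t) (ht : t ≤ T) (a : Fin m) : ∫ ω, (W t ω - W s ω) a ∂P = 0 := by
  rw [hW.integral_comp_increment hs hst ht (f := fun x => x a) (by fun_prop)]
  have h := integral_strongDual_stdGaussian (E := Vec m) (EuclideanSpace.proj a)
  simp only [PiLp.smul_apply, smul_eq_mul, integral_const_mul]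
  simp only [PiLp.proj_apply] at h
  rw [h, mul_zero]

lemma integral_increment_mul (hW : IsBrownianMotion W P T) {s t : ℝ} (hs : 0 ≤ s)
    (hst : s ≤ t) (ht : t ≤ T) (a b : Fin m) :
    ∫ ω, (W t ω - W s ω) a * (W t ω - W s ω) b ∂P = if a = b then t - s else 0 := by
  have h0 : 0 ≤ t - s := sub_nonneg.2 hst
  rw [hW.integral_comp_increment hs hst ht (f := fun x => x a * x b) (by fun_prop)]
  have hz : ∀ a : Fin m, ∫ x : Vec m, x a ∂(stdGaussian (Vec m)) = 0 := fun a => by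
    have h := integral_strongDual_stdGaussian (E := Vec m) (EuclideanSpace.proj a)
    simpa only [PiLp.proj_apply] using h
  have hL : ∀ a : Fin m, MemLp (fun x : Vec m => x a) 2 (stdGaussian (Vec m)) := fun a => by
    have := IsGaussian.memLp_dual (stdGaussian (Vec m)) (EuclideanSpace.proj a) 2 (by simp)
    simpa using this
  have hcov := covariance_eval_multivariateGaussian (μ := (0 : Vec m))
    (S := (1 : Matrix (Fin m) (Fin m) ℝ)) Matrix.PosSemidef.one a b
  rw [multivariateGaussian_zero_one, covariance_eq_sub (hL a) (hL b), hz, hz, mul_zero,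
    sub_zero] at hcov
  simp only [Pi.mul_apply] at hcov
  simp only [PiLp.smul_apply, smul_eq_mul]
  have : ∀ x : Vec m, √(t - s) * x a * (√(t - s) * x b) = (t - s) * (x a * x b) := fun x => by
    rw [mul_mul_mul_comm, Real.mul_self_sqrt h0]
  simp only [this, integral_const_mul, hcov, Matrix.one_apply]
  split_ifs <;> simp

lemma integral_norm_increment_pow_four (hW : IsBrownianMotion W P T) {s t : ℝ} (hs : 0 ≤ s)
    (hst : s ≤ t) (ht : t ≤ T) :
    ∫ ω, ‖W t ω - W s ω‖ ^ 4 ∂P = (t - s) ^ 2 * ∫ x, ‖x‖ ^ 4 ∂(stdGaussian (Vec m)) := by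
  have h0 : 0 ≤ t - s := sub_nonneg.2 hst
  rw [hW.integral_comp_increment hs hst ht (f := fun x => ‖x‖ ^ 4) (by fun_prop),
    ← integral_const_mul]
  congr 1; ext x
  rw [norm_smul, mul_pow, Real.norm_of_nonneg (Real.sqrt_nonneg _)]
  congr 1
  rw [show (4 : ℕ) = 2 * 2 from rfl, pow_mul, Real.sq_sqrt h0]

lemma integral_mul_increment (hW : IsBrownianMotion W P T) {s t : ℝ} (hs : 0 ≤ s) (hst : s ≤ t)
    (ht : t ≤ T) {ζ : Ω → ℝ} (hζ : Measurable[augmentedSigma W P s] ζ) {f : Vec m → ℝ}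
    (hf : Measurable f) :
    ∫ ω, ζ ω * f (W t ω - W s ω) ∂P = (∫ ω, ζ ω ∂P) * ∫ ω, f (W t ω - W s ω) ∂P := by
  have hind : IndepFun ζ (fun ω => f (W t ω - W s ω)) P := by
    refine indep_of_indep_of_le_left (indep_of_indep_of_le_right
      (hW.indep_augmentedSigma hs hst ht) ?_) hζ.comap_le
    exact ((hf.comp (comap_measurable _))).comap_le
  exact hind.integral_fun_mul_eq_mul_integral
    (hζ.mono (hW.augmentedSigma_le (hst.trans ht)) le_rfl).aestronglyMeasurable
    (hf.comp (hW.measurable_increment hs hst ht)).aestronglyMeasurable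

lemma integrable_mul_increment (hW : IsBrownianMotion W P T) {s t : ℝ} (hs : 0 ≤ s)
    (hst : s ≤ t) (ht : t ≤ T) {ζ : Ω → ℝ} (hζ : Measurable[augmentedSigma W P s] ζ)
    (hζi : Integrable ζ P) {f : Vec m → ℝ} (hf : Measurable f)
    (hfi : Integrable (fun ω => f (W t ω - W s ω)) P) :
    Integrable (fun ω => ζ ω * f (W t ω - W s ω)) P := by
  have hind : IndepFun ζ (fun ω => f (W t ω - W s ω)) P := by
    refine indep_of_indep_of_le_left (indep_of_indep_of_le_right
      (hW.indep_augmentedSigma hs hst ht) ?_) hζ.comap_le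
    exact ((hf.comp (comap_measurable _))).comap_le
  exact hind.integrable_mul hζi hfi

end IsBrownianMotion

end BrownianBasics

/-! ### Covariances of elementary integrals. -/

section ElementaryIsometry

set_option linter.unusedSectionVars false

variable {Ω : Type*} {m : ℕ} [mΩ : MeasurableSpace Ω] {W : ℝ → Ω → Vec m} {P : Measure Ω} {T : ℝ}

lemma measurable_vec_apply {k : ℕ} {α : Type*} {mα : MeasurableSpace α} {f : α → Vec k}
    (hf : Measurable f) (i : Fin k) : Measurable (fun ω => f ω i) :=
  (show Measurable (fun x : Vec k => x i) by fun_prop).comp hf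

lemma MeasureTheory.MemLp.vec_apply {k : ℕ} {α : Type*} {mα : MeasurableSpace α} {μ : Measure α}
    {p : ℝ≥0∞} {f : α → Vec k} (hf : MemLp f p μ) (i : Fin k) : MemLp (fun ω => f ω i) p μ :=
  (EuclideanSpace.proj (𝕜 := ℝ) i).comp_memLp' hf

lemma inner_vec_eq_sum {k : ℕ} (x y : Vec k) : inner ℝ x y = ∑ i, x i * y i := by
  simp [PiLp.inner_apply, mul_comm]

namespace IsBrownianMotion

lemma memLp_inner_increment (hW : IsBrownianMotion W P T) {s t : ℝ} (hs : 0 ≤ s)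
    (hst : s ≤ t) (ht : t ≤ T) {ξ : Ω → Vec m} (hξ : Measurable[augmentedSigma W P s] ξ)
    (hξ2 : MemLp ξ 2 P) : MemLp (fun ω => inner ℝ (ξ ω) (W t ω - W s ω)) 2 P := by
  have hΔ := hW.memLp_increment hs hst ht (p := 2) (by simp)
  have hΔm := hW.measurable_increment hs hst ht
  have hξm : Measurable ξ := hξ.mono (hW.augmentedSigma_le (hst.trans ht)) le_rfl
  have h1 := hW.integrable_mul_increment hs hst ht (ζ := fun ω => ‖ξ ω‖ ^ 2)
    ((show Measurable (fun x : Vec m => ‖x‖ ^ 2) by fun_prop).comp hξ)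
    (hξ2.integrable_norm_pow (by simp)) (f := fun x => ‖x‖ ^ 2)
    (by fun_prop) (hΔ.integrable_norm_pow (by simp))
  have hm : Measurable (fun ω => inner ℝ (ξ ω) (W t ω - W s ω)) := hξm.inner hΔm
  rw [memLp_two_iff_integrable_sq hm.aestronglyMeasurable]
  refine h1.mono' (hm.pow_const 2).aestronglyMeasurable (ae_of_all _ fun ω => ?_)
  rw [Real.norm_of_nonneg (sq_nonneg _), ← mul_pow, ← sq_abs]
  exact pow_le_pow_left₀ (abs_nonneg _) (abs_real_inner_le_norm _ _) 2

lemma measurable_inner_increment {r s t : ℝ} (hs : 0 ≤ s)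
    (hst : s ≤ t) (htr : t ≤ r) {ξ : Ω → Vec m} (hξ : Measurable[augmentedSigma W P s] ξ) :
    Measurable[augmentedSigma W P r] (fun ω => inner ℝ (ξ ω) (W t ω - W s ω)) := by
  have h1 : Measurable[augmentedSigma W P r] (W t) :=
    measurable_augmentedSigma (hs.trans hst) htr
  have h2 : Measurable[augmentedSigma W P r] (W s) :=
    measurable_augmentedSigma hs (hst.trans htr)
  exact (hξ.mono (augmentedSigma_mono (hst.trans htr)) le_rfl).inner (h1.sub h2)

/-- The martingale property: the increment is centred and independent of everything known at time
`s`. It removes all the cross terms in the isometry. -/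
lemma integral_mul_inner_increment (hW : IsBrownianMotion W P T) {s t : ℝ} (hs : 0 ≤ s)
    (hst : s ≤ t) (ht : t ≤ T) {ζ : Ω → ℝ} (hζ : Measurable[augmentedSigma W P s] ζ)
    (hζ2 : MemLp ζ 2 P) {ξ : Ω → Vec m} (hξ : Measurable[augmentedSigma W P s] ξ)
    (hξ2 : MemLp ξ 2 P) :
    ∫ ω, ζ ω * inner ℝ (ξ ω) (W t ω - W s ω) ∂P = 0 := by
  have hΔ := hW.memLp_increment hs hst ht (p := 1) (by simp)
  have hm : ∀ i, Measurable[augmentedSigma W P s] (fun ω => ζ ω * ξ ω i) := fun i =>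
    hζ.mul (measurable_vec_apply hξ i)
  have hint : ∀ i, Integrable (fun ω => ζ ω * ξ ω i) P := fun i =>
    hζ2.integrable_mul (hξ2.vec_apply i)
  have he : ∀ ω, ζ ω * inner ℝ (ξ ω) (W t ω - W s ω)
      = ∑ i, (ζ ω * ξ ω i) * (W t ω - W s ω) i := fun ω => by
    rw [inner_vec_eq_sum, Finset.mul_sum]
    simp only [mul_assoc]
  simp only [he]
  rw [integral_finsetSum _ fun i _ => hW.integrable_mul_increment hs hst ht (hm i) (hint i)
    (f := fun x => x i) (by fun_prop) (memLp_one_iff_integrable.1 (hΔ.vec_apply i))]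
  refine Finset.sum_eq_zero fun i _ => ?_
  rw [hW.integral_mul_increment hs hst ht (hm i) (f := fun x => x i) (by fun_prop),
    hW.integral_increment_apply hs hst ht, mul_zero]

/-- In coordinates, `ξ_i η_j` is independent of the product of the `i`-th and `j`-th coordinates of
the increment, and distinct coordinates are uncorrelated, so only the diagonal survives. -/
lemma integral_inner_increment_mul_self (hW : IsBrownianMotion W P T) {s t : ℝ} (hs : 0 ≤ s)
    (hst : s ≤ t) (ht : t ≤ T) {ξ η : Ω → Vec m} (hξ : Measurable[augmentedSigma W P s] ξ)
    (hξ2 : MemLp ξ 2 P) (hη : Measurable[augmentedSigma W P s] η) (hη2 : MemLp η 2 P) :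
    ∫ ω, inner ℝ (ξ ω) (W t ω - W s ω) * inner ℝ (η ω) (W t ω - W s ω) ∂P
      = (t - s) * ∫ ω, inner ℝ (ξ ω) (η ω) ∂P := by
  have hΔ := hW.memLp_increment hs hst ht (p := 2) (by simp)
  have hm : ∀ i j, Measurable[augmentedSigma W P s] (fun ω => ξ ω i * η ω j) := fun i j =>
    (measurable_vec_apply hξ i).mul (measurable_vec_apply hη j)
  have hint : ∀ i j, Integrable (fun ω => ξ ω i * η ω j) P := fun i j =>
    (hξ2.vec_apply i).integrable_mul (hη2.vec_apply j)
  have hi : ∀ i j, Integrable (fun ω => (ξ ω i * η ω j) *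
      ((W t ω - W s ω) i * (W t ω - W s ω) j)) P := fun i j =>
    hW.integrable_mul_increment hs hst ht (hm i j) (hint i j)
      (f := fun x => x i * x j) (by fun_prop) ((hΔ.vec_apply i).integrable_mul (hΔ.vec_apply j))
  have he : ∀ ω, inner ℝ (ξ ω) (W t ω - W s ω) * inner ℝ (η ω) (W t ω - W s ω)
      = ∑ i, ∑ j, (ξ ω i * η ω j) * ((W t ω - W s ω) i * (W t ω - W s ω) j) := fun ω => by
    rw [inner_vec_eq_sum, inner_vec_eq_sum, Finset.sum_mul_sum]
    exact Finset.sum_congr rfl fun i _ => Finset.sum_congr rfl fun j _ => by ring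
  simp only [he]
  rw [integral_finsetSum _ fun i _ => integrable_finsetSum _ fun j _ => hi i j]
  have h1 : ∀ i, ∫ ω, ∑ j, (ξ ω i * η ω j) * ((W t ω - W s ω) i * (W t ω - W s ω) j) ∂P
      = (t - s) * ∫ ω, ξ ω i * η ω i ∂P := fun i => by
    rw [integral_finsetSum _ fun j _ => hi i j, Finset.sum_eq_single i]
    · rw [hW.integral_mul_increment hs hst ht (hm i i) (f := fun x => x i * x i) (by fun_prop),
        hW.integral_increment_mul hs hst ht, if_pos rfl, mul_comm]
    · intro j _ hj
      rw [hW.integral_mul_increment hs hst ht (hm i j) (f := fun x => x i * x j) (by fun_prop),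
        hW.integral_increment_mul hs hst ht, if_neg hj.symm, mul_zero]
    · simp
  simp only [h1, ← Finset.mul_sum]
  rw [← integral_finsetSum _ fun i _ => hint i i]
  simp only [inner_vec_eq_sum]

/-- Cut both intervals at `c` and at `e = min b d`. Only the overlap `(c, e]` contributes: every
other product either vanishes or contains an increment that comes after all the other factors. -/
lemma integral_inner_increment_mul_of_le (hW : IsBrownianMotion W P T) {a b c d : ℝ}
    (ha : 0 ≤ a) (hab : a ≤ b) (hb : b ≤ T) (hcd : c ≤ d) (hd : d ≤ T) (hac : a ≤ c)
    {ξ η : Ω → Vec m} (hξ : Measurable[augmentedSigma W P a] ξ)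
    (hξ2 : MemLp ξ 2 P) (hη : Measurable[augmentedSigma W P c] η) (hη2 : MemLp η 2 P) :
    ∫ ω, inner ℝ (ξ ω) (W b ω - W a ω) * inner ℝ (η ω) (W d ω - W c ω) ∂P
      = max (min b d - c) 0 * ∫ ω, inner ℝ (ξ ω) (η ω) ∂P := by
  have hc : 0 ≤ c := ha.trans hac
  rcases le_total b c with hbc | hcb
  · rw [hW.integral_mul_inner_increment hc hcd hd (measurable_inner_increment ha hab hbc hξ)
      (hW.memLp_inner_increment ha hab hb hξ hξ2) hη hη2, max_eq_right, zero_mul]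
    exact sub_nonpos.2 ((min_le_left _ _).trans hbc)
  set e := min b d with he
  have hce : c ≤ e := le_min hcb hcd
  have heb : e ≤ b := min_le_left _ _
  have hed : e ≤ d := min_le_right _ _
  have hcT : c ≤ T := hcd.trans hd
  have heT : e ≤ T := hed.trans hd
  have he0 : 0 ≤ e := hc.trans hce
  have hξc : Measurable[augmentedSigma W P c] ξ := hξ.mono (augmentedSigma_mono hac) le_rfl
  have hξe : Measurable[augmentedSigma W P e] ξ := hξc.mono (augmentedSigma_mono hce) le_rfl
  have hηe : Measurable[augmentedSigma W P e] η := hη.mono (augmentedSigma_mono hce) le_rfl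
  have L0 := hW.memLp_inner_increment ha hac hcT hξ hξ2
  have L1 := hW.memLp_inner_increment hc hce heT hξc hξ2
  have L2 := hW.memLp_inner_increment he0 heb hb hξe hξ2
  have M := hW.memLp_inner_increment hc hcd hd hη hη2
  have M1 := hW.memLp_inner_increment hc hce heT hη hη2
  have M2 := hW.memLp_inner_increment he0 hed hd hηe hη2
  have hsplit : ∀ ω, inner ℝ (ξ ω) (W b ω - W a ω) * inner ℝ (η ω) (W d ω - W c ω)
      = inner ℝ (ξ ω) (W c ω - W a ω) * inner ℝ (η ω) (W d ω - W c ω)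
      + inner ℝ (ξ ω) (W e ω - W c ω) * inner ℝ (η ω) (W e ω - W c ω)
      + inner ℝ (ξ ω) (W e ω - W c ω) * inner ℝ (η ω) (W d ω - W e ω)
      + inner ℝ (η ω) (W e ω - W c ω) * inner ℝ (ξ ω) (W b ω - W e ω) := fun ω => by
    -- As `e` is `b` or `d`, one of the two remaining increments is zero.
    have h0 : inner ℝ (ξ ω) (W b ω - W e ω) * inner ℝ (η ω) (W d ω - W e ω) = 0 := by
      rcases min_choice b d with h | h
      · rw [he, h]; simp
      · rw [he, h]; simp
    have h1 : inner ℝ (ξ ω) (W b ω - W a ω) = inner ℝ (ξ ω) (W c ω - W a ω)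
        + inner ℝ (ξ ω) (W e ω - W c ω) + inner ℝ (ξ ω) (W b ω - W e ω) := by
      rw [← inner_add_right, ← inner_add_right]; congr 1; abel
    have h2 : inner ℝ (η ω) (W d ω - W c ω) = inner ℝ (η ω) (W e ω - W c ω)
        + inner ℝ (η ω) (W d ω - W e ω) := by
      rw [← inner_add_right]; congr 1; abel
    rw [h1, h2]
    linear_combination h0
  simp only [hsplit]
  rw [integral_add, integral_add, integral_add,
    hW.integral_mul_inner_increment hc hcd hd (measurable_inner_increment ha hac le_rfl hξ) L0
      hη hη2,
    hW.integral_inner_increment_mul_self hc hce heT hξc hξ2 hη hη2,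
    hW.integral_mul_inner_increment he0 hed hd (measurable_inner_increment hc hce le_rfl hξc) L1
      hηe hη2,
    hW.integral_mul_inner_increment he0 heb hb (measurable_inner_increment hc hce le_rfl hη) M1
      hξe hξ2, max_eq_left (sub_nonneg.2 hce)]
  · ring
  · exact L0.integrable_mul M
  · exact L1.integrable_mul M1
  · exact (L0.integrable_mul M).add (L1.integrable_mul M1)
  · exact L1.integrable_mul M2
  · exact ((L0.integrable_mul M).add (L1.integrable_mul M1)).add (L1.integrable_mul M2)
  · exact M1.integrable_mul L2

lemma integral_inner_increment_mul (hW : IsBrownianMotion W P T) {a b c d : ℝ}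
    (ha : 0 ≤ a) (hab : a ≤ b) (hb : b ≤ T) (hc : 0 ≤ c) (hcd : c ≤ d) (hd : d ≤ T)
    {ξ η : Ω → Vec m} (hξ : Measurable[augmentedSigma W P a] ξ)
    (hξ2 : MemLp ξ 2 P) (hη : Measurable[augmentedSigma W P c] η) (hη2 : MemLp η 2 P) :
    ∫ ω, inner ℝ (ξ ω) (W b ω - W a ω) * inner ℝ (η ω) (W d ω - W c ω) ∂P
      = max (min b d - max a c) 0 * ∫ ω, inner ℝ (ξ ω) (η ω) ∂P := by
  rcases le_total a c with h | h
  · rw [hW.integral_inner_increment_mul_of_le ha hab hb hcd hd h hξ hξ2 hη hη2, max_eq_right h]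
  · have := hW.integral_inner_increment_mul_of_le hc hcd hd hab hb h hη hη2 hξ hξ2
    rw [max_eq_left h, min_comm]
    simp only [mul_comm (inner ℝ (ξ _) _), real_inner_comm (η _) (ξ _)]
    rw [this]

end IsBrownianMotion

end ElementaryIsometry

/-! ### Elementary processes, the Itô isometry and its `L²` closure. -/

section ElementaryProcesses

set_option linter.unusedSectionVars false

variable {Ω : Type*} {m : ℕ} [mΩ : MeasurableSpace Ω] {W : ℝ → Ω → Vec m} {P : Measure Ω} {T : ℝ}

/-- The product of Lebesgue measure on `[0, T]` and `P`. -/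
noncomputable abbrev timeMeasure (T : ℝ) (P : Measure Ω) : Measure (ℝ × Ω) :=
  (volume.restrict (Icc 0 T)).prod P

/-- The process `ξ 1_{(a, b]}`. -/
noncomputable def stepIntegrand (a b : ℝ) (ξ : Ω → Vec m) (p : ℝ × Ω) : Vec m :=
  (Ioc a b).indicator (fun _ => ξ p.2) p.1

/-- `IsElementary W P T S J`: `S` is a finite sum of processes `ξ 1_{(a, b]}` on `[0, T]` with `ξ`
square integrable and known at time `a`, and `J` is its stochastic integral. -/
inductive IsElementary (W : ℝ → Ω → Vec m) (P : Measure Ω) (T : ℝ) :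
    (ℝ × Ω → Vec m) → (Ω → ℝ) → Prop
  | zero : IsElementary W P T (fun _ => 0) (fun _ => 0)
  | add {S S' : ℝ × Ω → Vec m} {J J' : Ω → ℝ} : IsElementary W P T S J →
      IsElementary W P T S' J' → IsElementary W P T (fun p => S p + S' p) (fun ω => J ω + J' ω)
  | step {a b : ℝ} {ξ : Ω → Vec m} : 0 ≤ a → a ≤ b → b ≤ T →
      Measurable[augmentedSigma W P a] ξ → MemLp ξ 2 P →
      IsElementary W P T (stepIntegrand a b ξ) (fun ω => inner ℝ (ξ ω) (W b ω - W a ω))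

lemma stepIntegrand_eq_indicator (a b : ℝ) (ξ : Ω → Vec m) :
    stepIntegrand a b ξ = (Ioc a b ×ˢ univ).indicator (fun p : ℝ × Ω => ξ p.2) := by
  ext1 p
  by_cases h : p.1 ∈ Ioc a b
  · rw [stepIntegrand, indicator_of_mem h, indicator_of_mem (by exact ⟨h, mem_univ _⟩)]
  · rw [stepIntegrand, indicator_of_notMem h, indicator_of_notMem fun h' => h h'.1]

variable [IsProbabilityMeasure P]

lemma memLp_stepIntegrand (a b : ℝ) {ξ : Ω → Vec m} (hξ : MemLp ξ 2 P) :
    MemLp (stepIntegrand a b ξ) 2 (timeMeasure T P) := by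
  rw [stepIntegrand_eq_indicator]
  exact (hξ.comp_snd _).indicator (measurableSet_Ioc.prod MeasurableSet.univ)

namespace IsElementary

variable {S S' : ℝ × Ω → Vec m} {J J' : Ω → ℝ}

lemma memLp_process (h : IsElementary W P T S J) : MemLp S 2 (timeMeasure T P) := by
  induction h with
  | zero => exact MemLp.zero'
  | add _ _ h1 h2 => exact h1.add h2
  | step _ _ _ _ hξ => exact memLp_stepIntegrand _ _ hξ

lemma memLp_integral (hW : IsBrownianMotion W P T) (h : IsElementary W P T S J) :
    MemLp J 2 P := by
  induction h with
  | zero => exact MemLp.zero'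
  | add _ _ h1 h2 => exact h1.add h2
  | step ha hab hb hξ hξ2 => exact hW.memLp_inner_increment ha hab hb hξ hξ2

lemma neg (h : IsElementary W P T S J) :
    IsElementary W P T (fun p => -S p) (fun ω => -J ω) := by
  induction h with
  | zero => simpa using IsElementary.zero
  | add _ _ h1 h2 => simpa only [neg_add] using h1.add h2
  | @step a b ξ ha hab hb hξ hξ2 =>
    have := IsElementary.step ha hab hb hξ.neg hξ2.neg
    convert this using 1
    · ext1 p
      by_cases hp : p.1 ∈ Ioc a b <;> simp [stepIntegrand, hp]
    · ext1 ω; simp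

lemma sub (h : IsElementary W P T S J) (h' : IsElementary W P T S' J') :
    IsElementary W P T (fun p => S p - S' p) (fun ω => J ω - J' ω) := by
  simpa only [sub_eq_add_neg] using h.add h'.neg

lemma integral_stepIntegrand_inner {a b c d : ℝ} (ha : 0 ≤ a) (hb : b ≤ T) (ξ η : Ω → Vec m) :
    ∫ p, inner ℝ (stepIntegrand a b ξ p) (stepIntegrand c d η p) ∂(timeMeasure T P)
      = max (min b d - max a c) 0 * ∫ ω, inner ℝ (ξ ω) (η ω) ∂P := by
  have h : ∀ p : ℝ × Ω, inner ℝ (stepIntegrand a b ξ p) (stepIntegrand c d η p)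
      = (Ioc a b ∩ Ioc c d).indicator (fun _ => (1 : ℝ)) p.1 * inner ℝ (ξ p.2) (η p.2) := by
    intro p
    by_cases h1 : p.1 ∈ Ioc a b <;> by_cases h2 : p.1 ∈ Ioc c d <;>
      simp [stepIntegrand, h1, h2, indicator]
  simp only [h]
  rw [integral_prod_mul (fun r => (Ioc a b ∩ Ioc c d).indicator (fun _ => (1 : ℝ)) r)
    (fun ω => inner ℝ (ξ ω) (η ω)), Ioc_inter_Ioc, integral_indicator measurableSet_Ioc,
    Measure.restrict_restrict measurableSet_Ioc, inter_eq_left.2]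
  · simp [Measure.real]
    left
    rw [ENNReal.toReal_ofReal']
  · intro r hr
    exact ⟨ha.trans ((le_max_left _ _).trans hr.1.le), (hr.2.trans (min_le_left _ _)).trans hb⟩

lemma integrable_mul (hW : IsBrownianMotion W P T) (h : IsElementary W P T S J)
    (h' : IsElementary W P T S' J') : Integrable (fun ω => J ω * J' ω) P :=
  (h.memLp_integral hW).integrable_mul (h'.memLp_integral hW)

lemma integrable_inner (h : IsElementary W P T S J) (h' : IsElementary W P T S' J') :
    Integrable (fun p => (inner ℝ (S p) (S' p) : ℝ)) (timeMeasure T P) := by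
  refine (h.memLp_process.norm.integrable_mul h'.memLp_process.norm).mono'
    (h.memLp_process.1.inner h'.memLp_process.1) (ae_of_all _ fun p => ?_)
  exact norm_inner_le_norm _ _

/-- The isometry is proved in polarized form because both sides are then bilinear: a double
induction reduces it to a pair of steps. No common refinement of partitions is needed. -/
lemma integral_mul (hW : IsBrownianMotion W P T) (h : IsElementary W P T S J)
    (h' : IsElementary W P T S' J') :
    ∫ ω, J ω * J' ω ∂P = ∫ p, inner ℝ (S p) (S' p) ∂(timeMeasure T P) := by
  induction h with
  | zero => simp
  | add e1 e2 h1 h2 =>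
    simp only [add_mul, inner_add_left]
    rw [integral_add (e1.integrable_mul hW h') (e2.integrable_mul hW h'),
      integral_add (e1.integrable_inner h') (e2.integrable_inner h'), h1, h2]
  | step ha hab hb hξ hξ2 =>
    induction h' with
    | zero => simp
    | add e1 e2 h1 h2 =>
      have e := IsElementary.step ha hab hb hξ hξ2
      simp only [mul_add, inner_add_right]
      rw [integral_add (e.integrable_mul hW e1) (e.integrable_mul hW e2),
        integral_add (e.integrable_inner e1) (e.integrable_inner e2), h1, h2]
    | step hc hcd hd hη hη2 =>
      rw [integral_stepIntegrand_inner ha hb,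
        hW.integral_inner_increment_mul ha hab hb hc hcd hd hξ hξ2 hη hη2]

/-- The Itô isometry for elementary processes. -/
lemma eLpNorm_integral (hW : IsBrownianMotion W P T) (h : IsElementary W P T S J) :
    eLpNorm J 2 P = eLpNorm S 2 (timeMeasure T P) := by
  rw [(h.memLp_integral hW).eLpNorm_eq_integral_rpow_norm (by simp) (by simp),
    h.memLp_process.eLpNorm_eq_integral_rpow_norm (by simp) (by simp)]
  have := h.integral_mul hW h
  simp only [← pow_two, real_inner_self_eq_norm_sq] at this
  simp [this]

/-- The same `J'` serves in both conclusions, which is how a factor known at time `s` comes out of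
the integral over `(s, t]`. Each step is cut to start at `max a s`, where both `ξ` and `θ` are
known. -/
lemma exists_restrict (h : IsElementary W P T S J) {s t : ℝ} {θ : Ω → ℝ}
    (hθ : Measurable[augmentedSigma W P s] θ) {C : ℝ} (hC : ∀ ω, |θ ω| ≤ C)
    (hle : augmentedSigma W P s ≤ mΩ) :
    ∃ J', IsElementary W P T (fun p => (Ioc s t).indicator (fun _ => S p) p.1) J' ∧
      IsElementary W P T (fun p => θ p.2 • (Ioc s t).indicator (fun _ => S p) p.1)
        (fun ω => θ ω * J' ω) := by
  induction h with
  | zero =>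
    refine ⟨fun _ => 0, ?_, ?_⟩
    · convert IsElementary.zero using 2; simp
    · convert IsElementary.zero using 2 <;> simp
  | @add S S' J J' _ _ h1 h2 =>
    obtain ⟨J1, a1, b1⟩ := h1
    obtain ⟨J2, a2, b2⟩ := h2
    refine ⟨fun ω => J1 ω + J2 ω, ?_, ?_⟩
    · convert a1.add a2 using 1
      ext1 p; by_cases hp : p.1 ∈ Ioc s t <;> simp [hp]
    · convert b1.add b2 using 1
      · ext1 p; by_cases hp : p.1 ∈ Ioc s t <;> simp [hp]
      · ext1 ω; ring
  | @step a b ξ ha hab hb hξ hξ2 =>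
    have hind : ∀ p : ℝ × Ω, (Ioc s t).indicator (fun _ => stepIntegrand a b ξ p) p.1
        = stepIntegrand (max a s) (min b t) ξ p := fun p => by
      rw [stepIntegrand, stepIntegrand, ← Ioc_inter_Ioc]
      by_cases h1 : p.1 ∈ Ioc s t <;> by_cases h2 : p.1 ∈ Ioc a b <;>
        simp [-mem_Ioc, indicator, h1, h2]
    have hsm : ∀ p : ℝ × Ω, θ p.2 • stepIntegrand (max a s) (min b t) ξ p
        = stepIntegrand (max a s) (min b t) (fun ω => θ ω • ξ ω) p := fun p => by
      by_cases h2 : p.1 ∈ Ioc (max a s) (min b t) <;> simp [stepIntegrand, h2]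
    simp only [hind, hsm]
    -- A step requires ordered endpoints, so an empty overlap has to be represented by the zero
    -- process.
    rcases lt_or_ge (min b t) (max a s) with hlt | hle'
    · have h0 : ∀ ξ : Ω → Vec m, stepIntegrand (max a s) (min b t) ξ = fun _ => 0 := fun ξ => by
        ext1 p; rw [stepIntegrand, Ioc_eq_empty hlt.not_gt]; simp
      refine ⟨fun _ => 0, ?_, ?_⟩
      · simp only [h0]; exact IsElementary.zero
      · simp only [h0, mul_zero]; exact IsElementary.zero
    · have hξ' : Measurable[augmentedSigma W P (max a s)] ξ :=
        hξ.mono (augmentedSigma_mono (le_max_left _ _)) le_rfl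
      have hθ' : Measurable[augmentedSigma W P (max a s)] θ :=
        hθ.mono (augmentedSigma_mono (le_max_right _ _)) le_rfl
      have h0 : 0 ≤ max a s := ha.trans (le_max_left _ _)
      have hT : min b t ≤ T := (min_le_left _ _).trans hb
      refine ⟨_, IsElementary.step h0 hle' hT hξ' hξ2, ?_⟩
      have hm2 : MemLp (fun ω => θ ω • ξ ω) 2 P := by
        refine hξ2.of_le_mul (c := C) ((hθ.mono hle le_rfl).aestronglyMeasurable.smul
          hξ2.aestronglyMeasurable) (ae_of_all _ fun ω => ?_)
        rw [norm_smul]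
        exact mul_le_mul_of_nonneg_right (hC ω) (norm_nonneg _)
      have hm1 : Measurable[augmentedSigma W P (max a s)] (fun ω => θ ω • ξ ω) := hθ'.smul hξ'
      simpa only [real_inner_smul_left] using IsElementary.step h0 hle' hT hm1 hm2

end IsElementary

/-- `I` is the Itô integral over `[0, T]` of the square integrable process `ψ`: the limit in `L²` of
elementary integrals. -/
structure IsL2Ito (W : ℝ → Ω → Vec m) (P : Measure Ω) (T : ℝ) (ψ : ℝ × Ω → Vec m) (I : Ω → ℝ) :
    Prop where
  integrand : AEStronglyMeasurable ψ (timeMeasure T P)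
  integral : AEStronglyMeasurable I P
  approx : ∃ (S : ℕ → ℝ × Ω → Vec m) (J : ℕ → Ω → ℝ), (∀ k, IsElementary W P T (S k) (J k)) ∧
    Tendsto (fun k => eLpNorm (fun p => S k p - ψ p) 2 (timeMeasure T P)) atTop (𝓝 0) ∧
    Tendsto (fun k => eLpNorm (fun ω => J k ω - I ω) 2 P) atTop (𝓝 0)

lemma ENNReal.tendsto_zero_of_le {f g : ℕ → ℝ≥0∞} (hg : Tendsto g atTop (𝓝 0))
    (h : ∀ k, f k ≤ g k) : Tendsto f atTop (𝓝 0) :=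
  tendsto_of_tendsto_of_tendsto_of_le_of_le tendsto_const_nhds hg (fun _ => zero_le) h

lemma IsElementary.isL2Ito (hW : IsBrownianMotion W P T) {S : ℝ × Ω → Vec m} {J : Ω → ℝ}
    (h : IsElementary W P T S J) : IsL2Ito W P T S J :=
  ⟨h.memLp_process.1, (h.memLp_integral hW).1, fun _ => S, fun _ => J, fun _ => h, by simp,
    by simp⟩

namespace IsL2Ito

variable {ψ ψ' : ℝ × Ω → Vec m} {I I' : Ω → ℝ}

lemma add (hW : IsBrownianMotion W P T) (h : IsL2Ito W P T ψ I) (h' : IsL2Ito W P T ψ' I') :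
    IsL2Ito W P T (fun p => ψ p + ψ' p) (fun ω => I ω + I' ω) := by
  obtain ⟨S, J, hE, h1, h2⟩ := h.approx
  obtain ⟨S', J', hE', h1', h2'⟩ := h'.approx
  refine ⟨h.integrand.add h'.integrand, h.integral.add h'.integral, _, _,
    fun k => (hE k).add (hE' k), ?_, ?_⟩
  · refine ENNReal.tendsto_zero_of_le (by simpa using h1.add h1') fun k => ?_
    simp only [add_sub_add_comm]
    exact eLpNorm_add_le ((hE k).memLp_process.1.sub h.integrand)
      ((hE' k).memLp_process.1.sub h'.integrand) (by simp)
  · refine ENNReal.tendsto_zero_of_le (by simpa using h2.add h2') fun k => ?_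
    simp only [add_sub_add_comm]
    exact eLpNorm_add_le (((hE k).memLp_integral hW).1.sub h.integral)
      (((hE' k).memLp_integral hW).1.sub h'.integral) (by simp)

lemma neg (h : IsL2Ito W P T ψ I) : IsL2Ito W P T (fun p => -ψ p) (fun ω => -I ω) := by
  obtain ⟨S, J, hE, h1, h2⟩ := h.approx
  refine ⟨h.integrand.neg, h.integral.neg, _, _, fun k => (hE k).neg, ?_, ?_⟩
  · refine h1.congr fun k => ?_
    rw [← eLpNorm_neg]; congr 1; ext1 p; simp; abel
  · refine h2.congr fun k => ?_
    rw [← eLpNorm_neg]; congr 1; ext1 p; simp; ring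

lemma sub (hW : IsBrownianMotion W P T) (h : IsL2Ito W P T ψ I) (h' : IsL2Ito W P T ψ' I') :
    IsL2Ito W P T (fun p => ψ p - ψ' p) (fun ω => I ω - I' ω) := by
  simpa only [sub_eq_add_neg] using h.add hW h'.neg

lemma sum (hW : IsBrownianMotion W P T) {ι : Type*} (s : Finset ι) {ψ : ι → ℝ × Ω → Vec m}
    {I : ι → Ω → ℝ} (h : ∀ i ∈ s, IsL2Ito W P T (ψ i) (I i)) :
    IsL2Ito W P T (fun p => ∑ i ∈ s, ψ i p) (fun ω => ∑ i ∈ s, I i ω) := by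
  classical
  induction s using Finset.induction_on with
  | empty => simpa using IsElementary.zero.isL2Ito hW
  | insert i s hi ih =>
    simp only [Finset.sum_insert hi]
    exact (h i (Finset.mem_insert_self i s)).add hW
      (ih fun j hj => h j (Finset.mem_insert_of_mem hj))

/-- The isometry passes to the limit by the triangle inequality. The inequality is enough here,
since it serves only to bound errors. -/
lemma eLpNorm_le (hW : IsBrownianMotion W P T) (h : IsL2Ito W P T ψ I) :
    eLpNorm I 2 P ≤ eLpNorm ψ 2 (timeMeasure T P) := by
  obtain ⟨S, J, hE, h1, h2⟩ := h.approx
  have hk : ∀ k, eLpNorm I 2 P ≤ eLpNorm ψ 2 (timeMeasure T P)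
      + (eLpNorm (fun p => S k p - ψ p) 2 (timeMeasure T P)
        + eLpNorm (fun ω => J k ω - I ω) 2 P) := fun k => by
    have a1 : eLpNorm I 2 P ≤ eLpNorm (J k) 2 P + eLpNorm (fun ω => J k ω - I ω) 2 P := by
      have := eLpNorm_sub_le (p := 2) ((hE k).memLp_integral hW).1
        (((hE k).memLp_integral hW).1.sub h.integral) (by simp)
      rwa [sub_sub_cancel] at this
    have a2 : eLpNorm (S k) 2 (timeMeasure T P) ≤ eLpNorm ψ 2 (timeMeasure T P)
        + eLpNorm (fun p => S k p - ψ p) 2 (timeMeasure T P) := by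
      have := eLpNorm_add_le (p := 2) h.integrand
        ((hE k).memLp_process.1.sub h.integrand) (by simp)
      rwa [add_sub_cancel] at this
    rw [(hE k).eLpNorm_integral hW] at a1
    rw [← add_assoc]
    exact a1.trans (add_le_add_left a2 _)
  refine ge_of_tendsto' (x := atTop) ?_ hk
  simpa using (h1.add h2).const_add (eLpNorm ψ 2 (timeMeasure T P))

/-- Multiplication by a bounded factor known at the beginning of the support of the integrand. -/
lemma smul (hW : IsBrownianMotion W P T) (h : IsL2Ito W P T ψ I) {s t : ℝ}
    (hsT : s ≤ T) (hψ : ∀ p : ℝ × Ω, p.1 ∉ Ioc s t → ψ p = 0) {θ : Ω → ℝ}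
    (hθ : Measurable[augmentedSigma W P s] θ) {C : ℝ} (hC : ∀ ω, |θ ω| ≤ C) :
    IsL2Ito W P T (fun p => θ p.2 • ψ p) (fun ω => θ ω * I ω) := by
  obtain ⟨S, J, hE, h1, h2⟩ := h.approx
  have hle := hW.augmentedSigma_le hsT
  choose J' hJ' hθJ' using fun k => (hE k).exists_restrict (t := t) hθ hC hle
  have hθm : AEStronglyMeasurable θ P := (hθ.mono hle le_rfl).aestronglyMeasurable
  -- Since `ψ` vanishes off `(s, t]`, cutting the approximants to `(s, t]` cannot increase their
  -- error.
  have k1 : ∀ k, eLpNorm (fun p => (Ioc s t).indicator (fun _ => S k p) p.1 - ψ p) 2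
      (timeMeasure T P) ≤ eLpNorm (fun p => S k p - ψ p) 2 (timeMeasure T P) := fun k => by
    refine eLpNorm_mono fun p => ?_
    by_cases hp : p.1 ∈ Ioc s t
    · rw [indicator_of_mem hp]
    · rw [indicator_of_notMem hp, hψ p hp]; simp
  -- By the isometry, `J' k - J k` has the norm of the discarded part of `S k`, which is at most
  -- twice the approximation error.
  have k2 : ∀ k, eLpNorm (fun ω => J' k ω - I ω) 2 P
      ≤ (eLpNorm (fun p => S k p - ψ p) 2 (timeMeasure T P)
        + eLpNorm (fun p => S k p - ψ p) 2 (timeMeasure T P))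
        + eLpNorm (fun ω => J k ω - I ω) 2 P := fun k => by
    have b1 : eLpNorm (fun ω => J' k ω - I ω) 2 P ≤ eLpNorm (fun ω => J' k ω - J k ω) 2 P
        + eLpNorm (fun ω => J k ω - I ω) 2 P := by
      have := eLpNorm_add_le (p := 2) (((hJ' k).sub (hE k)).memLp_integral hW).1
        (((hE k).memLp_integral hW).1.sub h.integral) (by simp)
      refine le_trans (le_of_eq ?_) this
      congr 1; ext1 ω; simp
    refine b1.trans (add_le_add_left ?_ _)
    rw [((hJ' k).sub (hE k)).eLpNorm_integral hW]
    refine le_trans ?_ (add_le_add_left (k1 k) _)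
    have := eLpNorm_sub_le (p := 2) ((hJ' k).memLp_process.1.sub h.integrand)
      ((hE k).memLp_process.1.sub h.integrand) (by simp)
    refine le_trans (le_of_eq ?_) this
    congr 1; ext1 ω; simp
  have c1 : Tendsto (fun k => ENNReal.ofReal C * eLpNorm (fun p => S k p - ψ p) 2
      (timeMeasure T P)) atTop (𝓝 0) := by
    simpa using ENNReal.Tendsto.const_mul h1 (Or.inr ENNReal.ofReal_ne_top)
  have c2 : Tendsto (fun k => ENNReal.ofReal C * ((eLpNorm (fun p => S k p - ψ p) 2
        (timeMeasure T P) + eLpNorm (fun p => S k p - ψ p) 2 (timeMeasure T P))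
        + eLpNorm (fun ω => J k ω - I ω) 2 P)) atTop (𝓝 0) := by
    simpa using ENNReal.Tendsto.const_mul ((h1.add h1).add h2) (Or.inr ENNReal.ofReal_ne_top)
  refine ⟨hθm.comp_snd.smul h.integrand, hθm.mul h.integral, _, _, hθJ', ?_, ?_⟩
  · refine ENNReal.tendsto_zero_of_le c1 fun k => le_trans ?_ (mul_le_mul_right (k1 k) _)
    refine eLpNorm_le_mul_eLpNorm_of_ae_le_mul (ae_of_all _ fun p => ?_) 2
    rw [← smul_sub, norm_smul]
    exact mul_le_mul_of_nonneg_right (hC _) (norm_nonneg _)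
  · refine ENNReal.tendsto_zero_of_le c2 fun k => le_trans ?_ (mul_le_mul_right (k2 k) _)
    refine eLpNorm_le_mul_eLpNorm_of_ae_le_mul (ae_of_all _ fun p => ?_) 2
    rw [← mul_sub, norm_mul]
    exact mul_le_mul_of_nonneg_right (hC _) (norm_nonneg _)

/-- By the isometry the elementary integrals are Cauchy in `L²` as soon as the integrands converge;
the limit in probability then has to be the `L²` limit. -/
lemma of_tendstoInMeasure (hW : IsBrownianMotion W P T)
    (hψ : AEStronglyMeasurable ψ (timeMeasure T P)) {S : ℕ → ℝ × Ω → Vec m} {J : ℕ → Ω → ℝ}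
    (hE : ∀ k, IsElementary W P T (S k) (J k))
    (h1 : Tendsto (fun k => eLpNorm (fun p => S k p - ψ p) 2 (timeMeasure T P)) atTop (𝓝 0))
    (h2 : TendstoInMeasure P J atTop I) : IsL2Ito W P T ψ I := by
  have hJm : ∀ k, AEStronglyMeasurable (J k) P := fun k => ((hE k).memLp_integral hW).1
  have hI : AEStronglyMeasurable I P := h2.aestronglyMeasurable hJm
  refine ⟨hψ, hI, S, J, hE, h1, ?_⟩
  have hb : ∀ k l, eLpNorm (fun ω => J k ω - J l ω) 2 P
      ≤ eLpNorm (fun p => S k p - ψ p) 2 (timeMeasure T P)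
        + eLpNorm (fun p => S l p - ψ p) 2 (timeMeasure T P) := fun k l => by
    rw [((hE k).sub (hE l)).eLpNorm_integral hW]
    have := eLpNorm_sub_le (p := 2) ((hE k).memLp_process.1.sub hψ)
      ((hE l).memLp_process.1.sub hψ) (by simp)
    refine le_trans (le_of_eq ?_) this
    congr 1; ext1 ω; simp
  rw [ENNReal.tendsto_nhds_zero] at h1 ⊢
  intro ε hε
  have hε2 : 0 < ε / 2 := ENNReal.half_pos hε.ne'
  filter_upwards [h1 _ hε2] with k hk
  -- Lower semicontinuity of the norm under convergence in measure lets `l → ∞` in the Cauchy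
  -- estimate.
  refine eLpNorm_le_of_tendstoInMeasure (u := atTop) (f := fun l ω => J k ω - J l ω) ?_ ?_
    fun l => (hJm k).sub (hJm l)
  · filter_upwards [h1 _ hε2] with l hl
    exact (hb k l).trans ((add_le_add hk hl).trans (ENNReal.add_halves ε).le)
  · intro δ hδ
    refine (h2 δ hδ).congr fun l => ?_
    congr 1; ext ω
    simp only [mem_ofPred_eq, edist_dist, Real.dist_eq, sub_sub_sub_cancel_left]
    rw [abs_sub_comm]

end IsL2Ito

end ElementaryProcesses

/-! ### Simple processes stopped before their energy exceeds a level. -/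

section Truncation

set_option linter.unusedSectionVars false

lemma eLpNorm_two_sq {α E : Type*} {mα : MeasurableSpace α} [NormedAddCommGroup E]
    (μ : Measure α) (f : α → E) : eLpNorm f 2 μ ^ 2 = ∫⁻ x, ‖f x‖ₑ ^ 2 ∂μ := by
  have := eLpNorm_nnreal_pow_eq_lintegral (μ := μ) (f := f) (p := 2) (by norm_num)
  simpa using this

lemma tendsto_eLpNorm_two_zero {α E : Type*} {mα : MeasurableSpace α} [NormedAddCommGroup E]
    {μ : Measure α} {f : ℕ → α → E}
    (h : Tendsto (fun k => ∫⁻ x, ‖f k x‖ₑ ^ 2 ∂μ) atTop (𝓝 0)) :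
    Tendsto (fun k => eLpNorm (f k) 2 μ) atTop (𝓝 0) := by
  have h1 := (ENNReal.continuous_rpow_const (y := 1 / 2)).tendsto 0 |>.comp h
  rw [ENNReal.zero_rpow_of_pos (by norm_num)] at h1
  refine h1.congr fun k => ?_
  simp only [Function.comp]
  rw [← eLpNorm_two_sq, ← ENNReal.rpow_natCast, ← ENNReal.rpow_mul]
  norm_num

lemma sum_indicator_Ioc_eq {E : Type*} [AddCommMonoid E] {τ : ℕ → ℝ} (hτ : Monotone τ) {N k : ℕ}
    (hk : k < N) {r : ℝ} (hr : r ∈ Ioc (τ k) (τ (k + 1))) (v : ℕ → E) :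
    ∑ j ∈ Finset.range N, (Ioc (τ j) (τ (j + 1))).indicator (fun _ => v j) r = v k := by
  rw [Finset.sum_eq_single k, indicator_of_mem hr]
  · intro j _ hjk
    refine indicator_of_notMem (fun hj => ?_) _
    rcases lt_or_gt_of_ne hjk with h | h
    · exact absurd (hj.2.trans (hτ h)) (not_le.2 hr.1)
    · exact absurd (hr.2.trans (hτ h)) (not_le.2 hj.1)
  · exact fun h => absurd (Finset.mem_range.2 hk) h

lemma enorm_sq_sum_indicator_Ioc {E : Type*} [NormedAddCommGroup E] {τ : ℕ → ℝ}
    (hτ : Monotone τ) (N : ℕ) (v : ℕ → E) (r : ℝ) :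
    ‖∑ j ∈ Finset.range N, (Ioc (τ j) (τ (j + 1))).indicator (fun _ => v j) r‖ₑ ^ 2
      = ∑ j ∈ Finset.range N, (Ioc (τ j) (τ (j + 1))).indicator (fun _ => ‖v j‖ₑ ^ 2) r := by
  by_cases h : ∃ k < N, r ∈ Ioc (τ k) (τ (k + 1))
  · obtain ⟨k, hk, hr⟩ := h
    rw [sum_indicator_Ioc_eq hτ hk hr, sum_indicator_Ioc_eq hτ hk hr]
  · push Not at h
    rw [Finset.sum_eq_zero fun j hj =>
        indicator_of_notMem (h j (Finset.mem_range.1 hj)) _,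
      Finset.sum_eq_zero fun j hj => indicator_of_notMem (h j (Finset.mem_range.1 hj)) _]
    simp

lemma lintegral_sum_indicator_Ioc {τ : ℕ → ℝ} {s : ℝ} (hmem : ∀ k, τ k ∈ Icc 0 s) (N : ℕ)
    (v : ℕ → ℝ≥0∞) :
    ∫⁻ r in Icc 0 s, ∑ j ∈ Finset.range N, (Ioc (τ j) (τ (j + 1))).indicator (fun _ => v j) r
      = ∑ j ∈ Finset.range N, v j * ENNReal.ofReal (τ (j + 1) - τ j) := by
  rw [lintegral_finsetSum _ fun j _ => measurable_const.indicator measurableSet_Ioc]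
  refine Finset.sum_congr rfl fun j _ => ?_
  rw [lintegral_indicator measurableSet_Ioc, Measure.restrict_restrict measurableSet_Ioc,
    inter_eq_left.2 (show Ioc (τ j) (τ (j + 1)) ⊆ Icc 0 s from
      fun r hr => ⟨(hmem j).1.trans hr.1.le, hr.2.trans (hmem _).2⟩)]
  simp

/-- If the last term is kept, the full partial sum is at most `K` and dominates everything kept; if
it is dropped, the induction hypothesis applies. -/
lemma sum_ite_partialSum_le (a : ℕ → ℝ≥0∞) (K : ℝ≥0∞) (N : ℕ) :
    ∑ j ∈ Finset.range N, (if ∑ i ∈ Finset.range (j + 1), a i ≤ K then a j else 0) ≤ K := by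
  induction N with
  | zero => simp
  | succ N ih =>
    rw [Finset.sum_range_succ]
    split_ifs with h
    · refine le_trans (add_le_add_left (Finset.sum_le_sum fun j _ => ?_) _)
        ((Finset.sum_range_succ a N).symm.le.trans h)
      split_ifs <;> simp
    · simpa using ih

lemma enorm_sub_sq_le {E : Type*} [NormedAddCommGroup E] (x y : E) :
    ‖x - y‖ₑ ^ 2 ≤ 2 * ‖x‖ₑ ^ 2 + 2 * ‖y‖ₑ ^ 2 := by
  have h1 : ‖x - y‖ₑ ≤ ‖x‖ₑ + ‖y‖ₑ := enorm_sub_le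
  have h2 : (‖x‖ + ‖y‖) ^ 2 ≤ 2 * ‖x‖ ^ 2 + 2 * ‖y‖ ^ 2 := by
    nlinarith [sq_nonneg (‖x‖ - ‖y‖)]
  refine (pow_le_pow_left' h1 2).trans ?_
  simp only [← ofReal_norm]
  rw [← ENNReal.ofReal_add (norm_nonneg _) (norm_nonneg _), ← ENNReal.ofReal_pow (by positivity),
    ← ENNReal.ofReal_pow (by positivity), ← ENNReal.ofReal_pow (by positivity),
    show (2 : ℝ≥0∞) = ENNReal.ofReal 2 by simp, ← ENNReal.ofReal_mul (by positivity),
    ← ENNReal.ofReal_mul (by positivity), ← ENNReal.ofReal_add (by positivity) (by positivity)]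
  exact ENNReal.ofReal_le_ofReal h2

variable {Ω : Type*} {m : ℕ} [mΩ : MeasurableSpace Ω] {W : ℝ → Ω → Vec m} {P : Measure Ω} {T : ℝ}

namespace SimpleProcess

variable {s : ℝ}

/-- The energy of a simple process up to time `τ_k`. -/
noncomputable def energy {𝓕 : ℝ → MeasurableSpace Ω} (S : SimpleProcess 𝓕 m 0 s) (k : ℕ) (ω : Ω) :
    ℝ≥0∞ :=
  ∑ j ∈ Finset.range k, ‖S.ξ j ω‖ₑ ^ 2 * ENNReal.ofReal (S.τ (j + 1) - S.τ j)

lemma lintegral_process {𝓕 : ℝ → MeasurableSpace Ω} (S : SimpleProcess 𝓕 m 0 s) (ω : Ω) :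
    ∫⁻ r in Icc 0 s, ‖S.process r ω‖ₑ ^ 2 = S.energy S.N ω := by
  simp only [process, enorm_sq_sum_indicator_Ioc S.τ_mono]
  rw [lintegral_sum_indicator_Ioc S.τ_mem]
  rfl

open Classical in
/-- The coefficients of a simple process stopped before its energy exceeds `K`. -/
noncomputable def stopped {𝓕 : ℝ → MeasurableSpace Ω} (S : SimpleProcess 𝓕 m 0 s) (K : ℝ≥0∞)
    (j : ℕ) (ω : Ω) : Vec m :=
  if S.energy (j + 1) ω ≤ K then S.ξ j ω else 0

lemma measurable_energy (S : SimpleProcess (augmentedSigma W P) m 0 s) (k : ℕ) {r : ℝ}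
    (hr : ∀ j < k, S.τ j ≤ r) : Measurable[augmentedSigma W P r] (S.energy k) := by
  refine Finset.measurable_fun_sum _ fun j hj => ?_
  have h : Measurable[augmentedSigma W P r] (S.ξ j) :=
    (S.ξ_measurable j).mono (augmentedSigma_mono (hr j (Finset.mem_range.1 hj))) le_rfl
  exact ((show Measurable (fun x : Vec m => ‖x‖ₑ ^ 2 *
    ENNReal.ofReal (S.τ (j + 1) - S.τ j)) by fun_prop).comp h)

/-- The times are deterministic, so the energy through the `j`-th step involves only `ξ_0, …, ξ_j`
and is known at `τ_j`. One can thus stop before the level is crossed, without overshoot. -/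
lemma measurable_stopped (S : SimpleProcess (augmentedSigma W P) m 0 s) (K : ℝ≥0∞) (j : ℕ) :
    Measurable[augmentedSigma W P (S.τ j)] (S.stopped K j) := by
  refine Measurable.ite ?_ (S.ξ_measurable j) measurable_const
  exact measurableSet_le (S.measurable_energy (j + 1) fun i hi =>
    S.τ_mono (Nat.lt_succ_iff.1 hi)) measurable_const

/-- The simple process stopped before its energy exceeds `K`. -/
noncomputable def stoppedIntegrand {𝓕 : ℝ → MeasurableSpace Ω} (S : SimpleProcess 𝓕 m 0 s)
    (K : ℝ≥0∞) (p : ℝ × Ω) : Vec m :=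
  ∑ j ∈ Finset.range S.N, stepIntegrand (S.τ j) (S.τ (j + 1)) (S.stopped K j) p

/-- The integral of the simple process stopped before its energy exceeds `K`. -/
noncomputable def stoppedIntegral {𝓕 : ℝ → MeasurableSpace Ω} (S : SimpleProcess 𝓕 m 0 s)
    (W : ℝ → Ω → Vec m) (K : ℝ≥0∞) (ω : Ω) : ℝ :=
  ∑ j ∈ Finset.range S.N, inner ℝ (S.stopped K j ω) (W (S.τ (j + 1)) ω - W (S.τ j) ω)

lemma energy_mono {𝓕 : ℝ → MeasurableSpace Ω} (S : SimpleProcess 𝓕 m 0 s) (ω : Ω) :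
    Monotone fun k => S.energy k ω := fun _ _ h =>
  Finset.sum_le_sum_of_subset (Finset.range_subset_range.2 h)

lemma stopped_eq {𝓕 : ℝ → MeasurableSpace Ω} (S : SimpleProcess 𝓕 m 0 s) {K : ℝ≥0∞} {ω : Ω}
    (h : S.energy S.N ω ≤ K) {j : ℕ} (hj : j < S.N) : S.stopped K j ω = S.ξ j ω :=
  if_pos ((S.energy_mono ω hj).trans h)

lemma stoppedIntegrand_eq {𝓕 : ℝ → MeasurableSpace Ω} (S : SimpleProcess 𝓕 m 0 s) {K : ℝ≥0∞}
    {ω : Ω} (h : S.energy S.N ω ≤ K) (r : ℝ) : S.stoppedIntegrand K (r, ω) = S.process r ω :=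
  Finset.sum_congr rfl fun j hj => by
    rw [stepIntegrand, S.stopped_eq h (Finset.mem_range.1 hj)]

lemma stoppedIntegral_eq {𝓕 : ℝ → MeasurableSpace Ω} (S : SimpleProcess 𝓕 m 0 s) {K : ℝ≥0∞}
    {ω : Ω} (h : S.energy S.N ω ≤ K) : S.stoppedIntegral W K ω = S.integral W ω :=
  Finset.sum_congr rfl fun j hj => by rw [S.stopped_eq h (Finset.mem_range.1 hj)]

lemma lintegral_stoppedIntegrand_le {𝓕 : ℝ → MeasurableSpace Ω} (S : SimpleProcess 𝓕 m 0 s)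
    (K : ℝ≥0∞) (ω : Ω) : ∫⁻ r in Icc 0 s, ‖S.stoppedIntegrand K (r, ω)‖ₑ ^ 2 ≤ K := by
  simp only [stoppedIntegrand, stepIntegrand, enorm_sq_sum_indicator_Ioc S.τ_mono]
  rw [lintegral_sum_indicator_Ioc S.τ_mem]
  refine le_trans (Finset.sum_le_sum fun j _ => ?_) (sum_ite_partialSum_le
    (fun j => ‖S.ξ j ω‖ₑ ^ 2 * ENNReal.ofReal (S.τ (j + 1) - S.τ j)) K S.N)
  by_cases h : S.energy (j + 1) ω ≤ K
  · rw [stopped, if_pos h, if_pos (by exact h)]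
  · rw [stopped, if_neg h]; simp

lemma stoppedIntegrand_eq_zero {𝓕 : ℝ → MeasurableSpace Ω} (S : SimpleProcess 𝓕 m 0 s)
    (K : ℝ≥0∞) (ω : Ω) {r : ℝ} (hr : r ∉ Ioc 0 s) : S.stoppedIntegrand K (r, ω) = 0 :=
  Finset.sum_eq_zero fun j _ => indicator_of_notMem
    (fun h => hr ⟨(S.τ_mem j).1.trans_lt h.1, h.2.trans (S.τ_mem _).2⟩) _

variable [IsProbabilityMeasure P]

lemma memLp_ξ (hW : IsBrownianMotion W P T) (hs : s ≤ T)
    (S : SimpleProcess (augmentedSigma W P) m 0 s) (j : ℕ) : MemLp (S.ξ j) 2 P := by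
  obtain ⟨C, hC⟩ := S.ξ_bounded
  exact MemLp.of_bound ((S.ξ_measurable j).mono (hW.augmentedSigma_le
    ((S.τ_mem j).2.trans hs)) le_rfl).aestronglyMeasurable C (ae_of_all _ (hC j))

lemma isElementary_sum {N : ℕ} {τ : ℕ → ℝ} (hτ : Monotone τ) (hmem : ∀ k, τ k ∈ Icc 0 T)
    {ξ : ℕ → Ω → Vec m} (hξ : ∀ j < N, Measurable[augmentedSigma W P (τ j)] (ξ j))
    (hξ2 : ∀ j < N, MemLp (ξ j) 2 P) :
    IsElementary W P T (fun p => ∑ j ∈ Finset.range N, stepIntegrand (τ j) (τ (j + 1)) (ξ j) p)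
      (fun ω => ∑ j ∈ Finset.range N, inner ℝ (ξ j ω) (W (τ (j + 1)) ω - W (τ j) ω)) := by
  induction N with
  | zero => simpa using IsElementary.zero
  | succ N ih =>
    simp only [Finset.sum_range_succ]
    exact (ih (fun j hj => hξ j (hj.trans N.lt_succ_self))
      fun j hj => hξ2 j (hj.trans N.lt_succ_self)).add
      (IsElementary.step (hmem N).1 (hτ N.le_succ) (hmem _).2 (hξ N N.lt_succ_self)
        (hξ2 N N.lt_succ_self))

lemma isElementary_stopped (hW : IsBrownianMotion W P T) (hs : s ≤ T)
    (S : SimpleProcess (augmentedSigma W P) m 0 s) (K : ℝ≥0∞) :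
    IsElementary W P T (S.stoppedIntegrand K) (S.stoppedIntegral W K) := by
  refine isElementary_sum S.τ_mono (fun k => ⟨(S.τ_mem k).1, (S.τ_mem k).2.trans hs⟩)
    (fun j _ => S.measurable_stopped K j) fun j _ => ?_
  refine (S.memLp_ξ hW hs j).mono ((S.measurable_stopped K j).mono (hW.augmentedSigma_le
    ((S.τ_mem j).2.trans hs)) le_rfl).aestronglyMeasurable (ae_of_all _ fun ω => ?_)
  rw [stopped]
  split_ifs <;> simp

end SimpleProcess

end Truncation

/-! ### From limits in probability to limits in `L²`. -/

section ItoIntegralL2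

set_option linter.unusedSectionVars false

lemma setLIntegral_Icc_of_support_Ioc {s T : ℝ} (hs : s ≤ T) {f g : ℝ → ℝ≥0∞}
    (h : ∀ r ∈ Ioc 0 s, f r = g r) (h0 : ∀ r ∉ Ioc 0 s, f r = 0) :
    ∫⁻ r in Icc 0 T, f r = ∫⁻ r in Icc 0 s, g r := by
  have hf : f = (Ioc 0 s).indicator g := by
    ext r
    by_cases hr : r ∈ Ioc 0 s
    · rw [h r hr, indicator_of_mem hr]
    · rw [h0 r hr, indicator_of_notMem hr]
  rw [hf, lintegral_indicator measurableSet_Ioc, Measure.restrict_restrict measurableSet_Ioc,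
    inter_eq_left.2 (show Ioc 0 s ⊆ Icc 0 T from fun r hr => ⟨hr.1.le, hr.2.trans hs⟩)]
  exact setLIntegral_congr Ioc_ae_eq_Icc

variable {Ω : Type*} {m : ℕ} [mΩ : MeasurableSpace Ω] {W : ℝ → Ω → Vec m} {P : Measure Ω} {T : ℝ}

lemma IsProgressiveOn.aemeasurable_path {E : Type*} [MeasurableSpace E]
    {𝓕 : ℝ → MeasurableSpace Ω} {a b : ℝ} {Y : ℝ → Ω → E} (h : IsProgressiveOn 𝓕 a b Y)
    {t : ℝ} (ht : t ∈ Icc a b) (ω : Ω) :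
    AEMeasurable (fun r => Y r ω) (volume.restrict (Icc a t)) :=
  aemeasurable_restrict_of_measurable_subtype measurableSet_Icc
    ((h t ht).comp (@measurable_prodMk_right _ _ _ (𝓕 t) ω))

lemma SimpleProcess.measurable_path {𝓕 : ℝ → MeasurableSpace Ω} {s : ℝ}
    (S : SimpleProcess 𝓕 m 0 s) (ω : Ω) : Measurable (fun r => S.process r ω) :=
  Finset.measurable_fun_sum _ fun _ _ => measurable_const.indicator measurableSet_Ioc

lemma SimpleProcess.measurable_stoppedPath {𝓕 : ℝ → MeasurableSpace Ω} {s : ℝ}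
    (S : SimpleProcess 𝓕 m 0 s) (K : ℝ≥0∞) (ω : Ω) :
    Measurable (fun r => S.stoppedIntegrand K (r, ω)) :=
  Finset.measurable_fun_sum _ fun j _ => by
    change Measurable ((Ioc _ _).indicator fun _ => S.stopped K j ω)
    exact measurable_const.indicator measurableSet_Ioc

lemma SimpleProcess.energy_le {𝓕 : ℝ → MeasurableSpace Ω} {s : ℝ} (S : SimpleProcess 𝓕 m 0 s)
    {φ : ℝ → Vec m} (hφ : AEMeasurable φ (volume.restrict (Icc 0 s))) (ω : Ω) :
    S.energy S.N ω ≤ 2 * (∫⁻ r in Icc 0 s, ‖S.process r ω - φ r‖ₑ ^ 2)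
      + 2 * ∫⁻ r in Icc 0 s, ‖φ r‖ₑ ^ 2 := by
  rw [← S.lintegral_process, ← lintegral_const_mul' _ _ (by simp),
    ← lintegral_const_mul' _ _ (by simp),
    ← lintegral_add_right' _ ((hφ.enorm.pow_const 2).const_mul 2)]
  refine lintegral_mono fun r => ?_
  have := enorm_sub_sq_le (S.process r ω - φ r) (-φ r)
  simpa using this

lemma SimpleProcess.lintegral_stoppedIntegrand_sub_le {𝓕 : ℝ → MeasurableSpace Ω} {s : ℝ}
    (S : SimpleProcess 𝓕 m 0 s) (φ : ℝ → Vec m) (K : ℝ≥0∞) (ω : Ω) :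
    ∫⁻ r in Icc 0 s, ‖S.stoppedIntegrand K (r, ω) - φ r‖ₑ ^ 2
      ≤ 2 * K + 2 * ∫⁻ r in Icc 0 s, ‖φ r‖ₑ ^ 2 := by
  have h1 : ∫⁻ r in Icc 0 s, ‖S.stoppedIntegrand K (r, ω) - φ r‖ₑ ^ 2
      ≤ ∫⁻ r in Icc 0 s, (2 * ‖S.stoppedIntegrand K (r, ω)‖ₑ ^ 2 + 2 * ‖φ r‖ₑ ^ 2) :=
    lintegral_mono fun r => enorm_sub_sq_le _ _
  rw [lintegral_add_left (((S.measurable_stoppedPath K ω).enorm.pow_const 2).const_mul 2),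
    lintegral_const_mul' _ _ (by simp), lintegral_const_mul' _ _ (by simp)] at h1
  refine h1.trans (add_le_add_left (mul_le_mul_right (S.lintegral_stoppedIntegrand_le K ω) 2) _)

variable [IsProbabilityMeasure P]

lemma lintegral_le_const_add {f g : Ω → ℝ≥0∞} {c : ℝ≥0∞} (h : ∀ ω, f ω ≤ c + g ω) :
    ∫⁻ ω, f ω ∂P ≤ c + ∫⁻ ω, g ω ∂P := by
  have := lintegral_mono (μ := P) h
  rwa [lintegral_add_left measurable_const, lintegral_const, measure_univ, mul_one] at this

lemma exists_nat_tail_le {Q : Ω → ℝ≥0∞} (hQ : AEMeasurable Q P) (hQi : ∫⁻ ω, Q ω ∂P ≠ ∞) :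
    Tendsto (fun q : ℕ => P {ω | (q : ℝ≥0∞) ≤ Q ω}) atTop (𝓝 0) := by
  have h1 : Tendsto (fun q : ℕ => (∫⁻ ω, Q ω ∂P) * (q : ℝ≥0∞)⁻¹) atTop (𝓝 0) := by
    simpa using ENNReal.Tendsto.const_mul ENNReal.tendsto_inv_nat_nhds_zero (Or.inr hQi)
  refine tendsto_of_tendsto_of_tendsto_of_le_of_le' tendsto_const_nhds h1
    (Eventually.of_forall fun _ => zero_le) ?_
  filter_upwards [eventually_gt_atTop 0] with q hq
  have h := mul_meas_ge_le_lintegral₀ hQ (q : ℝ≥0∞)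
  rw [← div_eq_mul_inv, ENNReal.le_div_iff_mul_le (Or.inl (by simpa using hq.ne'))
    (Or.inl (by simp)), mul_comm]
  exact h

/-- For a square integrable integrand, the Itô integral of the definition (a limit in probability)
is the limit in `L²` of elementary integrals. -/
lemma IsItoIntegral.isL2Ito (hW : IsBrownianMotion W P T) {s : ℝ} (hs0 : 0 ≤ s) (hs : s ≤ T)
    {φ : ℝ → Ω → Vec m} {D : Ω → ℝ} (h : IsItoIntegral W P 0 s φ D)
    (hφ : MemLp (fun p : ℝ × Ω => (Ioc 0 s).indicator (fun _ => φ p.1 p.2) p.1) 2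
      (timeMeasure T P)) :
    IsL2Ito W P T (fun p : ℝ × Ω => (Ioc 0 s).indicator (fun _ => φ p.1 p.2) p.1) D := by
  set ψ : ℝ × Ω → Vec m := fun p => (Ioc 0 s).indicator (fun _ => φ p.1 p.2) p.1 with hψ
  obtain ⟨S, hS1, hS2⟩ := h.limit
  set Q : Ω → ℝ≥0∞ := fun ω => ∫⁻ r in Icc 0 s, ‖φ r ω‖ₑ ^ 2 with hQ
  set R : ℕ → Ω → ℝ≥0∞ := fun k ω => ∫⁻ r in Icc 0 s, ‖(S k).process r ω - φ r ω‖ₑ ^ 2 with hR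
  have hψQ : ∀ ω, ∫⁻ r in Icc 0 T, ‖ψ (r, ω)‖ₑ ^ 2 = Q ω := fun ω =>
    setLIntegral_Icc_of_support_Ioc hs (fun r hr => by simp [hψ, indicator_of_mem hr])
      (fun r hr => by simp [hψ, indicator_of_notMem hr])
  have hψS : ∀ k K ω, ∫⁻ r in Icc 0 T, ‖(S k).stoppedIntegrand K (r, ω) - ψ (r, ω)‖ₑ ^ 2
      = ∫⁻ r in Icc 0 s, ‖(S k).stoppedIntegrand K (r, ω) - φ r ω‖ₑ ^ 2 := fun k K ω =>
    setLIntegral_Icc_of_support_Ioc hs (fun r hr => by simp [hψ, indicator_of_mem hr])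
      (fun r hr => by
        simp [hψ, indicator_of_notMem hr, (S k).stoppedIntegrand_eq_zero K ω hr])
  have hQm : AEMeasurable Q P := by
    have := (hφ.1.enorm.pow_const 2).lintegral_prod_left'
    exact this.congr (ae_of_all _ hψQ)
  have hQi : ∫⁻ ω, Q ω ∂P ≠ ∞ := by
    have h1 := eLpNorm_two_sq (timeMeasure T P) ψ
    rw [lintegral_prod_symm _ (hφ.1.enorm.pow_const 2)] at h1
    simp only [hψQ] at h1
    rw [← h1]
    exact ENNReal.pow_ne_top hφ.2.ne
  have hpath : ∀ ω, AEMeasurable (fun r => φ r ω) (volume.restrict (Icc 0 s)) := fun ω =>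
    h.progressive.aemeasurable_path ⟨hs0, le_rfl⟩ ω
  -- The level `4 q` comes from `energy ≤ 2 R + 2 Q`: when `R` and `Q` are below `q`, truncation at
  -- `4 q` changes nothing.
  have hgood : ∀ (k q : ℕ) (η : ℝ≥0∞) (ω : Ω), η ≤ q → R k ω < η → Q ω < q →
      (S k).energy (S k).N ω ≤ 4 * (q : ℝ≥0∞) := fun k q η ω hη hRω hQω => by
    refine ((S k).energy_le (hpath ω) ω).trans ?_
    calc 2 * R k ω + 2 * Q ω ≤ 2 * (q : ℝ≥0∞) + 2 * q := by
          gcongr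
          exact hRω.le.trans hη
      _ = 4 * (q : ℝ≥0∞) := by rw [← add_mul]; norm_num
  -- `Ω` is split into the good event, where the error is `R k < η`, and two exceptional ones. On
  -- `{q ≤ Q}` the crude bound `2 (4 q) + 2 Q` is at most `10 Q`, which is integrable. Measurable
  -- hulls replace the exceptional events.
  have hkey : ∀ (k q : ℕ) (η : ℝ≥0∞), η ≤ q →
      eLpNorm (fun p => (S k).stoppedIntegrand (4 * q) p - ψ p) 2 (timeMeasure T P) ^ 2
        ≤ η + ((∫⁻ ω in toMeasurable P {ω | η ≤ R k ω}, (2 * (4 * q) + 2 * Q ω) ∂P)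
          + ∫⁻ ω in toMeasurable P {ω | (q : ℝ≥0∞) ≤ Q ω}, 10 * Q ω ∂P) := by
    intro k q η hη
    have hm : AEMeasurable (fun p => ‖(S k).stoppedIntegrand (4 * q) p - ψ p‖ₑ ^ 2)
        (timeMeasure T P) :=
      (((S k).isElementary_stopped hW hs (4 * q)).memLp_process.1.sub hφ.1).enorm.pow_const 2
    rw [eLpNorm_two_sq, lintegral_prod_symm _ hm]
    simp only [hψS]
    rw [← lintegral_indicator (measurableSet_toMeasurable _ _),
      ← lintegral_indicator (measurableSet_toMeasurable _ _),
      ← lintegral_add_left' (((hQm.const_mul 2).const_add _).indicator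
        (measurableSet_toMeasurable _ _))]
    refine lintegral_le_const_add fun ω => ?_
    by_cases h1 : η ≤ R k ω
    · rw [indicator_of_mem (subset_toMeasurable P _ h1)]
      refine ((S k).lintegral_stoppedIntegrand_sub_le (fun r => φ r ω) _ ω).trans ?_
      exact le_add_left le_self_add
    · by_cases h2 : (q : ℝ≥0∞) ≤ Q ω
      · rw [indicator_of_mem (s := toMeasurable P {ω | (q : ℝ≥0∞) ≤ Q ω})
          (subset_toMeasurable P _ h2)]
        refine ((S k).lintegral_stoppedIntegrand_sub_le (fun r => φ r ω) _ ω).trans ?_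
        refine le_add_left (le_add_left ?_)
        calc 2 * (4 * (q : ℝ≥0∞)) + 2 * Q ω ≤ 2 * (4 * Q ω) + 2 * Q ω := by gcongr
          _ = 10 * Q ω := by rw [← mul_assoc, ← add_mul]; norm_num
      · push Not at h1 h2
        have he := hgood k q η ω hη h1 h2
        simp only [(S k).stoppedIntegrand_eq he]
        exact le_add_right h1.le
  have hex : ∀ i : ℕ, ∃ q k : ℕ,
      eLpNorm (fun p => (S k).stoppedIntegrand (4 * q) p - ψ p) 2 (timeMeasure T P) ^ 2
        ≤ 3 * ((i : ℝ≥0∞) + 1)⁻¹ ∧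
      P {ω | ((i : ℝ≥0∞) + 1)⁻¹ ≤ edist ((S k).stoppedIntegral W (4 * q) ω) (D ω)}
        ≤ 3 * ((i : ℝ≥0∞) + 1)⁻¹ := by
    intro i
    set ε : ℝ≥0∞ := ((i : ℝ≥0∞) + 1)⁻¹ with hε
    have hε0 : 0 < ε := by simp [hε]
    have hε1 : ε ≤ 1 := by
      rw [hε, ENNReal.inv_le_one]; simp
    have t1 := exists_nat_tail_le hQm hQi
    have t2 : Tendsto (fun q : ℕ => ∫⁻ ω in toMeasurable P {ω | (q : ℝ≥0∞) ≤ Q ω},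
        10 * Q ω ∂P) atTop (𝓝 0) := by
      refine tendsto_setLIntegral_zero ?_ ?_
      · rw [lintegral_const_mul' _ _ (by simp)]
        exact ENNReal.mul_ne_top (by simp) hQi
      · refine t1.congr fun q => ?_
        simp [measure_toMeasurable]
    -- The order matters: `q` is fixed first, by the tail of `Q`; then `k` is taken large depending
    -- on `q`, since the bound on `{ε ≤ R k}` contains `q`.
    obtain ⟨q, hq1, hq2, hq3⟩ := (((ENNReal.tendsto_nhds_zero.1 t1) ε hε0).and
      (((ENNReal.tendsto_nhds_zero.1 t2) ε hε0).and (eventually_ge_atTop 1))).exists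
    have hεq : ε ≤ q := hε1.trans (by exact_mod_cast hq3)
    have t3 : Tendsto (fun k => P {ω | ε ≤ R k ω}) atTop (𝓝 0) := hS1 ε hε0
    have t4 : Tendsto (fun k => ∫⁻ ω in toMeasurable P {ω | ε ≤ R k ω},
        (2 * (4 * q) + 2 * Q ω) ∂P) atTop (𝓝 0) := by
      refine tendsto_setLIntegral_zero ?_ ?_
      · rw [lintegral_add_left measurable_const, lintegral_const, measure_univ, mul_one,
          lintegral_const_mul' _ _ (by simp)]
        exact ENNReal.add_ne_top.2 ⟨ENNReal.mul_ne_top (by simp) (ENNReal.mul_ne_top (by simp)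
          (by simp)), ENNReal.mul_ne_top (by simp) hQi⟩
      · refine t3.congr fun q => ?_
        simp [measure_toMeasurable]
    have t5 := hS2 ε hε0
    obtain ⟨k, hk1, hk2, hk3⟩ := (((ENNReal.tendsto_nhds_zero.1 t3) ε hε0).and
      (((ENNReal.tendsto_nhds_zero.1 t4) ε hε0).and
        ((ENNReal.tendsto_nhds_zero.1 t5) ε hε0))).exists
    have h3 : ε + (ε + ε) = 3 * ε := by ring
    refine ⟨q, k, (hkey k q ε hεq).trans ?_, ?_⟩
    · rw [← h3]
      exact add_le_add le_rfl (add_le_add hk2 hq2)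
    · have hsub : {ω | ε ≤ edist ((S k).stoppedIntegral W (4 * q) ω) (D ω)}
          ⊆ {ω | ε ≤ R k ω} ∪ ({ω | (q : ℝ≥0∞) ≤ Q ω} ∪
            {ω | ε ≤ edist ((S k).integral W ω) (D ω)}) := by
        intro ω hω
        by_cases h1 : ε ≤ R k ω
        · exact Or.inl h1
        by_cases h2 : (q : ℝ≥0∞) ≤ Q ω
        · exact Or.inr (Or.inl h2)
        push Not at h1 h2
        refine Or.inr (Or.inr ?_)
        have he := hgood k q ε ω hεq h1 h2
        rw [mem_ofPred_eq, (S k).stoppedIntegral_eq he] at hω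
        exact hω
      refine (measure_mono hsub).trans ((measure_union_le _ _).trans ?_)
      rw [← h3]
      exact add_le_add hk1 ((measure_union_le _ _).trans (add_le_add hq1 hk3))
  choose q k h1 h2 using hex
  have hlim : Tendsto (fun i : ℕ => 3 * ((i : ℝ≥0∞) + 1)⁻¹) atTop (𝓝 0) := by
    have := (ENNReal.tendsto_inv_nat_nhds_zero).comp (tendsto_add_atTop_nat 1)
    have h3 := ENNReal.Tendsto.const_mul (a := 3) this (Or.inr (by simp))
    simpa [Function.comp_def] using h3
  refine IsL2Ito.of_tendstoInMeasure hW hφ.1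
    (fun i => (S (k i)).isElementary_stopped hW hs (4 * q i)) ?_ ?_
  · refine tendsto_eLpNorm_two_zero ?_
    refine ENNReal.tendsto_zero_of_le hlim fun i => ?_
    rw [← eLpNorm_two_sq]
    exact h1 i
  · intro δ hδ
    have hsmall : ∀ᶠ i : ℕ in atTop, ((i : ℝ≥0∞) + 1)⁻¹ ≤ δ := by
      have := (ENNReal.tendsto_inv_nat_nhds_zero).comp (tendsto_add_atTop_nat 1)
      have h3 := (ENNReal.tendsto_nhds_zero.1 this) δ hδ
      simpa [Function.comp_def] using h3
    refine tendsto_of_tendsto_of_tendsto_of_le_of_le' tendsto_const_nhds hlim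
      (Eventually.of_forall fun _ => zero_le) ?_
    filter_upwards [hsmall] with i hi
    exact (measure_mono fun ω hω => hi.trans hω).trans (h2 i)

end ItoIntegralL2

/-! ### Uniform grids. -/

section Grid

/-- The points `k t / N`, `k ≤ N`, of the uniform grid on `[0, t]` (constant for `k ≥ N`). -/
noncomputable def grid (t : ℝ) (N k : ℕ) : ℝ := ((min k N : ℕ) : ℝ) / N * t

variable {t : ℝ} {N : ℕ}

lemma grid_zero : grid t N 0 = 0 := by simp [grid]

lemma grid_self (hN : 0 < N) : grid t N N = t := by
  have : (N : ℝ) ≠ 0 := by exact_mod_cast hN.ne'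
  simp [grid, div_self this]

lemma grid_mono (ht : 0 ≤ t) : Monotone (grid t N) := fun i j hij => by
  unfold grid
  gcongr

lemma grid_mem (ht : 0 ≤ t) (k : ℕ) : grid t N k ∈ Icc 0 t := by
  refine ⟨by unfold grid; positivity, ?_⟩
  rcases Nat.eq_zero_or_pos N with h | h
  · simpa [grid, h] using ht
  · have h0 : (0 : ℝ) < N := by exact_mod_cast h
    have : ((min k N : ℕ) : ℝ) / N ≤ 1 := by
      rw [div_le_one h0]
      exact_mod_cast min_le_right k N
    unfold grid
    nlinarith

lemma grid_succ_sub {k : ℕ} (hk : k < N) : grid t N (k + 1) - grid t N k = t / N := by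
  unfold grid
  rw [min_eq_left hk.le, min_eq_left (Nat.succ_le_of_lt hk)]
  push_cast
  ring

/-- The cell ends at the first grid point that is not below `r`; this is not the initial point, as
`r > 0`. -/
lemma exists_mem_Ioc_grid (hN : 0 < N) {r : ℝ} (hr : r ∈ Ioc 0 t) :
    ∃ k < N, r ∈ Ioc (grid t N k) (grid t N (k + 1)) := by
  have hex : ∃ j, r ≤ grid t N j := ⟨N, by rw [grid_self hN]; exact hr.2⟩
  classical
  have h1 := Nat.find_spec hex
  have h0 : Nat.find hex ≠ 0 := fun h => by
    rw [h, grid_zero] at h1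
    exact absurd hr.1 (not_lt.2 h1)
  obtain ⟨k, hk⟩ := Nat.exists_eq_succ_of_ne_zero h0
  refine ⟨k, ?_, ?_, ?_⟩
  · have : Nat.find hex ≤ N := Nat.find_min' hex (by rw [grid_self hN]; exact hr.2)
    omega
  · exact not_le.1 (Nat.find_min hex (by omega))
  · rw [hk] at h1; exact h1

lemma tendsto_div_nat (t : ℝ) : Tendsto (fun N : ℕ => t / N) atTop (𝓝 0) :=
  tendsto_const_nhds.div_atTop tendsto_natCast_atTop_atTop

end Grid

/-! ### Left-point approximation of Itô integrals of continuous processes. -/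

section ItoIncrements

set_option linter.unusedSectionVars false

variable {Ω : Type*} {m : ℕ} [mΩ : MeasurableSpace Ω] {W : ℝ → Ω → Vec m} {P : Measure Ω} {T : ℝ}

/-- An adapted process with continuous paths on `[0, T]` and square integrable supremum, together
with its Itô integrals `D s = ∫_0^s ψ dW`. -/
structure IsContinuousIto (W : ℝ → Ω → Vec m) (P : Measure Ω) (T : ℝ) (ψ : ℝ → Ω → Vec m)
    (D : ℝ → Ω → ℝ) : Prop where
  measurable : ∀ s ∈ Icc 0 T, Measurable[augmentedSigma W P s] (ψ s)
  continuous : ∀ᵐ ω ∂P, ContinuousOn (fun s => ψ s ω) (Icc 0 T)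
  bound : ∃ Z : Ω → ℝ, MemLp Z 2 P ∧ ∀ᵐ ω ∂P, ∀ s ∈ Icc 0 T, ‖ψ s ω‖ ≤ Z ω
  ito : ∀ s ∈ Icc 0 T, IsL2Ito W P T
    (fun p : ℝ × Ω => (Ioc 0 s).indicator (fun _ => ψ p.1 p.2) p.1) (D s)

/-- The process `1_{(s, t]} (ψ - ψ_s)`. -/
noncomputable def incrementIntegrand (ψ : ℝ → Ω → Vec m) (s t : ℝ) (p : ℝ × Ω) : Vec m :=
  (Ioc s t).indicator (fun _ => ψ p.1 p.2 - ψ s p.2) p.1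

/-- The difference between `∫_s^t ψ dW` and `ψ_s ⬝ (W_t - W_s)`. -/
noncomputable def incrementError (W : ℝ → Ω → Vec m) (ψ : ℝ → Ω → Vec m) (D : ℝ → Ω → ℝ)
    (s t : ℝ) (ω : Ω) : ℝ :=
  D t ω - D s ω - inner ℝ (ψ s ω) (W t ω - W s ω)

/-- The difference, on `(0, t]`, between `ψ` and its left-point discretization. -/
noncomputable def gridError (ψ : ℝ → Ω → Vec m) (t : ℝ) (N : ℕ) (p : ℝ × Ω) : Vec m :=
  ∑ k ∈ Finset.range N, incrementIntegrand ψ (grid t N k) (grid t N (k + 1)) p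

lemma gridError_eq {ψ : ℝ → Ω → Vec m} {t : ℝ} (ht : 0 ≤ t) {N k : ℕ} (hk : k < N)
    {p : ℝ × Ω} (hp : p.1 ∈ Ioc (grid t N k) (grid t N (k + 1))) :
    gridError ψ t N p = ψ p.1 p.2 - ψ (grid t N k) p.2 :=
  sum_indicator_Ioc_eq (grid_mono ht) hk hp fun j => ψ p.1 p.2 - ψ (grid t N j) p.2

lemma incrementIntegrand_eq_zero {ψ : ℝ → Ω → Vec m} {s t : ℝ} {p : ℝ × Ω} (hp : p.1 ∉ Ioc s t) :
    incrementIntegrand ψ s t p = 0 := indicator_of_notMem hp _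

lemma gridError_eq_zero {ψ : ℝ → Ω → Vec m} {t : ℝ} (ht : 0 ≤ t) {N : ℕ}
    {p : ℝ × Ω} (hp : p.1 ∉ Ioc 0 t) : gridError ψ t N p = 0 :=
  Finset.sum_eq_zero fun k _ => incrementIntegrand_eq_zero fun h =>
    hp ⟨(grid_mem ht k).1.trans_lt h.1, h.2.trans (grid_mem ht _).2⟩

lemma norm_gridError_le {ψ : ℝ → Ω → Vec m} {t : ℝ} (ht : 0 ≤ t) (htT : t ≤ T) (N : ℕ)
    {p : ℝ × Ω} {z : ℝ} (hz : ∀ s ∈ Icc 0 T, ‖ψ s p.2‖ ≤ z) :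
    ‖gridError ψ t N p‖ ≤ 2 * z := by
  have hz0 : 0 ≤ z := (norm_nonneg _).trans (hz 0 ⟨le_rfl, ht.trans htT⟩)
  rcases Nat.eq_zero_or_pos N with hN | hN
  · simp [gridError, hN, hz0]
  by_cases hp : p.1 ∈ Ioc 0 t
  · obtain ⟨k, hk, hkp⟩ := exists_mem_Ioc_grid hN hp
    rw [gridError_eq ht hk hkp]
    refine (norm_sub_le _ _).trans ?_
    have h1 := hz p.1 ⟨hp.1.le, hp.2.trans htT⟩
    have h2 := hz (grid t N k) ⟨(grid_mem ht k).1, (grid_mem ht k).2.trans htT⟩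
    linarith
  · rw [gridError_eq_zero ht hp]; simpa using hz0

lemma tendsto_gridError {ψ : ℝ → Ω → Vec m} {t : ℝ} (ht : 0 ≤ t) (htT : t ≤ T) {p : ℝ × Ω}
    (hc : ContinuousOn (fun s => ψ s p.2) (Icc 0 T)) :
    Tendsto (fun N => gridError ψ t N p) atTop (𝓝 0) := by
  by_cases hp : p.1 ∈ Ioc 0 t
  · rw [Metric.tendsto_nhds]
    intro ε hε
    obtain ⟨δ, hδ, h⟩ := Metric.continuousOn_iff.1 hc p.1 ⟨hp.1.le, hp.2.trans htT⟩ ε hε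
    filter_upwards [(tendsto_div_nat t).eventually (gt_mem_nhds hδ), eventually_gt_atTop 0]
      with N hN hN0
    obtain ⟨k, hk, hkp⟩ := exists_mem_Ioc_grid hN0 hp
    rw [gridError_eq ht hk hkp, dist_zero_right, ← dist_eq_norm, dist_comm]
    refine h _ ⟨(grid_mem ht k).1, (grid_mem ht k).2.trans htT⟩ ?_
    rw [Real.dist_eq, abs_sub_comm, abs_of_pos (sub_pos.2 hkp.1)]
    have := grid_succ_sub (t := t) hk
    linarith [hkp.2]
  · simp only [gridError_eq_zero ht hp]
    exact tendsto_const_nhds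

variable [IsProbabilityMeasure P]

namespace IsContinuousIto

variable {ψ : ℝ → Ω → Vec m} {D : ℝ → Ω → ℝ}

lemma memLp (hW : IsBrownianMotion W P T) (h : IsContinuousIto W P T ψ D) {s : ℝ}
    (hs : s ∈ Icc 0 T) : MemLp (ψ s) 2 P := by
  obtain ⟨Z, hZ, hb⟩ := h.bound
  refine hZ.mono ((h.measurable s hs).mono (hW.augmentedSigma_le hs.2)
    le_rfl).aestronglyMeasurable ?_
  filter_upwards [hb] with ω hω
  exact (hω s hs).trans (le_abs_self _)

/-- By linearity: `1_{(0,t]} ψ - 1_{(0,s]} ψ - 1_{(s,t]} ψ_s = 1_{(s,t]} (ψ - ψ_s)`. -/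
lemma isL2Ito_increment (hW : IsBrownianMotion W P T) (h : IsContinuousIto W P T ψ D)
    {s t : ℝ} (hs : 0 ≤ s) (hst : s ≤ t) (ht : t ≤ T) :
    IsL2Ito W P T (incrementIntegrand ψ s t) (incrementError W ψ D s t) := by
  have hsm : s ∈ Icc 0 T := ⟨hs, hst.trans ht⟩
  have h1 := ((h.ito t ⟨hs.trans hst, ht⟩).sub hW (h.ito s hsm)).sub hW
    ((IsElementary.step hs hst ht (h.measurable s hsm) (h.memLp hW hsm)).isL2Ito hW)
  convert h1 using 1
  swap
  · rfl
  ext1 p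
  by_cases hp : p.1 ∈ Ioc s t
  · have h2 : p.1 ∈ Ioc 0 t := ⟨hs.trans_lt hp.1, hp.2⟩
    have h3 : p.1 ∉ Ioc 0 s := fun h => absurd hp.1 (not_lt.2 h.2)
    rw [incrementIntegrand, stepIntegrand, indicator_of_mem hp, indicator_of_mem hp,
      indicator_of_mem h2, indicator_of_notMem h3, sub_zero]
  · rw [incrementIntegrand_eq_zero hp, stepIntegrand, indicator_of_notMem hp, sub_zero]
    by_cases h2 : p.1 ∈ Ioc 0 s
    · rw [indicator_of_mem h2, indicator_of_mem (Ioc_subset_Ioc_right hst h2), sub_self]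
    · have h3 : p.1 ∉ Ioc 0 t := fun h3 => by
        rcases lt_or_ge s p.1 with h4 | h4
        · exact hp ⟨h4, h3.2⟩
        · exact h2 ⟨h3.1, h4⟩
      rw [indicator_of_notMem h2, indicator_of_notMem h3, sub_self]

variable {t : ℝ}

lemma aestronglyMeasurable_gridError (hW : IsBrownianMotion W P T)
    (h : IsContinuousIto W P T ψ D) (ht : 0 ≤ t) (htT : t ≤ T) (N : ℕ) :
    AEStronglyMeasurable (gridError ψ t N) (timeMeasure T P) :=
  Finset.aestronglyMeasurable_fun_sum _ fun k _ =>
    (h.isL2Ito_increment hW (grid_mem ht k).1 (grid_mono ht k.le_succ)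
      ((grid_mem ht _).2.trans htT)).integrand

/-- Dominated convergence: the discretization converges pointwise along continuous paths, and twice
the square integrable bound on the supremum dominates it. -/
lemma tendsto_eLpNorm_gridError (hW : IsBrownianMotion W P T)
    (h : IsContinuousIto W P T ψ D) (ht : 0 ≤ t) (htT : t ≤ T) :
    Tendsto (fun N => eLpNorm (gridError ψ t N) 2 (timeMeasure T P)) atTop (𝓝 0) := by
  obtain ⟨Z, hZ, hb⟩ := h.bound
  have hq : Measure.QuasiMeasurePreserving (Prod.snd : ℝ × Ω → Ω) (timeMeasure T P) P :=
    Measure.quasiMeasurePreserving_snd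
  refine tendsto_eLpNorm_two_zero ?_
  have hlim : ∫⁻ _ : ℝ × Ω, (0 : ℝ≥0∞) ∂(timeMeasure T P) = 0 := by simp
  rw [← hlim]
  refine tendsto_lintegral_of_dominated_convergence' (fun p : ℝ × Ω => ‖2 * Z p.2‖ₑ ^ 2)
    (fun N => (h.aestronglyMeasurable_gridError hW ht htT N).enorm.pow_const 2) ?_ ?_ ?_
  · intro N
    filter_upwards [hq.ae hb] with p hp
    refine pow_le_pow_left' ?_ 2
    rw [enorm_le_iff_norm_le]
    exact (norm_gridError_le ht htT N hp).trans (le_abs_self _)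
  · rw [← eLpNorm_two_sq]
    exact ENNReal.pow_ne_top ((hZ.const_mul 2).comp_snd (volume.restrict (Icc 0 T))).2.ne
  · filter_upwards [hq.ae h.continuous] with p hp
    have h1 := ENNReal.Tendsto.pow (n := 2) (tendsto_gridError ht htT hp).enorm
    simpa using h1

/-- Weights known at the left endpoints make the whole sum a single Itô integral. Its integrand is
at most `C` times `gridError` pointwise because the cells are disjoint, so that no factor `N` is
lost. -/
lemma eLpNorm_sum_mul_incrementError_le (hW : IsBrownianMotion W P T)
    (h : IsContinuousIto W P T ψ D) (ht : 0 ≤ t) (htT : t ≤ T) (N : ℕ) {c : ℕ → Ω → ℝ} {C : ℝ}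
    (hc : ∀ k < N, Measurable[augmentedSigma W P (grid t N k)] (c k))
    (hC : ∀ k < N, ∀ ω, |c k ω| ≤ C) :
    eLpNorm (fun ω => ∑ k ∈ Finset.range N,
        c k ω * incrementError W ψ D (grid t N k) (grid t N (k + 1)) ω) 2 P
      ≤ ENNReal.ofReal C * eLpNorm (gridError ψ t N) 2 (timeMeasure T P) := by
  have h1 := IsL2Ito.sum hW (Finset.range N) (ψ := fun k p => c k p.2 •
      incrementIntegrand ψ (grid t N k) (grid t N (k + 1)) p)
    (I := fun k ω => c k ω * incrementError W ψ D (grid t N k) (grid t N (k + 1)) ω)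
    fun k hk => (h.isL2Ito_increment hW (grid_mem ht k).1 (grid_mono ht k.le_succ)
      ((grid_mem ht _).2.trans htT)).smul hW ((grid_mem ht k).2.trans htT)
      (fun p hp => incrementIntegrand_eq_zero hp) (hc k (Finset.mem_range.1 hk))
      (hC k (Finset.mem_range.1 hk))
  refine (h1.eLpNorm_le hW).trans ?_
  refine eLpNorm_le_mul_eLpNorm_of_ae_le_mul (ae_of_all _ fun p => ?_) 2
  by_cases hp : ∃ k < N, p.1 ∈ Ioc (grid t N k) (grid t N (k + 1))
  · obtain ⟨k, hk, hkp⟩ := hp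
    rw [gridError_eq ht hk hkp, Finset.sum_eq_single k, norm_smul, incrementIntegrand,
      indicator_of_mem hkp]
    · exact mul_le_mul_of_nonneg_right (hC k hk p.2) (norm_nonneg _)
    · intro j hj hjk
      rw [incrementIntegrand_eq_zero, smul_zero]
      intro hjp
      rcases lt_or_gt_of_ne hjk with h | h
      · exact absurd (hjp.2.trans (grid_mono ht h)) (not_le.2 hkp.1)
      · exact absurd (hkp.2.trans (grid_mono ht h)) (not_le.2 hjp.1)
    · exact fun h => absurd (Finset.mem_range.2 hk) h
  · push Not at hp
    rw [gridError, Finset.sum_eq_zero, Finset.sum_eq_zero]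
    · simp
    · exact fun k hk => incrementIntegrand_eq_zero (hp k (Finset.mem_range.1 hk))
    · intro k hk
      rw [incrementIntegrand_eq_zero (hp k (Finset.mem_range.1 hk)), smul_zero]

/-- The norm estimate is applied in each cell and summed over disjoint cells. This controls the
errors at second order in Itô's formula, the preceding lemma those at first order. -/
lemma lintegral_sum_incrementError_sq_le (hW : IsBrownianMotion W P T)
    (h : IsContinuousIto W P T ψ D) (ht : 0 ≤ t) (htT : t ≤ T) (N : ℕ) :
    ∫⁻ ω, ∑ k ∈ Finset.range N,
        ‖incrementError W ψ D (grid t N k) (grid t N (k + 1)) ω‖ₑ ^ 2 ∂P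
      ≤ eLpNorm (gridError ψ t N) 2 (timeMeasure T P) ^ 2 := by
  have hI := fun k => h.isL2Ito_increment hW (grid_mem (N := N) ht k).1 (grid_mono ht k.le_succ)
      ((grid_mem ht (k + 1)).2.trans htT)
  rw [eLpNorm_two_sq, lintegral_finsetSum' _ fun k _ => (hI k).integral.enorm.pow_const 2]
  have h2 : ∀ p, ‖gridError ψ t N p‖ₑ ^ 2 = ∑ k ∈ Finset.range N,
      ‖incrementIntegrand ψ (grid t N k) (grid t N (k + 1)) p‖ₑ ^ 2 := fun p => by
    refine (enorm_sq_sum_indicator_Ioc (grid_mono ht) N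
      (fun k => ψ p.1 p.2 - ψ (grid t N k) p.2) p.1).trans ?_
    refine Finset.sum_congr rfl fun k _ => ?_
    by_cases hp : p.1 ∈ Ioc (grid t N k) (grid t N (k + 1))
    · rw [incrementIntegrand, indicator_of_mem hp, indicator_of_mem hp]
    · rw [incrementIntegrand, indicator_of_notMem hp, indicator_of_notMem hp]; simp
  simp only [h2]
  rw [lintegral_finsetSum' _ fun k _ => (hI k).integrand.enorm.pow_const 2]
  refine Finset.sum_le_sum fun k _ => ?_
  rw [← eLpNorm_two_sq, ← eLpNorm_two_sq]
  exact pow_le_pow_left' ((hI k).eLpNorm_le hW) 2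

end IsContinuousIto

end ItoIncrements

/-! ### Second and fourth moments of weighted sums of increments. -/

section MartingaleSums

set_option linter.unusedSectionVars false

variable {Ω : Type*} {m : ℕ} [mΩ : MeasurableSpace Ω] {W : ℝ → Ω → Vec m} {P : Measure Ω} {T : ℝ}

lemma MeasureTheory.MemLp.lintegral_enorm_sq {α : Type*} {mα : MeasurableSpace α} {μ : Measure α}
    {f : α → ℝ} (hf : MemLp f 2 μ) : ∫⁻ x, ‖f x‖ₑ ^ 2 ∂μ = ENNReal.ofReal (∫ x, f x ^ 2 ∂μ) := by
  rw [ofReal_integral_eq_lintegral_ofReal hf.integrable_sq (ae_of_all _ fun x => sq_nonneg _)]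
  refine lintegral_congr fun x => ?_
  rw [← ofReal_norm, ← ENNReal.ofReal_pow (norm_nonneg _), Real.norm_eq_abs, sq_abs]

/-- Pythagoras for martingale differences: each new term is orthogonal to the sum of the earlier
ones. -/
lemma integral_sq_sum_le_of_orthogonal {𝓕 : ℕ → MeasurableSpace Ω} (hmono : Monotone 𝓕)
    {N : ℕ} {Z : ℕ → Ω → ℝ} {B : ℝ} (hZ : ∀ k < N, MemLp (Z k) 2 P)
    (hm : ∀ k < N, Measurable[𝓕 (k + 1)] (Z k))
    (horth : ∀ k < N, ∀ ζ : Ω → ℝ, Measurable[𝓕 k] ζ → MemLp ζ 2 P → ∫ ω, ζ ω * Z k ω ∂P = 0)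
    (hB : ∀ k < N, ∫ ω, Z k ω ^ 2 ∂P ≤ B) :
    ∫ ω, (∑ k ∈ Finset.range N, Z k ω) ^ 2 ∂P ≤ N * B := by
  induction N with
  | zero => simp
  | succ N ih =>
    have hN := N.lt_succ_self
    have hS : MemLp (fun ω => ∑ k ∈ Finset.range N, Z k ω) 2 P :=
      memLp_finsetSum _ fun k hk => hZ k ((Finset.mem_range.1 hk).trans hN)
    have hSm : Measurable[𝓕 N] (fun ω => ∑ k ∈ Finset.range N, Z k ω) :=
      Finset.measurable_fun_sum _ fun k hk => (hm k ((Finset.mem_range.1 hk).trans hN)).mono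
        (hmono (Finset.mem_range.1 hk)) le_rfl
    have he : ∀ ω, (∑ k ∈ Finset.range (N + 1), Z k ω) ^ 2
        = (∑ k ∈ Finset.range N, Z k ω) ^ 2
          + 2 * ((∑ k ∈ Finset.range N, Z k ω) * Z N ω) + Z N ω ^ 2 := fun ω => by
      rw [Finset.sum_range_succ]; ring
    have i1 : Integrable (fun ω => (∑ k ∈ Finset.range N, Z k ω) * Z N ω) P :=
      hS.integrable_mul (hZ N hN)
    simp only [he]
    have i2 : Integrable (fun ω => (∑ k ∈ Finset.range N, Z k ω) ^ 2
        + 2 * ((∑ k ∈ Finset.range N, Z k ω) * Z N ω)) P := hS.integrable_sq.add (i1.const_mul 2)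
    rw [integral_add i2 (hZ N hN).integrable_sq, integral_add hS.integrable_sq (i1.const_mul 2),
      integral_const_mul,
      horth N hN _ hSm hS]
    have := ih (fun k hk => hZ k (hk.trans hN)) (fun k hk => hm k (hk.trans hN))
      (fun k hk => horth k (hk.trans hN)) (fun k hk => hB k (hk.trans hN))
    have h2 := hB N hN
    push_cast
    linarith

namespace IsBrownianMotion

/-- The centered products of coordinates of an increment. -/
noncomputable def _root_.centeredProduct (W : ℝ → Ω → Vec m) (a b : Fin m) (s t : ℝ) (ω : Ω) : ℝ :=
  (W t ω - W s ω) a * (W t ω - W s ω) b - if a = b then t - s else 0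

/-- The fourth moment of the norm of a standard Gaussian vector. -/
noncomputable def _root_.gaussianFourthMoment (m : ℕ) : ℝ := ∫ x, ‖x‖ ^ 4 ∂(stdGaussian (Vec m))

variable [IsProbabilityMeasure P]

lemma integral_mul_centeredProduct (hW : IsBrownianMotion W P T) {s t : ℝ} (hs : 0 ≤ s)
    (hst : s ≤ t) (ht : t ≤ T) (a b : Fin m) {ζ : Ω → ℝ}
    (hζ : Measurable[augmentedSigma W P s] ζ) :
    ∫ ω, ζ ω * centeredProduct W a b s t ω ∂P = 0 := by
  have hΔ := hW.memLp_increment hs hst ht (p := 2) (by simp)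
  unfold centeredProduct
  rw [hW.integral_mul_increment hs hst ht hζ
    (f := fun x => x a * x b - if a = b then t - s else 0) (by fun_prop)]
  have hi : Integrable (fun ω => (W t ω - W s ω) a * (W t ω - W s ω) b) P :=
    (hΔ.vec_apply a).integrable_mul (hΔ.vec_apply b)
  rw [integral_sub hi (integrable_const _), hW.integral_increment_mul hs hst ht]
  simp

/-- The constant comes from `(u - v)² ≤ 2 u² + 2 v²`, with `u` bounded by the squared norm of the
increment and `v` equal to `t - s` or `0`. -/
lemma memLp_centeredProduct (hW : IsBrownianMotion W P T) {s t : ℝ} (hs : 0 ≤ s)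
    (hst : s ≤ t) (ht : t ≤ T) (a b : Fin m) : MemLp (centeredProduct W a b s t) 2 P ∧
    ∫ ω, centeredProduct W a b s t ω ^ 2 ∂P ≤ (2 * gaussianFourthMoment m + 2) * (t - s) ^ 2 := by
  have h4 := (hW.memLp_increment hs hst ht (p := 4) (by simp)).integrable_norm_pow (p := 4)
    (by simp)
  have hm : Measurable (centeredProduct W a b s t) := by
    have := hW.measurable_increment hs hst ht
    exact ((measurable_vec_apply this a).mul (measurable_vec_apply this b)).sub_const _
  have hle : ∀ ω, centeredProduct W a b s t ω ^ 2
      ≤ 2 * ‖W t ω - W s ω‖ ^ 4 + 2 * (t - s) ^ 2 := fun ω => by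
    set x := W t ω - W s ω with hx
    have ha : |x a| ≤ ‖x‖ := PiLp.norm_apply_le x a
    have hb : |x b| ≤ ‖x‖ := PiLp.norm_apply_le x b
    have hab : (x a * x b) ^ 2 ≤ ‖x‖ ^ 4 := by
      rw [← sq_abs, abs_mul]
      calc (|x a| * |x b|) ^ 2 ≤ (‖x‖ * ‖x‖) ^ 2 := by gcongr
        _ = ‖x‖ ^ 4 := by ring
    have hd : (if a = b then t - s else 0) ^ 2 ≤ (t - s) ^ 2 := by
      split_ifs
      · exact le_rfl
      · simpa using sq_nonneg (t - s)
    have h2 : centeredProduct W a b s t ω = x a * x b - if a = b then t - s else 0 := rfl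
    rw [h2]
    nlinarith [sq_nonneg (x a * x b + if a = b then t - s else 0)]
  have hint : Integrable (fun ω => 2 * ‖W t ω - W s ω‖ ^ 4 + 2 * (t - s) ^ 2) P :=
    (h4.const_mul 2).add (integrable_const _)
  have hL : MemLp (centeredProduct W a b s t) 2 P := by
    rw [memLp_two_iff_integrable_sq hm.aestronglyMeasurable]
    refine hint.mono' (hm.pow_const 2).aestronglyMeasurable (ae_of_all _ fun ω => ?_)
    rw [Real.norm_of_nonneg (sq_nonneg _)]
    exact hle ω
  refine ⟨hL, (integral_mono hL.integrable_sq hint hle).trans (le_of_eq ?_)⟩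
  rw [integral_add (h4.const_mul 2) (integrable_const _), integral_const_mul,
    hW.integral_norm_increment_pow_four hs hst ht]
  simp [gaussianFourthMoment]
  ring

/-- This is the law of large numbers behind the second order term: `N` orthogonal terms, each of
second moment `O(N⁻²)`, add up to `O(N⁻¹)`. -/
lemma lintegral_sq_sum_mul_centeredProduct_le (hW : IsBrownianMotion W P T) {t : ℝ} (ht : 0 ≤ t)
    (htT : t ≤ T) {N : ℕ} {c : ℕ → Ω → ℝ} {C : ℝ}
    (hc : ∀ k < N, Measurable[augmentedSigma W P (grid t N k)] (c k))
    (hC : ∀ k < N, ∀ ω, |c k ω| ≤ C) (a b : Fin m) :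
    ∫⁻ ω, ‖∑ k ∈ Finset.range N,
        c k ω * centeredProduct W a b (grid t N k) (grid t N (k + 1)) ω‖ₑ ^ 2 ∂P
      ≤ ENNReal.ofReal (N * (C ^ 2 * ((2 * gaussianFourthMoment m + 2) * (t / N) ^ 2))) := by
  have g0 := fun k => (grid_mem (N := N) ht k).1
  have g1 := fun k => grid_mono (N := N) ht (Nat.le_succ k)
  have g2 := fun k => (grid_mem (N := N) ht k).2.trans htT
  have hp := fun k => hW.memLp_centeredProduct (g0 k) (g1 k) (g2 (k + 1)) a b
  have hcm : ∀ k < N, AEStronglyMeasurable (c k) P := fun k hk =>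
    ((hc k hk).mono (hW.augmentedSigma_le (g2 k)) le_rfl).aestronglyMeasurable
  have hZ : ∀ k < N, MemLp (fun ω => c k ω *
      centeredProduct W a b (grid t N k) (grid t N (k + 1)) ω) 2 P := fun k hk => by
    refine (hp k).1.of_le_mul (c := C) ((hcm k hk).mul (hp k).1.1) (ae_of_all _ fun ω => ?_)
    rw [norm_mul]
    exact mul_le_mul_of_nonneg_right (hC k hk ω) (norm_nonneg _)
  have hS : MemLp (fun ω => ∑ k ∈ Finset.range N, c k ω *
      centeredProduct W a b (grid t N k) (grid t N (k + 1)) ω) 2 P :=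
    memLp_finsetSum _ fun k hk => hZ k (Finset.mem_range.1 hk)
  rw [hS.lintegral_enorm_sq]
  refine ENNReal.ofReal_le_ofReal ?_
  refine integral_sq_sum_le_of_orthogonal (𝓕 := fun k => augmentedSigma W P (grid t N k))
    (fun i j hij => augmentedSigma_mono (grid_mono ht hij)) hZ ?_ ?_ ?_
  · intro k hk
    have w1 : Measurable[augmentedSigma W P (grid t N (k + 1))] (W (grid t N (k + 1))) :=
      measurable_augmentedSigma (g0 _) le_rfl
    have w2 : Measurable[augmentedSigma W P (grid t N (k + 1))] (W (grid t N k)) :=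
      measurable_augmentedSigma (g0 _) (g1 k)
    have w3 : Measurable[augmentedSigma W P (grid t N (k + 1))]
      (fun ω => W (grid t N (k + 1)) ω - W (grid t N k) ω) := w1.sub w2
    have c1 : Measurable[augmentedSigma W P (grid t N (k + 1))] (c k) :=
      (hc k hk).mono (augmentedSigma_mono (g1 k)) le_rfl
    exact c1.mul (((measurable_vec_apply w3 a).mul (measurable_vec_apply w3 b)).sub
      measurable_const)
  · intro k hk ζ hζ _
    simp only [← mul_assoc]
    exact hW.integral_mul_centeredProduct (g0 k) (g1 k) (g2 (k + 1)) a b (hζ.mul (hc k hk))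
  · intro k hk
    have h1 : ∫ ω, (c k ω * centeredProduct W a b (grid t N k) (grid t N (k + 1)) ω) ^ 2 ∂P
        ≤ ∫ ω, C ^ 2 * centeredProduct W a b (grid t N k) (grid t N (k + 1)) ω ^ 2 ∂P := by
      refine integral_mono (hZ k hk).integrable_sq ((hp k).1.integrable_sq.const_mul _) fun ω => ?_
      simp only [mul_pow]
      refine mul_le_mul_of_nonneg_right ?_ (sq_nonneg _)
      rw [← sq_abs]
      exact pow_le_pow_left₀ (abs_nonneg _) (hC k hk ω) 2
    refine h1.trans ?_
    rw [integral_const_mul]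
    refine mul_le_mul_of_nonneg_left ((hp k).2.trans (le_of_eq ?_)) (sq_nonneg _)
    rw [grid_succ_sub hk]

/-- Fourth moments control the overshoot of a stopped left-point sum: each is of order `(t - s)²`,
so their sum over a grid vanishes in the limit. -/
lemma integral_inner_increment_pow_four_le (hW : IsBrownianMotion W P T) {s t : ℝ} (hs : 0 ≤ s)
    (hst : s ≤ t) (ht : t ≤ T) {ξ : Ω → Vec m} (hξ : Measurable ξ) {C : ℝ}
    (hC : ∀ ω, ‖ξ ω‖ ≤ C) :
    Integrable (fun ω => inner ℝ (ξ ω) (W t ω - W s ω) ^ 4) P ∧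
    ∫ ω, inner ℝ (ξ ω) (W t ω - W s ω) ^ 4 ∂P ≤ C ^ 4 * ((t - s) ^ 2 * gaussianFourthMoment m) := by
  have h4 := (hW.memLp_increment hs hst ht (p := 4) (by simp)).integrable_norm_pow (p := 4)
    (by simp)
  have hle : ∀ ω, inner ℝ (ξ ω) (W t ω - W s ω) ^ 4 ≤ C ^ 4 * ‖W t ω - W s ω‖ ^ 4 := fun ω => by
    rw [← Even.pow_abs (by decide : Even 4), ← mul_pow]
    refine pow_le_pow_left₀ (abs_nonneg _) ((abs_real_inner_le_norm _ _).trans ?_) 4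
    exact mul_le_mul_of_nonneg_right (hC ω) (norm_nonneg _)
  have hm : Measurable (fun ω => inner ℝ (ξ ω) (W t ω - W s ω) ^ 4) :=
    (hξ.inner (hW.measurable_increment hs hst ht)).pow_const 4
  have hi : Integrable (fun ω => inner ℝ (ξ ω) (W t ω - W s ω) ^ 4) P := by
    refine (h4.const_mul (C ^ 4)).mono' hm.aestronglyMeasurable (ae_of_all _ fun ω => ?_)
    rw [Real.norm_of_nonneg (by positivity)]
    exact hle ω
  refine ⟨hi, (integral_mono hi (h4.const_mul _) hle).trans (le_of_eq ?_)⟩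
  rw [integral_const_mul, hW.integral_norm_increment_pow_four hs hst ht]
  rfl

end IsBrownianMotion

end MartingaleSums

/-! ### Deterministic inequalities for stopped sums. -/

section StoppedSums

/-- The square of a sum stopped when its partial sums leave `[-L, L]`. -/
lemma sq_sum_stopped_le {q θ : ℕ → ℝ} {L : ℝ} (h01 : ∀ k, θ k = 0 ∨ θ k = 1)
    (hmono : ∀ k, θ k = 1 → ∀ j ≤ k, θ j = 1)
    (hL : ∀ k, θ k = 1 → |∑ j ∈ Finset.range k, q j| ≤ L) (N : ℕ) :
    (∑ j ∈ Finset.range N, θ j * q j) ^ 2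
      ≤ 2 * L ^ 2 + 2 + 2 * ∑ j ∈ Finset.range N, (θ j * q j) ^ 4 := by
  induction N with
  | zero => simp; positivity
  | succ N ih =>
    rw [Finset.sum_range_succ, Finset.sum_range_succ]
    rcases h01 N with h | h
    · simpa [h] using ih
    · have h1 : ∑ j ∈ Finset.range N, θ j * q j = ∑ j ∈ Finset.range N, q j :=
        Finset.sum_congr rfl fun j hj => by
          rw [hmono N h j (Finset.mem_range.1 hj).le, one_mul]
      have h2 : 0 ≤ ∑ j ∈ Finset.range N, (θ j * q j) ^ 4 :=
        Finset.sum_nonneg fun j _ => by positivity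
      have h3 : (∑ j ∈ Finset.range N, q j) ^ 2 ≤ L ^ 2 := by
        rw [← sq_abs]
        exact pow_le_pow_left₀ (abs_nonneg _) (hL N h) 2
      rw [h1, h, one_mul]
      set I := ∑ j ∈ Finset.range N, q j
      -- Before its last kept term the sum is within `[-L, L]`, so only that term can overshoot: `(I
      -- + q)² ≤ 2 I² + 2 q²` and `2 q² ≤ q⁴ + 1`.
      nlinarith [sq_nonneg (I - q N), sq_nonneg (q N ^ 2 - 1), sq_nonneg (q N ^ 2)]

/-- If the stopped sums of `q` stay within distance `1` of the values of a sequence `M` with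
`|M| ≤ L - 1`, then no stopping occurs. -/
lemma stopped_eq_one {q θ M : ℕ → ℝ} {L : ℝ} (h01 : ∀ k, θ k = 0 ∨ θ k = 1)
    (hM0 : M 0 = 0) {N : ℕ} (hM : ∀ k ≤ N, |M k| ≤ L - 1)
    (hθ : ∀ k < N, (∀ j ≤ k, |∑ i ∈ Finset.range j, q i| ≤ L) → θ k = 1)
    (hmono : ∀ k, θ k = 1 → ∀ j ≤ k, θ j = 1)
    (hL : ∀ k, θ k = 1 → |∑ j ∈ Finset.range k, q j| ≤ L)
    (hclose : |∑ j ∈ Finset.range N, θ j * (M (j + 1) - M j - q j)| ≤ 1) :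
    ∀ k < N, θ k = 1 := by
  by_contra! hcon
  classical
  have hex : ∃ k, k < N ∧ θ k ≠ 1 := by
    obtain ⟨k, hk, h⟩ := hcon; exact ⟨k, hk, h⟩
  obtain ⟨hK, hKθ⟩ := Nat.find_spec hex
  -- At the first index `K` with weight different from `1`, all earlier weights are `1` and all
  -- later ones `0`, so the weighted sum telescopes to `M K` minus the partial sum of `q`. Hence
  -- this partial sum is within `1` of `M K`, so at most `L` in absolute value, and stopping at `K`
  -- was not called for.
  set K := Nat.find hex with hKdef
  have hbelow : ∀ j < K, θ j = 1 := fun j hj => by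
    by_contra h
    exact Nat.find_min hex hj ⟨hj.trans hK, h⟩
  have habove : ∀ j, K ≤ j → θ j = 0 := fun j hj => by
    rcases h01 j with h | h
    · exact h
    · exact absurd (hmono j h K hj) hKθ
  have hpart : ∀ j ≤ K, ∑ i ∈ Finset.range N, (if i < j then θ i * (M (i + 1) - M i - q i) else 0)
      = M j - ∑ i ∈ Finset.range j, q i := fun j hj => by
    rw [← Finset.sum_filter]
    have : (Finset.range N).filter (· < j) = Finset.range j := by
      ext i
      simp only [Finset.mem_filter, Finset.mem_range]
      omega
    rw [this, Finset.sum_congr rfl fun i hi => by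
      rw [hbelow i ((Finset.mem_range.1 hi).trans_le hj), one_mul], Finset.sum_sub_distrib,
      Finset.sum_range_sub, hM0, sub_zero]
  have hclose' : |M K - ∑ i ∈ Finset.range K, q i| ≤ 1 := by
    rw [← hpart K le_rfl]
    refine le_of_eq_of_le ?_ hclose
    congr 1
    refine Finset.sum_congr rfl fun i _ => ?_
    split_ifs with h
    · rfl
    · rw [habove i (not_lt.1 h), zero_mul]
  refine hKθ (hθ K hK fun j hj => ?_)
  rcases hj.lt_or_eq with h | h
  · exact hL j (hbelow j h)
  · rw [h]
    have h1 := hM K hK.le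
    rw [abs_le] at h1 hclose' ⊢
    constructor <;> linarith [hclose'.1, hclose'.2, h1.1, h1.2]

end StoppedSums

/-! ### Taylor expansion of a `C^{1,2}` function. -/

section TaylorExpansion

variable {n : ℕ} {T : ℝ} {L : ℝ → Vec n → ℝ}

/-- The bilinear form of a matrix. -/
noncomputable def matrixForm (H : Matrix (Fin n) (Fin n) ℝ) (u v : Vec n) : ℝ :=
  ∑ i, ∑ j, H i j * (u i * v j)

/-- The sum of the absolute values of the entries of a matrix. -/
noncomputable def matrixAbs (H : Matrix (Fin n) (Fin n) ℝ) : ℝ := ∑ i, ∑ j, |H i j|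

lemma abs_matrixForm_le (H : Matrix (Fin n) (Fin n) ℝ) (u v : Vec n) :
    |matrixForm H u v| ≤ matrixAbs H * (‖u‖ * ‖v‖) := by
  rw [matrixForm, matrixAbs, Finset.sum_mul]
  refine (Finset.abs_sum_le_sum_abs _ _).trans (Finset.sum_le_sum fun i _ => ?_)
  rw [Finset.sum_mul]
  refine (Finset.abs_sum_le_sum_abs _ _).trans (Finset.sum_le_sum fun j _ => ?_)
  rw [abs_mul, abs_mul]
  have hu : |u i| ≤ ‖u‖ := PiLp.norm_apply_le u i
  have hv : |v j| ≤ ‖v‖ := PiLp.norm_apply_le v j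
  gcongr

lemma matrixForm_add_self (H : Matrix (Fin n) (Fin n) ℝ) (u v : Vec n) :
    matrixForm H (u + v) (u + v)
      = matrixForm H u u + matrixForm H u v + matrixForm H v u + matrixForm H v v := by
  simp only [matrixForm, ← Finset.sum_add_distrib, PiLp.add_apply]
  exact Finset.sum_congr rfl fun i _ => Finset.sum_congr rfl fun j _ => by ring

lemma matrixForm_sub (H H' : Matrix (Fin n) (Fin n) ℝ) (u v : Vec n) :
    matrixForm (H - H') u v = matrixForm H u v - matrixForm H' u v := by
  simp only [matrixForm, ← Finset.sum_sub_distrib, Matrix.sub_apply, sub_mul]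

lemma inner_spaceGrad (s : ℝ) (y h : Vec n) :
    inner ℝ (spaceGrad L s y) h = fderiv ℝ (L s) y h := by
  simp [spaceGrad, gradient]

lemma fderiv_fderiv_eq_matrixForm (s : ℝ) (y u v : Vec n) :
    fderiv ℝ (fderiv ℝ (L s)) y u v = matrixForm (spaceHess L s y) u v := by
  have hu : ∀ u : Vec n, u = ∑ i, u i • EuclideanSpace.single i (1 : ℝ) := fun u => by
    ext j
    simp [Finset.sum_apply, Pi.single_apply]
  conv_lhs => rw [hu u, hu v]
  simp only [map_sum, map_smul, sum_apply, smul_apply,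
    matrixForm, spaceHess, smul_eq_mul, Finset.mul_sum]
  rw [Finset.sum_comm]
  exact Finset.sum_congr rfl fun i _ => Finset.sum_congr rfl fun j _ => by ring

lemma IsC12.differentiable_space (hL : IsC12 T L) {s : ℝ} (hs : s ∈ Ico 0 T) :
    Differentiable ℝ (L s) ∧ Differentiable ℝ (fderiv ℝ (L s)) := by
  have h := hL.contDiff_space s hs
  exact ⟨h.differentiable (by norm_num),
    (h.fderiv_right (m := 1) (by norm_num)).differentiable (by norm_num)⟩

/-- Second order Taylor expansion in space, with an error bound in terms of the variation of the
Hessian on the segment. -/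
lemma IsC12.abs_space_taylor_le (hL : IsC12 T L) {s : ℝ} (hs : s ∈ Ico 0 T) (y h : Vec n) {c : ℝ}
    (hc : ∀ τ ∈ Icc (0 : ℝ) 1,
      |matrixForm (spaceHess L s (y + τ • h)) h h - matrixForm (spaceHess L s y) h h| ≤ c) :
    |L s (y + h) - L s y - inner ℝ (spaceGrad L s y) h
      - (1 / 2) * matrixForm (spaceHess L s y) h h| ≤ c := by
  obtain ⟨hd1, hd2⟩ := hL.differentiable_space hs
  have hc0 : 0 ≤ c := (abs_nonneg _).trans (hc 0 ⟨le_rfl, zero_le_one⟩)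
  have hline : ∀ τ : ℝ, HasDerivAt (fun τ : ℝ => y + τ • h) h τ := fun τ => by
    simpa using ((hasDerivAt_id τ).smul_const h).const_add y
  have hf : ∀ τ : ℝ, HasDerivAt (fun τ : ℝ => L s (y + τ • h))
      (fderiv ℝ (L s) (y + τ • h) h) τ := fun τ =>
    (hd1 (y + τ • h)).hasFDerivAt.comp_hasDerivAt τ (hline τ)
  have hf' : ∀ τ : ℝ, HasDerivAt (fun τ : ℝ => fderiv ℝ (L s) (y + τ • h) h)
      (matrixForm (spaceHess L s (y + τ • h)) h h) τ := fun τ => by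
    rw [← fderiv_fderiv_eq_matrixForm]
    have h1 := (hd2 (y + τ • h)).hasFDerivAt.comp_hasDerivAt τ (hline τ)
    exact h1.clm_apply (hasDerivAt_const τ h) |>.congr_deriv (by simp)
  set A := matrixForm (spaceHess L s y) h h with hA
  -- The mean value inequality is applied twice along the segment, first to the derivative with its
  -- linear part removed, then to the function itself. This gives the constant `c`, where
  -- integrating the remainder would give `c / 2`.
  have hk : ∀ τ : ℝ, HasDerivAt (fun τ : ℝ => fderiv ℝ (L s) (y + τ • h) h - τ * A)
      (matrixForm (spaceHess L s (y + τ • h)) h h - A) τ := fun τ => by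
    exact ((hf' τ).sub ((hasDerivAt_id τ).mul_const A)).congr_deriv (by simp)
  have hkb : ∀ τ ∈ Icc (0 : ℝ) 1,
      |fderiv ℝ (L s) (y + τ • h) h - τ * A - fderiv ℝ (L s) y h| ≤ c := fun τ hτ => by
    have := (convex_Icc (0 : ℝ) 1).norm_image_sub_le_of_norm_hasDerivWithin_le
      (fun τ _ => (hk τ).hasDerivWithinAt) hc (left_mem_Icc.2 zero_le_one) hτ
    simp only [zero_smul, add_zero, zero_mul, sub_zero, Real.norm_eq_abs] at this
    refine this.trans ?_
    rw [abs_of_nonneg hτ.1]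
    exact mul_le_of_le_one_right hc0 hτ.2
  have hg : ∀ τ : ℝ, HasDerivAt
      (fun τ : ℝ => L s (y + τ • h) - (1 / 2) * A * τ ^ 2 - τ * fderiv ℝ (L s) y h)
      (fderiv ℝ (L s) (y + τ • h) h - τ * A - fderiv ℝ (L s) y h) τ := fun τ => by
    have h1 := ((hf τ).sub ((hasDerivAt_pow 2 τ).const_mul ((1 / 2) * A))).sub
      ((hasDerivAt_id τ).mul_const (fderiv ℝ (L s) y h))
    refine h1.congr_deriv ?_
    norm_num
    ring
  have := (convex_Icc (0 : ℝ) 1).norm_image_sub_le_of_norm_hasDerivWithin_le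
      (fun τ _ => (hg τ).hasDerivWithinAt) hkb (left_mem_Icc.2 zero_le_one)
      (right_mem_Icc.2 zero_le_one)
  simp only [one_smul, zero_smul, add_zero, Real.norm_eq_abs, sub_zero, abs_one, mul_one] at this
  rw [inner_spaceGrad]
  refine le_of_eq_of_le ?_ this
  congr 1
  ring

lemma IsC12.continuousOn_hess_entries (hL : IsC12 T L) :
    ContinuousOn (fun p : ℝ × Vec n => (fun i j => spaceHess L p.1 p.2 i j : Fin n → Fin n → ℝ))
      (Ico 0 T ×ˢ univ) := hL.continuousOn_spaceHess

/-- Taylor expansion of order one in time and two in space, uniformly on compact sets. -/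
lemma IsC12.taylor_uniform (hL : IsC12 T L) {t : ℝ} (ht : t < T) (R : ℝ) {ε : ℝ} (hε : 0 < ε) :
    ∃ δ > 0, ∀ s s' : ℝ, 0 ≤ s → s ≤ s' → s' ≤ t → ∀ y y' : Vec n, ‖y‖ ≤ R → ‖y'‖ ≤ R →
      s' - s ≤ δ → ‖y' - y‖ ≤ δ →
      |L s' y' - L s y - timeDeriv T L s y * (s' - s) - inner ℝ (spaceGrad L s y) (y' - y)
        - (1 / 2) * matrixForm (spaceHess L s y) (y' - y) (y' - y)|
        ≤ ε * ((s' - s) + ‖y' - y‖ ^ 2) := by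
  have hK : IsCompact (Icc (0 : ℝ) t ×ˢ Metric.closedBall (0 : Vec n) R) :=
    isCompact_Icc.prod (isCompact_closedBall _ _)
  have hsub : Icc (0 : ℝ) t ×ˢ Metric.closedBall (0 : Vec n) R ⊆ Ico 0 T ×ˢ univ :=
    prod_mono (fun r hr => ⟨hr.1, hr.2.trans_lt ht⟩) (subset_univ _)
  have u1 := hK.uniformContinuousOn_of_continuous (hL.continuousOn_timeDeriv.mono hsub)
  have u2 := hK.uniformContinuousOn_of_continuous (hL.continuousOn_hess_entries.mono hsub)
  rw [Metric.uniformContinuousOn_iff] at u1 u2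
  -- The variation of the Hessian is measured by the sum of its `n²` entries; the `+ 1` keeps the
  -- denominator positive when `n = 0`.
  set ε' : ℝ := ε / (n ^ 2 + 1) with hε'
  have hn : (0 : ℝ) < n ^ 2 + 1 := by positivity
  have hε'0 : 0 < ε' := div_pos hε hn
  obtain ⟨δ1, hδ1, h1⟩ := u1 ε hε
  obtain ⟨δ2, hδ2, h2⟩ := u2 ε' hε'0
  refine ⟨min δ1 δ2 / 2, by positivity, fun s s' hs hss' hs't y y' hy hy' hd hdy => ?_⟩
  have hm : 0 < min δ1 δ2 := lt_min hδ1 hδ2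
  have hlt1 : min δ1 δ2 / 2 < δ1 := (half_lt_self hm).trans_le (min_le_left _ _)
  have hlt2 : min δ1 δ2 / 2 < δ2 := (half_lt_self hm).trans_le (min_le_right _ _)
  have hst : s ≤ t := hss'.trans hs't
  have hsT : s ∈ Ico 0 T := ⟨hs, hst.trans_lt ht⟩
  -- time
  have htime : |L s' y' - L s y' - timeDeriv T L s y * (s' - s)| ≤ ε * (s' - s) := by
    have hder : ∀ r ∈ Icc s s', HasDerivWithinAt (fun r => L r y' - timeDeriv T L s y * r)
        (timeDeriv T L r y' - timeDeriv T L s y) (Icc s s') r := fun r hr => by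
      have hrT : r ∈ Ico 0 T := ⟨hs.trans hr.1, (hr.2.trans hs't).trans_lt ht⟩
      have := (hL.differentiable_time y' r hrT).hasDerivWithinAt.mono
        (show Icc s s' ⊆ Ico 0 T from fun q hq => ⟨hs.trans hq.1, (hq.2.trans hs't).trans_lt ht⟩)
      exact (this.sub ((hasDerivWithinAt_id r (Icc s s')).const_mul
        (timeDeriv T L s y))).congr_deriv (by simp [timeDeriv])
    have hb : ∀ r ∈ Icc s s', ‖timeDeriv T L r y' - timeDeriv T L s y‖ ≤ ε := fun r hr => by
      rw [← dist_eq_norm]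
      refine (h1 (r, y') ⟨⟨hs.trans hr.1, hr.2.trans hs't⟩, by simpa using hy'⟩ (s, y)
        ⟨⟨hs, hst⟩, by simpa using hy⟩ ?_).le
      rw [Prod.dist_eq, max_lt_iff]
      refine ⟨?_, ?_⟩
      · rw [Real.dist_eq, abs_of_nonneg (sub_nonneg.2 hr.1)]
        linarith [hr.2]
      · rw [dist_eq_norm]; linarith
    have := (convex_Icc s s').norm_image_sub_le_of_norm_hasDerivWithin_le hder hb
      (left_mem_Icc.2 hss') (right_mem_Icc.2 hss')
    rw [Real.norm_eq_abs, Real.norm_eq_abs, abs_of_nonneg (sub_nonneg.2 hss')] at this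
    refine le_of_eq_of_le ?_ this
    congr 1
    ring
  -- space
  have hspace := hL.abs_space_taylor_le hsT y (y' - y) (c := ε * ‖y' - y‖ ^ 2) (by
    intro τ hτ
    rw [← matrixForm_sub]
    refine (abs_matrixForm_le _ _ _).trans ?_
    rw [← pow_two]
    refine mul_le_mul_of_nonneg_right ?_ (sq_nonneg _)
    have hball : ‖y + τ • (y' - y)‖ ≤ R := by
      have := (convex_closedBall (0 : Vec n) R).add_smul_sub_mem (by simpa using hy)
        (by simpa using hy') hτ
      simpa using this
    have hdist : dist (s, y + τ • (y' - y)) (s, y) < δ2 := by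
      rw [Prod.dist_eq, dist_self, dist_eq_norm, add_sub_cancel_left, norm_smul,
        Real.norm_of_nonneg hτ.1]
      refine max_lt hδ2 ((mul_le_of_le_one_left (norm_nonneg _) hτ.2).trans_lt ?_)
      linarith
    have hlt := h2 (s, y + τ • (y' - y)) ⟨⟨hs, hst⟩, by simpa using hball⟩ (s, y)
      ⟨⟨hs, hst⟩, by simpa using hy⟩ hdist
    have hij : ∀ i j, |spaceHess L s (y + τ • (y' - y)) i j - spaceHess L s y i j| ≤ ε' :=
      fun i j => by
        rw [← Real.dist_eq]
        exact ((dist_le_pi_dist _ _ j).trans (dist_le_pi_dist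
          (fun i j => spaceHess L s (y + τ • (y' - y)) i j)
          (fun i j => spaceHess L s y i j) i)).trans hlt.le
    calc matrixAbs (spaceHess L s (y + τ • (y' - y)) - spaceHess L s y)
        ≤ ∑ _i : Fin n, ∑ _j : Fin n, ε' :=
          Finset.sum_le_sum fun i _ => Finset.sum_le_sum fun j _ => hij i j
      _ = n ^ 2 * ε' := by simp [pow_two, mul_assoc]
      _ ≤ ε := by
          rw [hε', mul_div_assoc', div_le_iff₀ hn]
          nlinarith)
  rw [add_sub_cancel] at hspace
  -- The path from `(s, y)` to `(s', y')` goes through `(s, y')`, so the space derivatives are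
  -- needed at time `s` only.
  have : L s' y' - L s y - timeDeriv T L s y * (s' - s) - inner ℝ (spaceGrad L s y) (y' - y)
        - (1 / 2) * matrixForm (spaceHess L s y) (y' - y) (y' - y)
      = (L s' y' - L s y' - timeDeriv T L s y * (s' - s))
        + (L s y' - L s y - inner ℝ (spaceGrad L s y) (y' - y)
        - (1 / 2) * matrixForm (spaceHess L s y) (y' - y) (y' - y)) := by ring
  rw [this, mul_add]
  exact (abs_add_le _ _).trans (add_le_add htime hspace)

end TaylorExpansion

/-! ### Riemann sums and Taylor remainders along a continuous path. -/

section PathwiseSums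

variable {t : ℝ} {Ns : ℕ → ℕ} {θ : ℕ → ℕ → ℝ}

lemma eventually_grid_close {E : Type*} [PseudoMetricSpace E] {f : ℝ → E} (ht : 0 ≤ t)
    (hf : ContinuousOn f (Icc 0 t)) (hN : Tendsto Ns atTop atTop) {ε : ℝ} (hε : 0 < ε) :
    ∀ᶠ i in atTop, ∀ k < Ns i, ∀ r ∈ Icc (grid t (Ns i) k) (grid t (Ns i) (k + 1)),
      dist (f r) (f (grid t (Ns i) k)) ≤ ε := by
  have hu := isCompact_Icc.uniformContinuousOn_of_continuous hf
  rw [Metric.uniformContinuousOn_iff] at hu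
  obtain ⟨δ, hδ, h⟩ := hu ε hε
  filter_upwards [((tendsto_div_nat t).comp hN).eventually (gt_mem_nhds hδ)] with i hi k hk r hr
  refine (h r ⟨(grid_mem ht k).1.trans hr.1, hr.2.trans (grid_mem ht _).2⟩ _ (grid_mem ht k)
    ?_).le
  rw [Real.dist_eq, abs_of_nonneg (sub_nonneg.2 hr.1)]
  have := grid_succ_sub (t := t) hk
  simp only [Function.comp] at hi
  linarith [hr.2]

lemma intervalIntegrable_grid {β : ℝ → ℝ} (ht : 0 ≤ t) (hβ : IntervalIntegrable β volume 0 t)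
    (N k : ℕ) : IntervalIntegrable β volume (grid t N k) (grid t N (k + 1)) := by
  refine hβ.mono_set ?_
  rw [uIcc_of_le ht, uIcc_of_le (grid_mono ht k.le_succ)]
  exact Icc_subset_Icc (grid_mem ht k).1 (grid_mem ht _).2

lemma sum_integral_grid {β : ℝ → ℝ} (ht : 0 ≤ t) (hβ : IntervalIntegrable β volume 0 t)
    {N : ℕ} (hN : 0 < N) :
    ∑ k ∈ Finset.range N, ∫ r in (grid t N k)..(grid t N (k + 1)), β r
      = ∫ r in (0 : ℝ)..t, β r := by
  rw [intervalIntegral.sum_integral_adjacent_intervals fun k _ => intervalIntegrable_grid ht hβ N k,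
    grid_zero, grid_self hN]

lemma tendsto_zero_of_forall_eventually_le {f : ℕ → ℝ} {K : ℝ}
    (h : ∀ η : ℝ, 0 < η → η ≤ 1 → ∀ᶠ i in atTop, |f i| ≤ η * K) : Tendsto f atTop (𝓝 0) := by
  rw [Metric.tendsto_nhds]
  intro ε hε
  have hK : 0 < |K| + 1 := by positivity
  have hη : 0 < min 1 (ε / (2 * (|K| + 1))) := by positivity
  filter_upwards [h _ hη (min_le_left _ _)] with i hi
  rw [dist_zero_right, Real.norm_eq_abs]
  refine hi.trans_lt ?_
  calc min 1 (ε / (2 * (|K| + 1))) * K ≤ min 1 (ε / (2 * (|K| + 1))) * (|K| + 1) := by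
        refine mul_le_mul_of_nonneg_left ?_ hη.le
        linarith [le_abs_self K]
    _ ≤ ε / (2 * (|K| + 1)) * (|K| + 1) := by
        refine mul_le_mul_of_nonneg_right (min_le_right _ _) hK.le
    _ = ε / 2 := by field_simp
    _ < ε := half_lt_self hε

/-- Weighted Riemann sums of `f` against `β dr` approximate the integral of `f β`. -/
lemma tendsto_riemann_sum (ht : 0 ≤ t) (hN : Tendsto Ns atTop atTop)
    (hθ : ∀ i k, θ i k ∈ Icc (0 : ℝ) 1) {f β : ℝ → ℝ} (hf : ContinuousOn f (Icc 0 t))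
    (hβ : IntervalIntegrable β volume 0 t) :
    Tendsto (fun i => ∑ k ∈ Finset.range (Ns i), θ i k *
      (f (grid t (Ns i) k) * (∫ r in (grid t (Ns i) k)..(grid t (Ns i) (k + 1)), β r)
        - ∫ r in (grid t (Ns i) k)..(grid t (Ns i) (k + 1)), f r * β r)) atTop (𝓝 0) := by
  refine tendsto_zero_of_forall_eventually_le (K := ∫ r in (0 : ℝ)..t, |β r|) fun η hη _ => ?_
  filter_upwards [eventually_grid_close ht hf hN hη, hN.eventually_gt_atTop 0] with i hi hi0
  rw [← sum_integral_grid ht hβ.abs hi0, Finset.mul_sum]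
  refine (Finset.abs_sum_le_sum_abs _ _).trans (Finset.sum_le_sum fun k hk => ?_)
  have hg : grid t (Ns i) k ≤ grid t (Ns i) (k + 1) := grid_mono ht k.le_succ
  have hb := intervalIntegrable_grid ht hβ (Ns i) k
  have hfb : IntervalIntegrable (fun r => f r * β r) volume (grid t (Ns i) k)
      (grid t (Ns i) (k + 1)) := by
    refine hb.continuousOn_mul (hf.mono ?_)
    rw [uIcc_of_le hg]
    exact Icc_subset_Icc (grid_mem ht k).1 (grid_mem ht _).2
  rw [abs_mul, abs_of_nonneg (hθ i k).1, ← intervalIntegral.integral_const_mul,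
    ← intervalIntegral.integral_sub (hb.const_mul _) hfb]
  refine (mul_le_of_le_one_left (abs_nonneg _) (hθ i k).2).trans ?_
  rw [← intervalIntegral.integral_const_mul]
  refine intervalIntegral.abs_integral_le_integral_abs hg |>.trans ?_
  refine intervalIntegral.integral_mono_on hg ((hb.const_mul _).sub hfb).abs
    (hb.abs.const_mul _) fun r hr => ?_
  rw [← sub_mul, abs_mul]
  refine mul_le_mul_of_nonneg_right ?_ (abs_nonneg _)
  -- Uniform continuity of `f` makes the integrand at most `η |β|` in every cell; the total is `η ∫
  -- |β|`.
  rw [abs_sub_comm, ← Real.dist_eq]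
  exact hi k (Finset.mem_range.1 hk) r hr

/-- For an integrable `β`, each squared increment is at most the largest cell integral of `|β|`
times the integral of `|β|` over that cell. The former tends to zero because the primitive of `|β|`
is uniformly continuous. -/
lemma tendsto_sum_sq_integral (ht : 0 ≤ t) (hN : Tendsto Ns atTop atTop) {β : ℝ → ℝ}
    (hβ : IntervalIntegrable β volume 0 t) :
    Tendsto (fun i => ∑ k ∈ Finset.range (Ns i),
      (∫ r in (grid t (Ns i) k)..(grid t (Ns i) (k + 1)), β r) ^ 2) atTop (𝓝 0) := by
  have hF : ContinuousOn (fun u => ∫ r in (0 : ℝ)..u, |β r|) (Icc 0 t) := by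
    have := intervalIntegral.continuousOn_primitive_interval (μ := volume) (a := 0) (b := t)
      (f := fun r => |β r|) (by
        rw [uIcc_of_le ht, ← intervalIntegrable_iff_integrableOn_Icc_of_le ht]
        exact hβ.abs)
    rwa [uIcc_of_le ht] at this
  refine tendsto_zero_of_forall_eventually_le (K := ∫ r in (0 : ℝ)..t, |β r|) fun η hη _ => ?_
  filter_upwards [eventually_grid_close ht hF hN hη, hN.eventually_gt_atTop 0] with i hi hi0
  rw [← sum_integral_grid ht hβ.abs hi0, Finset.mul_sum,
    abs_of_nonneg (Finset.sum_nonneg fun _ _ => sq_nonneg _)]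
  refine Finset.sum_le_sum fun k hk => ?_
  have hg : grid t (Ns i) k ≤ grid t (Ns i) (k + 1) := grid_mono ht k.le_succ
  have h1 := hi k (Finset.mem_range.1 hk) _ (right_mem_Icc.2 hg)
  have hsub : ∀ j, IntervalIntegrable (fun r => |β r|) volume 0 (grid t (Ns i) j) := fun j => by
    refine hβ.abs.mono_set ?_
    rw [uIcc_of_le ht, uIcc_of_le (grid_mem ht j).1]
    exact Icc_subset_Icc le_rfl (grid_mem ht j).2
  rw [Real.dist_eq, intervalIntegral.integral_interval_sub_left (hsub _) (hsub _)] at h1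
  have h2 := intervalIntegral.abs_integral_le_integral_abs (μ := volume) (f := β) hg
  have h3 : 0 ≤ ∫ r in (grid t (Ns i) k)..(grid t (Ns i) (k + 1)), |β r| :=
    intervalIntegral.integral_nonneg hg fun _ _ => abs_nonneg _
  rw [abs_of_nonneg h3] at h1
  rw [← sq_abs, pow_two]
  exact mul_le_mul (h2.trans h1) h2 (abs_nonneg _) hη.le

variable {n : ℕ} {T : ℝ} {L : ℝ → Vec n → ℝ}

lemma continuousOn_along_path {E : Type*} [TopologicalSpace E] {G : ℝ × Vec n → E} (ht : t < T)
    (hG : ContinuousOn G (Ico 0 T ×ˢ univ)) {x : ℝ → Vec n} (hx : ContinuousOn x (Icc 0 t)) :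
    ContinuousOn (fun r => G (r, x r)) (Icc 0 t) :=
  hG.comp (continuousOn_id.prodMk hx) fun _ hr => ⟨⟨hr.1, hr.2.trans_lt ht⟩, mem_univ _⟩

lemma IsC12.exists_matrixAbs_le (hL : IsC12 T L) (ht : t < T) {x : ℝ → Vec n}
    (hx : ContinuousOn x (Icc 0 t)) :
    ∃ C : ℝ, 0 ≤ C ∧ ∀ r ∈ Icc 0 t, matrixAbs (spaceHess L r (x r)) ≤ C := by
  have h1 := continuousOn_along_path ht hL.continuousOn_spaceHess hx
  have h2 : Continuous (fun H : Matrix (Fin n) (Fin n) ℝ => matrixAbs H) := by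
    unfold matrixAbs
    exact continuous_finsetSum _ fun i _ => continuous_finsetSum _ fun j _ =>
      (continuous_id.matrix_elem i j).abs
  obtain ⟨C, hC⟩ := (isCompact_Icc.image_of_continuousOn (h2.comp_continuousOn h1)).bddAbove
  exact ⟨max C 0, le_max_right _ _, fun r hr =>
    (hC (mem_image_of_mem _ hr)).trans (le_max_left _ _)⟩

lemma norm_sq_add_le {E : Type*} [SeminormedAddCommGroup E] (a b : E) :
    ‖a + b‖ ^ 2 ≤ 2 * ‖a‖ ^ 2 + 2 * ‖b‖ ^ 2 := by
  have := pow_le_pow_left₀ (norm_nonneg _) (norm_add_le a b) 2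
  nlinarith [sq_nonneg (‖a‖ - ‖b‖)]

/-- Sums of second order Taylor remainders along a continuous path with increments `e + q`, where
the squares of `e` are summable to a small quantity and only `q` is kept at second order. -/
lemma IsC12.tendsto_taylor_sum (hL : IsC12 T L) (ht : 0 ≤ t) (htT : t < T)
    (hN : Tendsto Ns atTop atTop) (hθ : ∀ i k, θ i k ∈ Icc (0 : ℝ) 1) {x : ℝ → Vec n}
    (hx : ContinuousOn x (Icc 0 t)) {e q : ℕ → ℕ → Vec n}
    (hinc : ∀ i, ∀ k < Ns i,
      x (grid t (Ns i) (k + 1)) - x (grid t (Ns i) k) = e i k + q i k)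
    (he : Tendsto (fun i => ∑ k ∈ Finset.range (Ns i), ‖e i k‖ ^ 2) atTop (𝓝 0)) {B : ℝ}
    (hq : ∀ᶠ i in atTop, ∑ k ∈ Finset.range (Ns i), θ i k * ‖q i k‖ ^ 2 ≤ B) :
    Tendsto (fun i => ∑ k ∈ Finset.range (Ns i), θ i k *
      (L (grid t (Ns i) (k + 1)) (x (grid t (Ns i) (k + 1)))
        - L (grid t (Ns i) k) (x (grid t (Ns i) k))
        - timeDeriv T L (grid t (Ns i) k) (x (grid t (Ns i) k))
          * (grid t (Ns i) (k + 1) - grid t (Ns i) k)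
        - inner ℝ (spaceGrad L (grid t (Ns i) k) (x (grid t (Ns i) k))) (e i k + q i k)
        - (1 / 2) * matrixForm (spaceHess L (grid t (Ns i) k) (x (grid t (Ns i) k)))
          (q i k) (q i k))) atTop (𝓝 0) := by
  obtain ⟨C, hC0, hC⟩ := hL.exists_matrixAbs_le htT hx
  obtain ⟨R, hR⟩ := (isCompact_Icc.image_of_continuousOn hx).isBounded.exists_norm_le
  have hR' : ∀ r ∈ Icc 0 t, ‖x r‖ ≤ R := fun r hr => hR _ (mem_image_of_mem _ hr)
  refine tendsto_zero_of_forall_eventually_le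
    (K := t + 2 + 2 * B + C * (2 + B)) fun η hη hη1 => ?_
  obtain ⟨δ, hδ, hT⟩ := hL.taylor_uniform htT R hη
  -- The sum of the `‖e‖²` is taken below `η²`, because it gets divided by `η` in the treatment of
  -- the cross terms.
  have hη2 : 0 < η ^ 2 := by positivity
  filter_upwards [eventually_grid_close ht hx hN hδ, hN.eventually_gt_atTop 0, hq,
    he.eventually (gt_mem_nhds hη2),
    ((tendsto_div_nat t).comp hN).eventually (gt_mem_nhds hδ)] with i h1 hi0 hqi hei hmi
  simp only [Function.comp] at hmi
  have hterm : ∀ k ∈ Finset.range (Ns i), |θ i k *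
      (L (grid t (Ns i) (k + 1)) (x (grid t (Ns i) (k + 1)))
        - L (grid t (Ns i) k) (x (grid t (Ns i) k))
        - timeDeriv T L (grid t (Ns i) k) (x (grid t (Ns i) k))
          * (grid t (Ns i) (k + 1) - grid t (Ns i) k)
        - inner ℝ (spaceGrad L (grid t (Ns i) k) (x (grid t (Ns i) k))) (e i k + q i k)
        - (1 / 2) * matrixForm (spaceHess L (grid t (Ns i) k) (x (grid t (Ns i) k)))
          (q i k) (q i k))|
      ≤ η * (grid t (Ns i) (k + 1) - grid t (Ns i) k)
        + (2 * η + C * (1 + 1 / η)) * ‖e i k‖ ^ 2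
        + (2 * η + C * η) * (θ i k * ‖q i k‖ ^ 2) := by
    intro k hk
    have hkN := Finset.mem_range.1 hk
    have hg : grid t (Ns i) k ≤ grid t (Ns i) (k + 1) := grid_mono ht k.le_succ
    have g0 := grid_mem (N := Ns i) ht k
    have g1 := grid_mem (N := Ns i) ht (k + 1)
    have hdx := h1 k hkN _ (right_mem_Icc.2 hg)
    rw [dist_eq_norm] at hdx
    have hm := grid_succ_sub (t := t) hkN
    have hTk := hT _ _ g0.1 hg g1.2 _ _ (hR' _ g0) (hR' _ g1) (by linarith) hdx
    rw [hinc i k hkN] at hTk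
    set s := grid t (Ns i) k
    set s' := grid t (Ns i) (k + 1)
    set H := spaceHess L s (x s) with hH
    have hCk : matrixAbs H ≤ C := hC s g0
    have hf := matrixForm_add_self H (e i k) (q i k)
    set a := ‖e i k‖ with ha
    set b := ‖q i k‖ with hb
    have ha0 : 0 ≤ a := norm_nonneg _
    have hb0 : 0 ≤ b := norm_nonneg _
    have f1 : |matrixForm H (e i k) (e i k)| ≤ C * (a * a) :=
      (abs_matrixForm_le _ _ _).trans (by gcongr)
    have f2 : |matrixForm H (e i k) (q i k)| ≤ C * (a * b) :=
      (abs_matrixForm_le _ _ _).trans (by gcongr)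
    have f3 : |matrixForm H (q i k) (e i k)| ≤ C * (a * b) :=
      (abs_matrixForm_le _ _ _).trans ((mul_comm ‖q i k‖ _).symm ▸ by gcongr)
    have hn := norm_sq_add_le (e i k) (q i k)
    -- Young's inequality with weight `η`: the cross terms between `e` and `q` are charged to the
    -- small sum of `‖e‖²` and to a small multiple of the bounded sum of `θ ‖q‖²`.
    have hab : 2 * (a * b) ≤ a ^ 2 / η + η * b ^ 2 := by
      have : 0 ≤ (a - η * b) ^ 2 / η := by positivity
      have h5 : (a - η * b) ^ 2 / η = a ^ 2 / η - 2 * (a * b) + η * b ^ 2 := by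
        field_simp
        ring
      linarith
    have hθ0 := (hθ i k).1
    have hθ1 := (hθ i k).2
    rw [abs_mul, abs_of_nonneg hθ0]
    have hmain : |L s' (x s') - L s (x s) - timeDeriv T L s (x s) * (s' - s)
        - inner ℝ (spaceGrad L s (x s)) (e i k + q i k)
        - (1 / 2) * matrixForm H (q i k) (q i k)|
        ≤ η * (s' - s) + (2 * η + C * (1 + 1 / η)) * a ^ 2 + (2 * η + C * η) * b ^ 2 := by
      have hdec : L s' (x s') - L s (x s) - timeDeriv T L s (x s) * (s' - s)
        - inner ℝ (spaceGrad L s (x s)) (e i k + q i k)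
        - (1 / 2) * matrixForm H (q i k) (q i k)
        = (L s' (x s') - L s (x s) - timeDeriv T L s (x s) * (s' - s)
        - inner ℝ (spaceGrad L s (x s)) (e i k + q i k)
        - (1 / 2) * matrixForm H (e i k + q i k) (e i k + q i k))
        + (1 / 2) * (matrixForm H (e i k) (e i k) + matrixForm H (e i k) (q i k)
          + matrixForm H (q i k) (e i k)) := by
        rw [hf]; ring
      rw [hdec]
      refine (abs_add_le _ _).trans ?_
      have hq2 : |(1 / 2) * (matrixForm H (e i k) (e i k) + matrixForm H (e i k) (q i k)
          + matrixForm H (q i k) (e i k))| ≤ (1 / 2) * (C * (a * a) + C * (a * b) + C * (a * b)) := by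
        rw [abs_mul, abs_of_pos (by norm_num : (0 : ℝ) < 1 / 2)]
        gcongr
        exact (abs_add_three _ _ _).trans (by gcongr)
      have hCab : C * (2 * (a * b)) ≤ C * (a ^ 2 / η + η * b ^ 2) := by gcongr
      have hηn : η * ‖e i k + q i k‖ ^ 2 ≤ η * (2 * a ^ 2 + 2 * b ^ 2) := by gcongr
      have hx1 : 0 ≤ C * a ^ 2 := by positivity
      have hx2 : 0 ≤ C * (a ^ 2 / η) := by positivity
      have hx3 : 0 ≤ C * (η * b ^ 2) := by positivity
      have e1 : (2 * η + C * (1 + 1 / η)) * a ^ 2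
          = 2 * η * a ^ 2 + C * a ^ 2 + C * (a ^ 2 / η) := by ring
      rw [e1]
      nlinarith [hTk, hq2]
    -- The weight is dropped by `θ ≤ 1` except on `‖q‖²`, whose sum is bounded only with the
    -- weights.
    calc θ i k * _ ≤ θ i k * (η * (s' - s) + (2 * η + C * (1 + 1 / η)) * a ^ 2
          + (2 * η + C * η) * b ^ 2) := mul_le_mul_of_nonneg_left hmain hθ0
      _ = θ i k * (η * (s' - s) + (2 * η + C * (1 + 1 / η)) * a ^ 2)
          + (2 * η + C * η) * (θ i k * b ^ 2) := by ring
      _ ≤ η * (s' - s) + (2 * η + C * (1 + 1 / η)) * a ^ 2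
          + (2 * η + C * η) * (θ i k * b ^ 2) := by
          have : 0 ≤ η * (s' - s) + (2 * η + C * (1 + 1 / η)) * a ^ 2 := by
            have := sub_nonneg.2 hg
            positivity
          gcongr
          exact mul_le_of_le_one_left this hθ1
  refine (Finset.abs_sum_le_sum_abs _ _).trans ((Finset.sum_le_sum hterm).trans ?_)
  rw [Finset.sum_add_distrib, Finset.sum_add_distrib, ← Finset.mul_sum, ← Finset.mul_sum,
    ← Finset.mul_sum, Finset.sum_range_sub, grid_self hi0, grid_zero, sub_zero]
  set A := ∑ k ∈ Finset.range (Ns i), ‖e i k‖ ^ 2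
  set D := ∑ k ∈ Finset.range (Ns i), θ i k * ‖q i k‖ ^ 2
  have hA0 : 0 ≤ A := Finset.sum_nonneg fun _ _ => sq_nonneg _
  have hAη : A ≤ η ^ 2 := hei.le
  have hA1 : A ≤ 1 := hAη.trans (pow_le_one₀ hη.le hη1)
  have hAη' : A ≤ η := hAη.trans (by nlinarith)
  have hAη2 : A / η ≤ η := by rw [div_le_iff₀ hη]; nlinarith
  have e1 : (2 * η + C * (1 + 1 / η)) * A = 2 * η * A + C * A + C * (A / η) := by ring
  rw [e1]
  have m1 : C * A ≤ C * η := by gcongr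
  have m2 : C * (A / η) ≤ C * η := by gcongr
  have m3 : 2 * η * A ≤ 2 * η * 1 := by gcongr
  have m4 : (2 * η + C * η) * D ≤ (2 * η + C * η) * B := by gcongr
  nlinarith

end PathwiseSums

/-! ### Pathwise Itô formula along a sequence of grids -/

section PathwiseIto

variable {n m : ℕ} {T t : ℝ} {L : ℝ → Vec n → ℝ} {Ns : ℕ → ℕ} {θ : ℕ → ℕ → ℝ}

lemma continuousOn_trace_mul_mul_transpose {α : Type*} [TopologicalSpace α] {S : Set α}
    {H : α → Matrix (Fin n) (Fin n) ℝ}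
    {A : α → Matrix (Fin n) (Fin m) ℝ} (hH : ContinuousOn H S) (hA : ContinuousOn A S) :
    ContinuousOn (fun r => (H r * (A r * (A r).transpose)).trace) S := by
  have hH' : ∀ i j, ContinuousOn (fun r => H r i j) S := fun i j =>
    (continuous_apply_apply i j).comp_continuousOn hH
  have hA' : ∀ i j, ContinuousOn (fun r => A r i j) S := fun i j =>
    (continuous_apply_apply i j).comp_continuousOn hA
  simp only [Matrix.trace, Matrix.diag, Matrix.mul_apply, Matrix.transpose_apply]
  fun_prop

/-- Itô's formula along a path `x` with increments `∫ β + E + q`, `q = A ΔW`, given the limits of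
the sums that involve the martingale increments. -/
theorem IsC12.tendsto_ito_sum (hL : IsC12 T L) (ht : 0 ≤ t) (htT : t < T)
    (hN : Tendsto Ns atTop atTop) (hθ : ∀ i k, θ i k ∈ Icc (0 : ℝ) 1) {x : ℝ → Vec n}
    (hx : ContinuousOn x (Icc 0 t)) {A : ℝ → Matrix (Fin n) (Fin m) ℝ}
    (hA : ContinuousOn A (Icc 0 t)) {β : ℝ → Vec n}
    (hβ : ∀ j, IntervalIntegrable (fun r => β r j) volume 0 t) {E q : ℕ → ℕ → Vec n}
    (hinc : ∀ i, ∀ k < Ns i, x (grid t (Ns i) (k + 1)) - x (grid t (Ns i) k)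
      = (WithLp.toLp 2 (fun j => ∫ r in (grid t (Ns i) k)..(grid t (Ns i) (k + 1)), β r j)
        + E i k) + q i k)
    (h1 : Tendsto (fun i => ∑ k ∈ Finset.range (Ns i), ‖E i k‖ ^ 2) atTop (𝓝 0))
    (h2 : Tendsto (fun i => ∑ k ∈ Finset.range (Ns i), θ i k *
      inner ℝ (spaceGrad L (grid t (Ns i) k) (x (grid t (Ns i) k))) (E i k)) atTop (𝓝 0))
    (h3 : Tendsto (fun i => ∑ k ∈ Finset.range (Ns i), θ i k *
      (matrixForm (spaceHess L (grid t (Ns i) k) (x (grid t (Ns i) k))) (q i k) (q i k)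
        - (spaceHess L (grid t (Ns i) k) (x (grid t (Ns i) k))
          * (A (grid t (Ns i) k) * (A (grid t (Ns i) k)).transpose)).trace
          * (grid t (Ns i) (k + 1) - grid t (Ns i) k))) atTop (𝓝 0))
    (h4 : Tendsto (fun i => ∑ k ∈ Finset.range (Ns i), θ i k *
      (‖q i k‖ ^ 2 - (A (grid t (Ns i) k) * (A (grid t (Ns i) k)).transpose).trace
          * (grid t (Ns i) (k + 1) - grid t (Ns i) k))) atTop (𝓝 0)) :
    Tendsto (fun i => ∑ k ∈ Finset.range (Ns i), θ i k *
      (L (grid t (Ns i) (k + 1)) (x (grid t (Ns i) (k + 1)))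
        - L (grid t (Ns i) k) (x (grid t (Ns i) k))
        - (∫ r in (grid t (Ns i) k)..(grid t (Ns i) (k + 1)),
            (timeDeriv T L r (x r) + inner ℝ (spaceGrad L r (x r)) (β r)
              + (1 / 2) * (spaceHess L r (x r) * (A r * (A r).transpose)).trace))
        - inner ℝ (spaceGrad L (grid t (Ns i) k) (x (grid t (Ns i) k))) (q i k)))
      atTop (𝓝 0) := by
  have hf0 := continuousOn_along_path htT hL.continuousOn_timeDeriv hx
  have hfp := continuousOn_along_path htT hL.continuousOn_spaceGrad hx
  have hfH := continuousOn_along_path htT hL.continuousOn_spaceHess hx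
  have hft := continuousOn_trace_mul_mul_transpose hfH hA
  have hfA : ContinuousOn (fun r => (A r * (A r).transpose).trace) (Icc 0 t) := by
    simpa using continuousOn_trace_mul_mul_transpose
      (continuousOn_const (c := (1 : Matrix (Fin n) (Fin n) ℝ))) hA
  have hfpj : ∀ j, ContinuousOn (fun r => spaceGrad L r (x r) j) (Icc 0 t) := fun j =>
    (EuclideanSpace.proj j : Vec n →L[ℝ] ℝ).continuous.comp_continuousOn hfp
  dsimp only at hf0 hfp hfH hft
  -- the drift part of the increments
  have hb : Tendsto (fun i => ∑ k ∈ Finset.range (Ns i), ‖(WithLp.toLp 2 (fun j =>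
      ∫ r in (grid t (Ns i) k)..(grid t (Ns i) (k + 1)), β r j) : Vec n)‖ ^ 2)
      atTop (𝓝 0) := by
    have := tendsto_finsetSum Finset.univ fun j _ => tendsto_sum_sq_integral ht hN (hβ j)
    simp only [Finset.sum_const_zero] at this
    refine this.congr fun i => ?_
    rw [Finset.sum_comm]
    simp [EuclideanSpace.norm_sq_eq]
  have he : Tendsto (fun i => ∑ k ∈ Finset.range (Ns i), ‖(WithLp.toLp 2 (fun j =>
      ∫ r in (grid t (Ns i) k)..(grid t (Ns i) (k + 1)), β r j) : Vec n) + E i k‖ ^ 2)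
      atTop (𝓝 0) := by
    refine squeeze_zero (fun i => Finset.sum_nonneg fun _ _ => sq_nonneg _)
      (fun i => Finset.sum_le_sum fun k _ => norm_sq_add_le _ _) ?_
    have := (hb.const_mul 2).add (h1.const_mul 2)
    simpa [Finset.mul_sum, Finset.sum_add_distrib] using this
  -- boundedness of the second order part
  obtain ⟨C, hC⟩ := (isCompact_Icc.image_of_continuousOn hfA).bddAbove
  have hq : ∀ᶠ i in atTop, ∑ k ∈ Finset.range (Ns i), θ i k * ‖q i k‖ ^ 2 ≤ 1 + |C| * t := by
    filter_upwards [h4.eventually (gt_mem_nhds zero_lt_one), hN.eventually_gt_atTop 0]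
      with i hi hi0
    have hs : ∑ k ∈ Finset.range (Ns i), θ i k *
        ((A (grid t (Ns i) k) * (A (grid t (Ns i) k)).transpose).trace
          * (grid t (Ns i) (k + 1) - grid t (Ns i) k)) ≤ |C| * t := by
      have htel : ∑ k ∈ Finset.range (Ns i), |C| * (grid t (Ns i) (k + 1) - grid t (Ns i) k)
          = |C| * t := by
        rw [← Finset.mul_sum, Finset.sum_range_sub, grid_zero, grid_self hi0, sub_zero]
      rw [← htel]
      refine Finset.sum_le_sum fun k _ => ?_
      have hg : 0 ≤ grid t (Ns i) (k + 1) - grid t (Ns i) k :=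
        sub_nonneg.2 (grid_mono ht k.le_succ)
      have hc : (A (grid t (Ns i) k) * (A (grid t (Ns i) k)).transpose).trace ≤ |C| :=
        (hC (mem_image_of_mem _ (grid_mem ht k))).trans (le_abs_self C)
      calc θ i k * ((A (grid t (Ns i) k) * (A (grid t (Ns i) k)).transpose).trace
          * (grid t (Ns i) (k + 1) - grid t (Ns i) k))
          ≤ θ i k * (|C| * (grid t (Ns i) (k + 1) - grid t (Ns i) k)) :=
            mul_le_mul_of_nonneg_left (mul_le_mul_of_nonneg_right hc hg) (hθ i k).1
        _ ≤ 1 * (|C| * (grid t (Ns i) (k + 1) - grid t (Ns i) k)) :=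
            mul_le_mul_of_nonneg_right (hθ i k).2 (mul_nonneg (abs_nonneg C) hg)
        _ = _ := one_mul _
    have : ∑ k ∈ Finset.range (Ns i), θ i k * ‖q i k‖ ^ 2
        = ∑ k ∈ Finset.range (Ns i), θ i k * (‖q i k‖ ^ 2
            - (A (grid t (Ns i) k) * (A (grid t (Ns i) k)).transpose).trace
              * (grid t (Ns i) (k + 1) - grid t (Ns i) k))
          + ∑ k ∈ Finset.range (Ns i), θ i k *
            ((A (grid t (Ns i) k) * (A (grid t (Ns i) k)).transpose).trace
              * (grid t (Ns i) (k + 1) - grid t (Ns i) k)) := by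
      rw [← Finset.sum_add_distrib]
      exact Finset.sum_congr rfl fun k _ => by ring
    linarith
  have hT := hL.tendsto_taylor_sum ht htT hN hθ hx hinc he hq
  -- The time derivative and the trace are integrated against `dr`, each gradient coordinate against
  -- `β_j dr`, which is merely integrable; the same Riemann sum lemma serves for both.
  have hone : IntervalIntegrable (fun _ : ℝ => (1 : ℝ)) volume 0 t := intervalIntegrable_const
  have r0 := tendsto_riemann_sum ht hN hθ hf0 hone
  have r2 := tendsto_riemann_sum ht hN hθ hft hone
  have r1 := tendsto_finsetSum Finset.univ fun j _ =>
    tendsto_riemann_sum ht hN hθ (hfpj j) (hβ j)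
  have hsum := ((((hT.add r0).add r1).add h2).add (h3.const_mul (1 / 2))).add
    (r2.const_mul (1 / 2))
  simp only [Finset.sum_const_zero, add_zero, mul_zero] at hsum
  refine hsum.congr fun i => ?_
  rw [Finset.sum_comm]
  simp only [Finset.mul_sum, ← Finset.sum_add_distrib]
  refine Finset.sum_congr rfl fun k _ => ?_
  have hsub : Icc (grid t (Ns i) k) (grid t (Ns i) (k + 1)) ⊆ Icc 0 t :=
    Icc_subset_Icc (grid_mem ht k).1 (grid_mem ht _).2
  have hle : grid t (Ns i) k ≤ grid t (Ns i) (k + 1) := grid_mono ht k.le_succ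
  have hii : ∀ {f : ℝ → ℝ}, ContinuousOn f (Icc 0 t) →
      IntervalIntegrable f volume (grid t (Ns i) k) (grid t (Ns i) (k + 1)) := fun hf =>
    (hf.mono (by rwa [uIcc_of_le hle])).intervalIntegrable
  have hpb : ∀ j ∈ Finset.univ, IntervalIntegrable (fun r => spaceGrad L r (x r) j * β r j)
      volume (grid t (Ns i) k) (grid t (Ns i) (k + 1)) := fun j _ =>
    (intervalIntegrable_grid ht (hβ j) (Ns i) k).continuousOn_mul
      ((hfpj j).mono (by rwa [uIcc_of_le hle]))
  have hG : ∫ r in (grid t (Ns i) k)..(grid t (Ns i) (k + 1)),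
      (timeDeriv T L r (x r) + inner ℝ (spaceGrad L r (x r)) (β r)
        + (1 / 2) * (spaceHess L r (x r) * (A r * (A r).transpose)).trace)
      = (∫ r in (grid t (Ns i) k)..(grid t (Ns i) (k + 1)), timeDeriv T L r (x r))
        + (∑ j, ∫ r in (grid t (Ns i) k)..(grid t (Ns i) (k + 1)),
            spaceGrad L r (x r) j * β r j)
        + (1 / 2) * ∫ r in (grid t (Ns i) k)..(grid t (Ns i) (k + 1)),
          (spaceHess L r (x r) * (A r * (A r).transpose)).trace := by
    simp only [inner_vec_eq_sum]
    have hps : IntervalIntegrable (fun r => ∑ j, spaceGrad L r (x r) j * β r j)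
        volume (grid t (Ns i) k) (grid t (Ns i) (k + 1)) := by
      have := IntervalIntegrable.sum Finset.univ hpb
      rwa [Finset.sum_fn] at this
    rw [intervalIntegral.integral_add ((hii hf0).add hps) ((hii hft).const_mul _),
      intervalIntegral.integral_add (hii hf0) hps, intervalIntegral.integral_const_mul,
      intervalIntegral.integral_finsetSum hpb]
  rw [hG]
  simp only [inner_add_right, inner_vec_eq_sum, mul_one, intervalIntegral.integral_const,
    smul_eq_mul, mul_sub, Finset.sum_sub_distrib, ← Finset.mul_sum, mul_add]
  ring

end PathwiseIto

/-! ### Measurability of processes on a time interval -/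

section ProcessMeasurability

variable {Ω : Type*} {t : ℝ}

lemma IsProgressiveOn.measurable_eval {E : Type*} [MeasurableSpace E]
    {𝓕 : ℝ → MeasurableSpace Ω} {a b : ℝ} {Y : ℝ → Ω → E} (h : IsProgressiveOn 𝓕 a b Y)
    {t : ℝ} (ht : t ∈ Icc a b) : Measurable[𝓕 t] (Y t) :=
  (h t ht).comp (@measurable_prodMk_left _ _ _ (𝓕 t) (⟨t, ht.1, le_rfl⟩ : Icc a t))

lemma ContinuousOn.measurable_comp {α β γ : Type*} [TopologicalSpace α] [MeasurableSpace α]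
    [BorelSpace α] [TopologicalSpace β] [MeasurableSpace β] [BorelSpace β] {mγ : MeasurableSpace γ}
    {F : α → β} {K : Set α} (hF : ContinuousOn F K) {Y : γ → α} (hY : Measurable Y)
    (h : ∀ p, Y p ∈ K) : Measurable (fun p => F (Y p)) :=
  (continuousOn_iff_continuous_domRestrict.1 hF).measurable.comp (hY.subtype_mk (h := h))

variable [mΩ : MeasurableSpace Ω]

/-- Clamping the time variable turns a process measurable on `[0, t] × Ω` into one measurable on `ℝ
× Ω`, to which Fubini applies. -/
lemma measurable_extend_Icc {E : Type*} [MeasurableSpace E] (ht : 0 ≤ t) {Y : ℝ → Ω → E}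
    (hY : Measurable (fun p : Icc (0 : ℝ) t × Ω => Y p.1 p.2)) :
    Measurable (fun p : ℝ × Ω => Y (projIcc 0 t ht p.1) p.2) :=
  hY.comp (((continuous_projIcc (h := ht)).measurable.comp measurable_fst).prodMk measurable_snd)

lemma measurable_integral_process (ht : 0 ≤ t) {Y : ℝ → Ω → ℝ}
    (hY : Measurable (fun p : Icc (0 : ℝ) t × Ω => Y p.1 p.2)) :
    Measurable (fun ω => ∫ r in (0 : ℝ)..t, Y r ω) := by
  have h : ∀ ω, ∫ r in (0 : ℝ)..t, Y r ω
      = ∫ r in Ioc 0 t, Y (projIcc 0 t ht r) ω := fun ω => by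
    rw [intervalIntegral.integral_of_le ht]
    refine setIntegral_congr_fun measurableSet_Ioc fun r hr => ?_
    simp only [projIcc_of_mem ht (Ioc_subset_Icc_self hr)]
  simp only [h]
  exact ((measurable_extend_Icc ht hY).comp
    measurable_swap).stronglyMeasurable.integral_prod_right'.measurable

lemma measurable_lintegral_process (ht : 0 ≤ t) {Y : ℝ → Ω → ℝ≥0∞}
    (hY : Measurable (fun p : Icc (0 : ℝ) t × Ω => Y p.1 p.2)) :
    Measurable (fun ω => ∫⁻ r in Icc 0 t, Y r ω) := by
  have h : ∀ ω, ∫⁻ r in Icc 0 t, Y r ω = ∫⁻ r in Icc 0 t, Y (projIcc 0 t ht r) ω := fun ω => by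
    refine setLIntegral_congr_fun measurableSet_Icc fun r hr => ?_
    simp only [projIcc_of_mem ht hr]
  simp only [h]
  exact ((measurable_extend_Icc ht hY).comp measurable_swap).lintegral_prod_right'

lemma aemeasurable_timeMeasure {E : Type*} [MeasurableSpace E] {T : ℝ} {P : Measure Ω}
    [SFinite P] (hT : 0 ≤ T) {Y : ℝ → Ω → E}
    (hY : Measurable (fun p : Icc (0 : ℝ) T × Ω => Y p.1 p.2)) :
    AEMeasurable (fun p : ℝ × Ω => Y p.1 p.2) (timeMeasure T P) := by
  refine ⟨_, measurable_extend_Icc hT hY, ?_⟩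
  have h : ∀ᵐ p : ℝ × Ω ∂(timeMeasure T P), p.1 ∈ Icc 0 T :=
    Measure.quasiMeasurePreserving_fst.ae (ae_restrict_mem measurableSet_Icc)
  filter_upwards [h] with p hp
  rw [projIcc_of_mem hT hp]

end ProcessMeasurability

/-! ### Diffusions driven by a Brownian motion -/

section Diffusion

set_option linter.unusedSectionVars false

variable {Ω : Type*} {n m d : ℕ} [mΩ : MeasurableSpace Ω] {W : ℝ → Ω → Vec m} {P : Measure Ω}
  {T : ℝ}

/-- The coordinates of `X - x - ∫ β` are the square integrable stochastic integrals of the rows of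
`σ(s, X_s)`. -/
structure IsItoDiffusion (W : ℝ → Ω → Vec m) (P : Measure Ω) (T : ℝ) (x : Vec n)
    (σ : ℝ → Vec n → Matrix (Fin n) (Fin m) ℝ) (β : ℝ → Ω → Vec n) (X : ℝ → Ω → Vec n) :
    Prop where
  σ_continuous : ContinuousOn (fun p : ℝ × Vec n => σ p.1 p.2) (Icc 0 T ×ˢ univ)
  progressive : IsProgressiveOn (augmentedSigma W P) 0 T X
  continuous : ∀ᵐ ω ∂P, ContinuousOn (fun s => X s ω) (Icc 0 T)
  drift_measurable : Measurable (fun p : Icc (0 : ℝ) T × Ω => β p.1 p.2)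
  drift_integrable : ∀ᵐ ω ∂P, ∀ j, IntervalIntegrable (fun r => β r ω j) volume 0 T
  rows : ∀ i, IsContinuousIto W P T (fun s ω => WithLp.toLp 2 (σ s (X s ω) i))
    (fun s ω => X s ω i - x i - ∫ r in (0 : ℝ)..s, β r ω i)

lemma norm_row_le_frobNorm (A : Matrix (Fin n) (Fin m) ℝ) (i : Fin n) :
    ‖(WithLp.toLp 2 (A i) : Vec m)‖ ≤ frobNorm A := by
  rw [EuclideanSpace.norm_eq, frobNorm]
  refine Real.sqrt_le_sqrt ?_
  simp only [Real.norm_eq_abs, sq_abs]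
  exact Finset.single_le_sum (f := fun i => ∑ j, A i j ^ 2)
    (fun _ _ => Finset.sum_nonneg fun _ _ => sq_nonneg _) (Finset.mem_univ i)

variable [IsProbabilityMeasure P] {M : ControlProblem n m d}

/-- The supremum over all times need not be measurable. The one over a countable dense set of times
is, its integral is no larger, and continuity of the paths makes it a bound at all times. -/
lemma ControlProblem.IsAdmissible.exists_bound (hW : IsBrownianMotion W P M.T) (hT : 0 ≤ M.T)
    {x : Vec n} {u : ℝ → Ω → Vec d} {X : ℝ → Ω → Vec n} (h : M.IsAdmissible W P 0 x u X) :
    ∃ Z : Ω → ℝ, MemLp Z 2 P ∧ ∀ᵐ ω ∂P, ∀ s ∈ Icc 0 M.T, ‖X s ω‖ ≤ Z ω := by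
  have : Nonempty (Icc 0 M.T) := ⟨⟨0, le_rfl, hT⟩⟩
  let q := TopologicalSpace.denseSeq (Icc 0 M.T)
  have hXm : ∀ k, Measurable (X (q k)) := fun k =>
    (h.solution.progressive.measurable_eval (q k).2).mono (hW.augmentedSigma_le (q k).2.2) le_rfl
  let Y : Ω → ℝ≥0∞ := fun ω => ⨆ k, ‖X (q k) ω‖ₑ ^ 2
  have hY : Measurable Y := Measurable.iSup fun k => (hXm k).enorm.pow_const 2
  have hYle : ∫⁻ ω, Y ω ∂P < ∞ := by
    refine lt_of_le_of_lt (lintegral_mono fun ω => iSup_le fun k => ?_) h.state_sq_integrable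
    exact le_iSup₂_of_le (q k : ℝ) (q k).2 le_rfl
  have hYfin := ae_lt_top hY hYle.ne
  refine ⟨fun ω => √(Y ω).toReal, ?_, ?_⟩
  · rw [memLp_two_iff_integrable_sq hY.ennreal_toReal.sqrt.aestronglyMeasurable]
    simp only [Real.sq_sqrt ENNReal.toReal_nonneg]
    exact integrable_toReal_of_lintegral_ne_top hY.aemeasurable hYle.ne
  · filter_upwards [hYfin, h.solution.continuous_paths] with ω hω hc s hs
    have hcl : IsClosed {r : Icc 0 M.T | ‖X r ω‖ ≤ √(Y ω).toReal} :=
      isClosed_le (continuousOn_iff_continuous_domRestrict.1 hc).norm continuous_const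
    have hsub : range q ⊆ {r : Icc 0 M.T | ‖X r ω‖ ≤ √(Y ω).toReal} := by
      rintro _ ⟨k, rfl⟩
      refine Real.le_sqrt_of_sq_le ?_
      have hk : ‖X (q k) ω‖ₑ ^ 2 ≤ Y ω := le_iSup (fun k => ‖X (q k) ω‖ₑ ^ 2) k
      have := ENNReal.toReal_mono hω.ne hk
      simpa using this
    have hall := closure_minimal hsub hcl
    rw [(TopologicalSpace.denseRange_denseSeq (Icc 0 M.T)).closure_range] at hall
    have hmem := hall (mem_univ (⟨s, hs⟩ : Icc 0 M.T))
    rwa [mem_ofPred_eq] at hmem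

/-- Linear growth and the square integrable supremum of the state dominate the rows of `σ` in `L²`,
so the integrals in the SDE are `L²` limits. This is the form in which the dynamics enter Itô's
formula. -/
theorem ControlProblem.IsAdmissible.isItoDiffusion (hM : M.StandingAssumptions)
    (hW : IsBrownianMotion W P M.T) {x : Vec n} {u : ℝ → Ω → Vec d} {X : ℝ → Ω → Vec n}
    (h : M.IsAdmissible W P 0 x u X) :
    IsItoDiffusion W P M.T x M.σ (fun r ω => M.b r (X r ω) (u r ω)) X := by
  have hT := hM.T_pos.le
  obtain ⟨Z, hZ, hZb⟩ := h.exists_bound hW hT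
  obtain ⟨C, hC0, hC⟩ := hM.linear_growth
  obtain ⟨ω₀⟩ : Nonempty Ω := nonempty_of_isProbabilityMeasure P
  -- The growth bound on `σ` is stated together with that on `b`, for controls in `U`; some element
  -- of `U` must be chosen to use it.
  set u₀ := u 0 ω₀
  have hu₀ : u₀ ∈ M.U := h.mem_U 0 ⟨le_rfl, hT⟩ ω₀
  have hTm : M.T ∈ Icc 0 M.T := ⟨hT, le_rfl⟩
  have hXj : Measurable (fun p : Icc (0 : ℝ) M.T × Ω => X p.1 p.2) :=
    (h.solution.progressive M.T hTm).mono
      (sup_le_sup le_rfl (MeasurableSpace.comap_mono (hW.augmentedSigma_le le_rfl))) le_rfl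
  have huj : Measurable (fun p : Icc (0 : ℝ) M.T × Ω => u p.1 p.2) :=
    (h.progressive M.T hTm).mono
      (sup_le_sup le_rfl (MeasurableSpace.comap_mono (hW.augmentedSigma_le le_rfl))) le_rfl
  have hbj : Measurable (fun p : Icc (0 : ℝ) M.T × Ω => M.b p.1 (X p.1 p.2) (u p.1 p.2)) :=
    hM.b_continuous.measurable_comp
      (Y := fun p : Icc (0 : ℝ) M.T × Ω => ((p.1 : ℝ), X p.1 p.2, u p.1 p.2))
      (measurable_fst.subtype_val.prodMk (hXj.prodMk huj))
      fun p => ⟨p.1.2, mem_univ _, h.mem_U p.1 p.1.2 p.2⟩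
  have hrow : ∀ i, ContinuousOn (fun p : ℝ × Vec n => (WithLp.toLp 2 (M.σ p.1 p.2 i) : Vec m))
      (Icc 0 M.T ×ˢ univ) := fun i =>
    (PiLp.continuous_toLp 2 _).comp_continuousOn
      ((continuous_apply i).comp_continuousOn hM.σ_continuous)
  have hrowle : ∀ i, ∀ s ∈ Icc 0 M.T, ∀ y, ‖(WithLp.toLp 2 (M.σ s y i) : Vec m)‖
      ≤ C * (1 + ‖y‖ + ‖u₀‖) := fun i s hs y =>
    (norm_row_le_frobNorm _ i).trans
      ((le_add_of_nonneg_left (norm_nonneg _)).trans (hC s hs y u₀ hu₀))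
  have hZ' : MemLp (fun ω => C * (1 + Z ω + ‖u₀‖)) 2 P := by
    have h1 : MemLp (fun ω => 1 + Z ω) 2 P := (memLp_const (1 : ℝ)).add hZ
    have h2 : MemLp (fun ω => 1 + Z ω + ‖u₀‖) 2 P := h1.add (memLp_const ‖u₀‖)
    exact h2.const_mul C
  have hrowb : ∀ i, ∀ᵐ ω ∂P, ∀ s ∈ Icc 0 M.T, ‖(WithLp.toLp 2 (M.σ s (X s ω) i) : Vec m)‖
      ≤ C * (1 + Z ω + ‖u₀‖) := fun i => by
    filter_upwards [hZb] with ω hω s hs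
    refine (hrowle i s hs _).trans ?_
    have := hω s hs
    gcongr
  have hrowj : ∀ i, Measurable (fun p : Icc (0 : ℝ) M.T × Ω =>
      (WithLp.toLp 2 (M.σ p.1 (X p.1 p.2) i) : Vec m)) := fun i =>
    (hrow i).measurable_comp (Y := fun p : Icc (0 : ℝ) M.T × Ω => ((p.1 : ℝ), X p.1 p.2))
      (measurable_fst.subtype_val.prodMk hXj) fun p => ⟨p.1.2, mem_univ _⟩
  refine ⟨hM.σ_continuous, h.solution.progressive, h.solution.continuous_paths,
    hbj, ?_, fun i => ⟨fun s hs => ?_, ?_, ⟨_, hZ', hrowb i⟩, fun s hs => ?_⟩⟩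
  · have hufin : ∀ᵐ ω ∂P, ∫⁻ s in Icc 0 M.T, ‖u s ω‖ₑ ^ 2 < ∞ :=
      ae_lt_top (measurable_lintegral_process hT (huj.enorm.pow_const 2))
        h.control_sq_integrable.ne
    filter_upwards [hufin, hZb] with ω hω hZω j
    rw [intervalIntegrable_iff_integrableOn_Icc_of_le hT]
    have hum : AEStronglyMeasurable (fun r => u r ω) (volume.restrict (Icc 0 M.T)) :=
      (h.progressive.aemeasurable_path hTm ω).aestronglyMeasurable
    have hu2 : MemLp (fun r => u r ω) 2 (volume.restrict (Icc 0 M.T)) := by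
      refine ⟨hum, ?_⟩
      have := eLpNorm_two_sq (volume.restrict (Icc 0 M.T)) (fun r => u r ω)
      rw [← this] at hω
      exact lt_of_not_ge fun htop => by simp [top_le_iff.1 htop] at hω
    have hu1 : Integrable (fun r => C * (1 + Z ω + ‖u r ω‖)) (volume.restrict (Icc 0 M.T)) := by
      have h1 : Integrable (fun r => 1 + Z ω + ‖u r ω‖) (volume.restrict (Icc 0 M.T)) :=
        (integrable_const (1 + Z ω)).add (hu2.integrable (by norm_num)).norm
      exact h1.const_mul C
    refine hu1.mono' ?_ ?_
    · refine (aemeasurable_restrict_of_measurable_subtype measurableSet_Icc ?_).aestronglyMeasurable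
      exact measurable_vec_apply (hbj.comp measurable_prodMk_right) j
    · filter_upwards [ae_restrict_mem measurableSet_Icc] with r hr
      have h1 := hC r hr (X r ω) (u r ω) (h.mem_U r hr ω)
      have h2 : 0 ≤ frobNorm (M.σ r (X r ω)) := Real.sqrt_nonneg _
      have h3 := hZω r hr
      refine (PiLp.norm_apply_le _ j).trans (((le_add_of_nonneg_right h2).trans h1).trans ?_)
      gcongr
  · have hc : Continuous (fun y : Vec n => (WithLp.toLp 2 (M.σ s y i) : Vec m)) := by
      rw [← continuousOn_univ]
      exact (hrow i).comp (f := fun y : Vec n => (s, y)) (by fun_prop) fun y _ => ⟨hs, mem_univ y⟩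
    exact hc.measurable.comp (h.solution.progressive.measurable_eval hs)
  · filter_upwards [h.solution.continuous_paths] with ω hω
    exact (hrow i).comp (continuousOn_id.prodMk hω) fun s hs => ⟨hs, mem_univ _⟩
  · refine (h.solution.sde s hs i).isL2Ito hW hs.1 hs.2 ?_
    have hb : MemLp (fun p : ℝ × Ω => C * (1 + Z p.2 + ‖u₀‖)) 2 (timeMeasure M.T P) :=
      hZ'.comp_snd _
    refine hb.mono ?_ ?_
    · refine AEMeasurable.aestronglyMeasurable ?_
      exact (aemeasurable_timeMeasure (Y := fun r ω => (WithLp.toLp 2 (M.σ r (X r ω) i) : Vec m))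
        hT (hrowj i)).indicator
        (s := Prod.fst ⁻¹' Ioc 0 s) (measurable_fst measurableSet_Ioc)
    · have h1 : ∀ᵐ p : ℝ × Ω ∂(timeMeasure M.T P), p.1 ∈ Icc 0 M.T :=
        Measure.quasiMeasurePreserving_fst.ae (ae_restrict_mem measurableSet_Icc)
      have h2 := (Measure.quasiMeasurePreserving_snd (μ := volume.restrict (Icc 0 M.T))).ae
        (hrowb i)
      filter_upwards [h1, h2] with p hp1 hp2
      refine (norm_indicator_le_norm_self _ _).trans ((hp2 p.1 hp1).trans (le_abs_self _))

end Diffusion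

/-! ### Stopped left-point sums -/

/-- Choose indices with integrals at most `2⁻ⁱ`: the series then has a finite integral, so it
converges almost everywhere. -/
lemma exists_subseq_ae_tendsto_zero {α : Type*} {mα : MeasurableSpace α} {μ : Measure α}
    {Y : ℕ → α → ℝ≥0∞} (hY : ∀ n, AEMeasurable (Y n) μ)
    (h : Tendsto (fun n => ∫⁻ a, Y n a ∂μ) atTop (𝓝 0)) :
    ∃ ns : ℕ → ℕ, StrictMono ns ∧ ∀ᵐ a ∂μ, Tendsto (fun i => Y (ns i) a) atTop (𝓝 0) := by
  have h2 : ∀ i : ℕ, ∀ᶠ n in atTop, ∫⁻ a, Y n a ∂μ ≤ 2⁻¹ ^ i := fun i =>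
    h.eventually (ge_mem_nhds (ENNReal.pow_pos (by simp) i))
  obtain ⟨ns, hns, hle⟩ := extraction_forall_of_eventually h2
  refine ⟨ns, hns, ?_⟩
  have hsum : ∫⁻ a, ∑' i, Y (ns i) a ∂μ ≠ ∞ := by
    rw [lintegral_tsum fun i => hY _]
    refine ne_top_of_le_ne_top ?_ (ENNReal.tsum_le_tsum hle)
    rw [ENNReal.tsum_geometric]
    simp
  filter_upwards [ae_lt_top' (AEMeasurable.tsum fun i => hY _) hsum] with a ha
  exact ENNReal.tendsto_atTop_zero_of_tsum_ne_top ha.ne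

section StopWeight

variable {Ω : Type*} {n m : ℕ}

/-- The left-point sum `∑_{j < k} ξ_{t_j} ⬝ (W_{t_{j+1}} - W_{t_j})` over the grid of `[0, t]`. -/
noncomputable def leftSum (W ξ : ℝ → Ω → Vec m) (t : ℝ) (N k : ℕ) (ω : Ω) : ℝ :=
  ∑ j ∈ Finset.range k, inner ℝ (ξ (grid t N j) ω) (W (grid t N (j + 1)) ω - W (grid t N j) ω)

open scoped Classical in
/-- The indicator of the event that neither `X` nor the left-point sum have exceeded `l` at the
grid times up to the `k`-th. -/
noncomputable def stopWeight (W ξ : ℝ → Ω → Vec m) (X : ℝ → Ω → Vec n) (l t : ℝ) (N k : ℕ)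
    (ω : Ω) : ℝ :=
  if ∀ j ≤ k, ‖X (grid t N j) ω‖ ≤ l ∧ |leftSum W ξ t N j ω| ≤ l then 1 else 0

variable {W ξ : ℝ → Ω → Vec m} {X : ℝ → Ω → Vec n} {l t : ℝ} {N k : ℕ} {ω : Ω}

lemma stopWeight_eq_one_iff : stopWeight W ξ X l t N k ω = 1 ↔
    ∀ j ≤ k, ‖X (grid t N j) ω‖ ≤ l ∧ |leftSum W ξ t N j ω| ≤ l := by
  unfold stopWeight
  split_ifs with h
  · exact ⟨fun _ => h, fun _ => rfl⟩
  · exact ⟨fun h0 => absurd h0 (by norm_num), fun h1 => absurd h1 h⟩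

lemma stopWeight_eq_zero_or_one :
    stopWeight W ξ X l t N k ω = 0 ∨ stopWeight W ξ X l t N k ω = 1 := by
  unfold stopWeight
  split_ifs <;> simp

lemma stopWeight_mem_Icc : stopWeight W ξ X l t N k ω ∈ Icc (0 : ℝ) 1 := by
  rcases stopWeight_eq_zero_or_one (W := W) (ξ := ξ) (X := X) (l := l) (t := t) (N := N) (k := k)
    (ω := ω) with h | h <;> simp [h]

lemma stopWeight_mono (h : stopWeight W ξ X l t N k ω = 1) :
    ∀ j ≤ k, stopWeight W ξ X l t N j ω = 1 := fun _ hj =>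
  stopWeight_eq_one_iff.2 fun i hi => stopWeight_eq_one_iff.1 h i (hi.trans hj)

/-- The weight vanishes once the state has left the ball of radius `l`, so that continuous
coefficients multiplied by it are bounded, as the `L²` estimates require. -/
lemma norm_stopWeight_smul_le {E : Type*} [SeminormedAddCommGroup E] [NormedSpace ℝ E] {v : E}
    {K : ℝ} (hK : 0 ≤ K) (h : ‖X (grid t N k) ω‖ ≤ l → ‖v‖ ≤ K) :
    ‖stopWeight W ξ X l t N k ω • v‖ ≤ K := by
  rcases stopWeight_eq_zero_or_one (W := W) (ξ := ξ) (X := X) (l := l) (t := t) (N := N) (k := k)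
    (ω := ω) with h1 | h1
  · simpa [h1] using hK
  · rw [h1, one_smul]
    exact h (stopWeight_eq_one_iff.1 h1 k le_rfl).1

variable [mΩ : MeasurableSpace Ω] {P : Measure Ω}

lemma measurable_leftSum (ht : 0 ≤ t)
    (hξ : ∀ s ∈ Icc 0 t, Measurable[augmentedSigma W P s] (ξ s)) (N k : ℕ) :
    Measurable[augmentedSigma W P (grid t N k)] (leftSum W ξ t N k) := by
  refine Finset.measurable_fun_sum _ fun j hj => ?_
  exact IsBrownianMotion.measurable_inner_increment (grid_mem ht j).1 (grid_mono ht j.le_succ)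
    (grid_mono ht (Nat.succ_le_of_lt (Finset.mem_range.1 hj))) (hξ _ (grid_mem ht j))

/-- The left-point sum of index `j` involves `W` only up to the `j`-th grid time. The weight is thus
known at the left endpoint of its cell and does not disturb the martingale estimates. -/
lemma measurable_stopWeight (ht : 0 ≤ t)
    (hξ : ∀ s ∈ Icc 0 t, Measurable[augmentedSigma W P s] (ξ s))
    (hX : ∀ s ∈ Icc 0 t, Measurable[augmentedSigma W P s] (X s)) (N k : ℕ) :
    Measurable[augmentedSigma W P (grid t N k)] (stopWeight W ξ X l t N k) := by
  classical
  have hset : MeasurableSet[augmentedSigma W P (grid t N k)]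
      {ω | ∀ j ≤ k, ‖X (grid t N j) ω‖ ≤ l ∧ |leftSum W ξ t N j ω| ≤ l} := by
    simp only [ofPred_forall]
    refine MeasurableSet.iInter fun j => MeasurableSet.iInter fun hj => ?_
    have hF : augmentedSigma W P (grid t N j) ≤ augmentedSigma W P (grid t N k) :=
      augmentedSigma_mono (grid_mono ht hj)
    have h1 := (hX _ (grid_mem ht j)).mono hF le_rfl
    have h2 := (measurable_leftSum ht hξ N j).mono hF le_rfl
    exact ((show Measurable (fun x : Vec n => ‖x‖) by fun_prop).comp h1 measurableSet_Iic).inter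
      ((show Measurable (fun x : ℝ => |x|) by fun_prop).comp h2 measurableSet_Iic)
  exact Measurable.ite hset measurable_const measurable_const

end StopWeight

/-! ### Itô's formula along grids -/

lemma tendsto_zero_of_enorm_sq {E : Type*} [SeminormedAddCommGroup E] {f : ℕ → E}
    (h : Tendsto (fun i => ‖f i‖ₑ ^ 2) atTop (𝓝 0)) : Tendsto f atTop (𝓝 0) := by
  have h1 := (ENNReal.tendsto_toReal ENNReal.zero_ne_top).comp h
  have h2 : Tendsto (fun i => √(‖f i‖ ^ 2)) atTop (𝓝 0) := by
    have := (Real.continuous_sqrt.tendsto _).comp h1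
    simpa [Function.comp_def] using this
  simp only [Real.sqrt_sq (norm_nonneg _)] at h2
  exact tendsto_zero_iff_norm_tendsto_zero.2 h2

section QuadraticForm

variable {n m : ℕ}

/-- Since `tr(G A Aᵀ) = tr(Aᵀ G A)`, the compensated quadratic form is a combination of centred
products with coefficients `Aᵀ G A`, and those are known at the left endpoint. -/
lemma matrixForm_mulVec_sub_trace (G : Matrix (Fin n) (Fin n) ℝ) (A : Matrix (Fin n) (Fin m) ℝ)
    (v : Vec m) (δ : ℝ) :
    matrixForm G (WithLp.toLp 2 (A.mulVec v.ofLp)) (WithLp.toLp 2 (A.mulVec v.ofLp))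
        - (G * (A * A.transpose)).trace * δ
      = ∑ a, ∑ b, (A.transpose * G * A) a b * (v a * v b - if a = b then δ else 0) := by
  have h1 : ∀ (k : ℕ) (H : Matrix (Fin k) (Fin k) ℝ) (u w : Vec k),
      matrixForm H u w = u.ofLp ⬝ᵥ H.mulVec w.ofLp := fun k H u w => by
    simp only [matrixForm, dotProduct, Matrix.mulVec, Finset.mul_sum]
    exact Finset.sum_congr rfl fun i _ => Finset.sum_congr rfl fun j _ => by ring
  have h2 : ∑ a, ∑ b, (A.transpose * G * A) a b * (v a * v b)
      = matrixForm G (WithLp.toLp 2 (A.mulVec v.ofLp)) (WithLp.toLp 2 (A.mulVec v.ofLp)) := by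
    change matrixForm _ v v = _
    rw [h1, h1, ← Matrix.mulVec_mulVec, ← Matrix.mulVec_mulVec, Matrix.dotProduct_mulVec,
      Matrix.vecMul_transpose]
  have h3 : ∑ a, ∑ b, (A.transpose * G * A) a b * (if a = b then δ else 0)
      = (G * (A * A.transpose)).trace * δ := by
    rw [← Matrix.mul_assoc, Matrix.trace_mul_comm, ← Matrix.mul_assoc]
    simp [Matrix.trace, Finset.sum_mul]
  rw [← h2, ← h3, ← Finset.sum_sub_distrib]
  simp only [← Finset.sum_sub_distrib, mul_sub]

lemma norm_sq_eq_matrixForm_one (u : Vec n) : ‖u‖ ^ 2 = matrixForm 1 u u := by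
  rw [EuclideanSpace.norm_sq_eq]
  simp [matrixForm, Matrix.one_apply, pow_two]

end QuadraticForm

section GridLimits

set_option linter.unusedSectionVars false

variable {Ω : Type*} {n m : ℕ} [mΩ : MeasurableSpace Ω] {W : ℝ → Ω → Vec m} {P : Measure Ω}
  {T t : ℝ} [IsProbabilityMeasure P] {c : ℕ → ℕ → Ω → ℝ} {C : ℝ}

lemma IsBrownianMotion.tendsto_eLpNorm_sum_centeredProduct (hW : IsBrownianMotion W P T)
    (ht : 0 ≤ t) (htT : t ≤ T)
    (hc : ∀ N, ∀ k < N, Measurable[augmentedSigma W P (grid t N k)] (c N k))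
    (hC : ∀ N k ω, |c N k ω| ≤ C) (a b : Fin m) :
    Tendsto (fun N => eLpNorm (fun ω => ∑ k ∈ Finset.range N,
      c N k ω * centeredProduct W a b (grid t N k) (grid t N (k + 1)) ω) 2 P) atTop (𝓝 0) := by
  refine tendsto_eLpNorm_two_zero (ENNReal.tendsto_zero_of_le ?_ fun N =>
    hW.lintegral_sq_sum_mul_centeredProduct_le ht htT (hc N) (fun k _ => hC N k) a b)
  rw [← ENNReal.ofReal_zero]
  refine ENNReal.tendsto_ofReal ?_
  -- The second moment bound `N C² K (t / N)²` is a constant divided by `N`.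
  have h := (tendsto_div_nat (t * (C ^ 2 * ((2 * gaussianFourthMoment m + 2) * t))))
  refine h.congr' ?_
  filter_upwards [eventually_gt_atTop 0] with N hN
  have : (N : ℝ) ≠ 0 := by exact_mod_cast hN.ne'
  field_simp

lemma IsContinuousIto.tendsto_eLpNorm_sum_incrementError {ψ : ℝ → Ω → Vec m} {D : ℝ → Ω → ℝ}
    (hW : IsBrownianMotion W P T) (h : IsContinuousIto W P T ψ D) (ht : 0 ≤ t) (htT : t ≤ T)
    (hc : ∀ N, ∀ k < N, Measurable[augmentedSigma W P (grid t N k)] (c N k))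
    (hC : ∀ N k ω, |c N k ω| ≤ C) :
    Tendsto (fun N => eLpNorm (fun ω => ∑ k ∈ Finset.range N,
      c N k ω * incrementError W ψ D (grid t N k) (grid t N (k + 1)) ω) 2 P) atTop (𝓝 0) := by
  refine ENNReal.tendsto_zero_of_le ?_ fun N =>
    h.eLpNorm_sum_mul_incrementError_le hW ht htT N (hc N) fun k _ => hC N k
  simpa using ENNReal.Tendsto.const_mul (h.tendsto_eLpNorm_gridError hW ht htT)
    (Or.inr ENNReal.ofReal_ne_top)

end GridLimits

section DiffusionIncrements

set_option linter.unusedSectionVars false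

variable {Ω : Type*} {n m : ℕ} [mΩ : MeasurableSpace Ω] {W : ℝ → Ω → Vec m} {P : Measure Ω}
  {T t : ℝ} {x : Vec n} {σ : ℝ → Vec n → Matrix (Fin n) (Fin m) ℝ} {β X : ℝ → Ω → Vec n}
  {V : ℝ → Vec n → ℝ}

/-- The integrand `V_xᵀ σ` of Itô's formula. -/
noncomputable def itoIntegrand (V : ℝ → Vec n → ℝ) (σ : ℝ → Vec n → Matrix (Fin n) (Fin m) ℝ)
    (s : ℝ) (y : Vec n) : Vec m :=
  WithLp.toLp 2 (Matrix.vecMul (spaceGrad V s y).ofLp (σ s y))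

/-- The drift `V_t + V_xᵀ b + ½ tr(V_xx σσᵀ)` of Itô's formula. -/
noncomputable def itoGenerator (T : ℝ) (V : ℝ → Vec n → ℝ)
    (σ : ℝ → Vec n → Matrix (Fin n) (Fin m) ℝ) (s : ℝ) (y b : Vec n) : ℝ :=
  timeDeriv T V s y + inner ℝ (spaceGrad V s y) b
    + (1 / 2) * (spaceHess V s y * (σ s y * (σ s y).transpose)).trace

/-- The martingale part of `V(s, X_s)` in Itô's formula. -/
noncomputable def itoRemainder (T : ℝ) (V : ℝ → Vec n → ℝ)
    (σ : ℝ → Vec n → Matrix (Fin n) (Fin m) ℝ) (β X : ℝ → Ω → Vec n) (s : ℝ) (ω : Ω) : ℝ :=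
  V s (X s ω) - V 0 (X 0 ω) - ∫ r in (0 : ℝ)..s, itoGenerator T V σ r (X r ω) (β r ω)

/-- The increment `σ(s, X_s) (W_t - W_s)`. -/
noncomputable def diffusionIncrement (W : ℝ → Ω → Vec m)
    (σ : ℝ → Vec n → Matrix (Fin n) (Fin m) ℝ) (X : ℝ → Ω → Vec n) (s t : ℝ) (ω : Ω) : Vec n :=
  WithLp.toLp 2 ((σ s (X s ω)).mulVec (W t ω - W s ω).ofLp)

/-- The vector of the differences between `∫_s^t σ(r, X_r) dW_r` and `σ(s, X_s) (W_t - W_s)`. -/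
noncomputable def diffusionError (W : ℝ → Ω → Vec m) (x : Vec n)
    (σ : ℝ → Vec n → Matrix (Fin n) (Fin m) ℝ) (β X : ℝ → Ω → Vec n) (s t : ℝ) (ω : Ω) : Vec n :=
  WithLp.toLp 2 fun i => incrementError W (fun s ω => WithLp.toLp 2 (σ s (X s ω) i))
    (fun s ω => X s ω i - x i - ∫ r in (0 : ℝ)..s, β r ω i) s t ω

lemma inner_itoIntegrand (s : ℝ) (y : Vec n) (w : Vec m) :
    inner ℝ (itoIntegrand V σ s y) w
      = inner ℝ (spaceGrad V s y) (WithLp.toLp 2 ((σ s y).mulVec w.ofLp)) := by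
  have h : ∀ (k : ℕ) (u v : Vec k), inner ℝ u v = u.ofLp ⬝ᵥ v.ofLp := fun k u v => by
    rw [inner_vec_eq_sum]; rfl
  rw [h, h, itoIntegrand, Matrix.dotProduct_mulVec]

lemma IsC12.continuousOn_itoIntegrand (hL : IsC12 T V)
    (hσ : ContinuousOn (fun p : ℝ × Vec n => σ p.1 p.2) (Icc 0 T ×ˢ univ)) :
    ContinuousOn (fun p : ℝ × Vec n => itoIntegrand V σ p.1 p.2) (Ico 0 T ×ˢ univ) := by
  have hσ' := fun i j => (continuous_apply_apply (ρ := fun _ _ => ℝ) i j).comp_continuousOn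
    (hσ.mono (prod_mono Ico_subset_Icc_self Subset.rfl))
  have hp := fun i : Fin n =>
    (EuclideanSpace.proj i : Vec n →L[ℝ] ℝ).continuous.comp_continuousOn hL.continuousOn_spaceGrad
  refine (PiLp.continuous_toLp 2 _).comp_continuousOn (continuousOn_pi.2 fun j => ?_)
  have h : ContinuousOn (fun p : ℝ × Vec n => ∑ i, spaceGrad V p.1 p.2 i * σ p.1 p.2 i j)
      (Ico 0 T ×ˢ univ) := continuousOn_finsetSum _ fun i _ => (hp i).mul (hσ' i j)
  exact h

lemma exists_norm_le_on_ball {E : Type*} [SeminormedAddCommGroup E] {G : ℝ × Vec n → E}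
    (hG : ContinuousOn G (Ico 0 T ×ˢ univ)) (ht : t < T) (l : ℝ) :
    ∃ K, 0 ≤ K ∧ ∀ s ∈ Icc 0 t, ∀ y, ‖y‖ ≤ l → ‖G (s, y)‖ ≤ K := by
  have hK : IsCompact (Icc (0 : ℝ) t ×ˢ Metric.closedBall (0 : Vec n) l) :=
    isCompact_Icc.prod (isCompact_closedBall _ _)
  obtain ⟨K, hK'⟩ := hK.exists_bound_of_continuousOn
    (hG.mono (prod_mono (fun r hr => ⟨hr.1, hr.2.trans_lt ht⟩) (subset_univ _)))
  exact ⟨max K 0, le_max_right _ _, fun s hs y hy =>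
    (hK' (s, y) ⟨hs, by simpa using hy⟩).trans (le_max_left _ _)⟩

namespace IsItoDiffusion

lemma measurable_comp (h : IsItoDiffusion W P T x σ β X) {E : Type*} [TopologicalSpace E]
    [MeasurableSpace E] [BorelSpace E] {G : ℝ × Vec n → E}
    (hG : ContinuousOn G (Ico 0 T ×ˢ univ)) {s : ℝ} (hs : s ∈ Ico 0 T) :
    Measurable[augmentedSigma W P s] (fun ω => G (s, X s ω)) := by
  have hc : Continuous (fun y : Vec n => G (s, y)) := by
    rw [← continuousOn_univ]
    exact hG.comp (f := fun y : Vec n => (s, y)) (by fun_prop) fun y _ => ⟨hs, mem_univ y⟩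
  exact hc.measurable.comp (h.progressive.measurable_eval ⟨hs.1, hs.2.le⟩)

/-- An algebraic identity, true by the choice of `diffusionError`; the SDE enters later, through the
smallness of that error. A single null set serves for all pairs of times, hence for all grids. -/
lemma ae_increment_eq (h : IsItoDiffusion W P T x σ β X) :
    ∀ᵐ ω ∂P, ∀ s t : ℝ, 0 ≤ s → s ≤ t → t ≤ T → X t ω - X s ω
      = (WithLp.toLp 2 (fun j => ∫ r in s..t, β r ω j) + diffusionError W x σ β X s t ω)
        + diffusionIncrement W σ X s t ω := by
  filter_upwards [h.drift_integrable] with ω hω s t hs hst ht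
  ext j
  have hsub : ∀ u ∈ Icc (0 : ℝ) T, IntervalIntegrable (fun r => β r ω j) volume 0 u :=
    fun u hu => (hω j).mono_set (by
      rw [uIcc_of_le hu.1, uIcc_of_le (hu.1.trans hu.2)]
      exact Icc_subset_Icc_right hu.2)
  have hint := intervalIntegral.integral_interval_sub_left
    (hsub t ⟨hs.trans hst, ht⟩) (hsub s ⟨hs, hst.trans ht⟩)
  have hin : inner ℝ (WithLp.toLp 2 (σ s (X s ω) j) : Vec m) (W t ω - W s ω)
      = (σ s (X s ω)).mulVec (W t ω - W s ω).ofLp j := inner_vec_eq_sum _ _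
  simp only [diffusionError, diffusionIncrement, incrementError, PiLp.add_apply, PiLp.sub_apply,
    hin, ← hint]
  ring

end IsItoDiffusion

end DiffusionIncrements

section GridIto

set_option linter.unusedSectionVars false

variable {Ω : Type*} {n m : ℕ} [mΩ : MeasurableSpace Ω] {W : ℝ → Ω → Vec m} {P : Measure Ω}
  {T t l : ℝ} {x : Vec n} {σ : ℝ → Vec n → Matrix (Fin n) (Fin m) ℝ} {β X : ℝ → Ω → Vec n}
  {V : ℝ → Vec n → ℝ}

/-- The weights that stop the diffusion `X` and the left-point sums of `V_xᵀ σ`. -/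
noncomputable abbrev itoWeight (W : ℝ → Ω → Vec m) (V : ℝ → Vec n → ℝ)
    (σ : ℝ → Vec n → Matrix (Fin n) (Fin m) ℝ) (X : ℝ → Ω → Vec n) (l t : ℝ) (N k : ℕ) (ω : Ω) :
    ℝ :=
  stopWeight W (fun s ω => itoIntegrand V σ s (X s ω)) X l t N k ω

namespace IsItoDiffusion

lemma measurable_itoWeight_smul (h : IsItoDiffusion W P T x σ β X) (hL : IsC12 T V)
    (ht : 0 ≤ t) (htT : t < T) {k : ℕ} {G : ℝ × Vec n → Vec k}
    (hG : ContinuousOn G (Ico 0 T ×ˢ univ)) (N j : ℕ) :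
    Measurable[augmentedSigma W P (grid t N j)] (fun ω => itoWeight W V σ X l t N j ω •
      G (grid t N j, X (grid t N j) ω)) := by
  have hs : ∀ s ∈ Icc 0 t, s ∈ Ico 0 T := fun s hs => ⟨hs.1, hs.2.trans_lt htT⟩
  have h1 := measurable_stopWeight (l := l) ht
    (fun s hs' => h.measurable_comp (hL.continuousOn_itoIntegrand h.σ_continuous) (hs s hs'))
    (fun s hs' => h.progressive.measurable_eval (Ico_subset_Icc_self (hs s hs'))) N j
  have h2 := h.measurable_comp hG (hs _ (grid_mem (N := N) ht j))
  exact (show Measurable (fun p : ℝ × Vec k => p.1 • p.2) by fun_prop).comp (h1.prodMk h2)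

lemma measurable_itoWeight_mul (h : IsItoDiffusion W P T x σ β X) (hL : IsC12 T V)
    (ht : 0 ≤ t) (htT : t < T) {G : ℝ × Vec n → ℝ}
    (hG : ContinuousOn G (Ico 0 T ×ˢ univ)) (N j : ℕ) :
    Measurable[augmentedSigma W P (grid t N j)] (fun ω => itoWeight W V σ X l t N j ω *
      G (grid t N j, X (grid t N j) ω)) := by
  have hs : ∀ s ∈ Icc 0 t, s ∈ Ico 0 T := fun s hs => ⟨hs.1, hs.2.trans_lt htT⟩
  have h1 := measurable_stopWeight (l := l) ht
    (fun s hs' => h.measurable_comp (hL.continuousOn_itoIntegrand h.σ_continuous) (hs s hs'))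
    (fun s hs' => h.progressive.measurable_eval (Ico_subset_Icc_self (hs s hs'))) N j
  have h2 := h.measurable_comp hG (hs _ (grid_mem (N := N) ht j))
  exact (show Measurable (fun p : ℝ × ℝ => p.1 * p.2) by fun_prop).comp (h1.prodMk h2)

lemma _root_.exists_norm_itoWeight_smul_le (ht : 0 ≤ t) (htT : t < T) {E : Type*}
    [SeminormedAddCommGroup E] [NormedSpace ℝ E] {G : ℝ × Vec n → E}
    (hG : ContinuousOn G (Ico 0 T ×ˢ univ)) (l : ℝ) :
    ∃ C, 0 ≤ C ∧ ∀ N j ω, ‖itoWeight W V σ X l t N j ω • G (grid t N j, X (grid t N j) ω)‖ ≤ C := by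
  obtain ⟨K, hK0, hK⟩ := exists_norm_le_on_ball hG htT l
  exact ⟨K, hK0, fun N j ω => norm_stopWeight_smul_le hK0 fun hX => hK _ (grid_mem ht j) _ hX⟩

variable [IsProbabilityMeasure P]

/-- The sums `∑ θ_k (q_kᵀ G q_k - tr(G σσᵀ) (t_{k+1} - t_k))`, where
`q_k = σ (W_{t_{k+1}} - W_{t_k})`, tend to zero in `L²`. -/
lemma tendsto_eLpNorm_sum_matrixForm (hW : IsBrownianMotion W P T)
    (h : IsItoDiffusion W P T x σ β X) (hL : IsC12 T V) (ht : 0 ≤ t) (htT : t < T) (l : ℝ)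
    {G : ℝ × Vec n → Matrix (Fin n) (Fin n) ℝ} (hG : ContinuousOn G (Ico 0 T ×ˢ univ)) :
    (∀ N, AEStronglyMeasurable (fun ω => ∑ k ∈ Finset.range N, itoWeight W V σ X l t N k ω *
      (matrixForm (G (grid t N k, X (grid t N k) ω))
          (diffusionIncrement W σ X (grid t N k) (grid t N (k + 1)) ω)
          (diffusionIncrement W σ X (grid t N k) (grid t N (k + 1)) ω)
        - (G (grid t N k, X (grid t N k) ω) * (σ (grid t N k) (X (grid t N k) ω)
            * (σ (grid t N k) (X (grid t N k) ω)).transpose)).trace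
          * (grid t N (k + 1) - grid t N k))) P) ∧
    Tendsto (fun N => eLpNorm (fun ω => ∑ k ∈ Finset.range N, itoWeight W V σ X l t N k ω *
      (matrixForm (G (grid t N k, X (grid t N k) ω))
          (diffusionIncrement W σ X (grid t N k) (grid t N (k + 1)) ω)
          (diffusionIncrement W σ X (grid t N k) (grid t N (k + 1)) ω)
        - (G (grid t N k, X (grid t N k) ω) * (σ (grid t N k) (X (grid t N k) ω)
            * (σ (grid t N k) (X (grid t N k) ω)).transpose)).trace
          * (grid t N (k + 1) - grid t N k))) 2 P) atTop (𝓝 0) := by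
  let B : Fin m → Fin m → ℝ × Vec n → ℝ := fun a b p =>
    ((σ p.1 p.2).transpose * G p * σ p.1 p.2) a b
  have hB : ∀ a b, ContinuousOn (B a b) (Ico 0 T ×ˢ univ) := fun a b => by
    have hσ' := fun i j => (continuous_apply_apply (ρ := fun _ _ => ℝ) i j).comp_continuousOn
      (h.σ_continuous.mono (prod_mono Ico_subset_Icc_self Subset.rfl))
    have hG' := fun i j =>
      (continuous_apply_apply (ρ := fun _ _ => ℝ) i j).comp_continuousOn hG
    have he : B a b = fun p => ∑ j, (∑ i, σ p.1 p.2 i a * G p i j) * σ p.1 p.2 j b := by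
      funext p
      simp [B, Matrix.mul_apply]
    rw [he]
    exact continuousOn_finsetSum _ fun j _ =>
      (continuousOn_finsetSum _ fun i _ => (hσ' i a).mul (hG' i j)).mul (hσ' j b)
  let f : Fin m → Fin m → ℕ → Ω → ℝ := fun a b N ω => ∑ k ∈ Finset.range N,
    (itoWeight W V σ X l t N k ω * B a b (grid t N k, X (grid t N k) ω))
      * centeredProduct W a b (grid t N k) (grid t N (k + 1)) ω
  have hf : ∀ a b N, AEStronglyMeasurable (f a b N) P := fun a b N => by
    refine Finset.aestronglyMeasurable_fun_sum _ fun k _ => ?_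
    have hk := grid_mem (N := N) ht k
    have h1 := (h.measurable_itoWeight_mul (l := l) hL ht htT (hB a b) N k).mono
      (hW.augmentedSigma_le (hk.2.trans htT.le)) le_rfl
    exact h1.aestronglyMeasurable.mul (hW.memLp_centeredProduct hk.1 (grid_mono ht k.le_succ)
      ((grid_mem ht _).2.trans htT.le) a b).1.aestronglyMeasurable
  have hlim : ∀ a b, Tendsto (fun N => eLpNorm (f a b N) 2 P) atTop (𝓝 0) := fun a b => by
    obtain ⟨C, -, hC⟩ := exists_norm_itoWeight_smul_le (W := W) (V := V) (σ := σ) (X := X)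
      ht htT (hB a b) l
    exact hW.tendsto_eLpNorm_sum_centeredProduct ht htT.le
      (fun N k _ => h.measurable_itoWeight_mul hL ht htT (hB a b) N k) hC a b
  have heq : ∀ N, (fun ω => ∑ k ∈ Finset.range N, itoWeight W V σ X l t N k ω *
      (matrixForm (G (grid t N k, X (grid t N k) ω))
          (diffusionIncrement W σ X (grid t N k) (grid t N (k + 1)) ω)
          (diffusionIncrement W σ X (grid t N k) (grid t N (k + 1)) ω)
        - (G (grid t N k, X (grid t N k) ω) * (σ (grid t N k) (X (grid t N k) ω)
            * (σ (grid t N k) (X (grid t N k) ω)).transpose)).trace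
          * (grid t N (k + 1) - grid t N k))) = ∑ a, ∑ b, f a b N := fun N => by
    funext ω
    simp only [f, Finset.sum_apply, diffusionIncrement, matrixForm_mulVec_sub_trace,
      Finset.mul_sum]
    rw [Finset.sum_comm]
    refine Finset.sum_congr rfl fun a _ => ?_
    rw [Finset.sum_comm]
    refine Finset.sum_congr rfl fun b _ => Finset.sum_congr rfl fun k _ => ?_
    rw [← mul_assoc]
    rfl
  have hm : ∀ a N, AEStronglyMeasurable (∑ b, f a b N) P := fun a N =>
    Finset.aestronglyMeasurable_sum _ fun b _ => hf a b N
  simp only [heq]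
  refine ⟨fun N => Finset.aestronglyMeasurable_sum _ fun a _ => hm a N, ?_⟩
  refine ENNReal.tendsto_zero_of_le ?_ fun N =>
    (eLpNorm_sum_le (fun a _ => hm a N) one_le_two).trans
      (Finset.sum_le_sum fun a _ => eLpNorm_sum_le (fun b _ => hf a b N) one_le_two)
  have := tendsto_finsetSum Finset.univ fun a _ =>
    tendsto_finsetSum Finset.univ fun b _ => hlim a b
  simpa using this

end IsItoDiffusion

end GridIto

section GridItoFormula

set_option linter.unusedSectionVars false

variable {Ω : Type*} {n m : ℕ} [mΩ : MeasurableSpace Ω] {W : ℝ → Ω → Vec m} {P : Measure Ω}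
  {T t l : ℝ} {x : Vec n} {σ : ℝ → Vec n → Matrix (Fin n) (Fin m) ℝ} {β X : ℝ → Ω → Vec n}
  {V : ℝ → Vec n → ℝ}

lemma tendsto_lintegral_add {Y Y' : ℕ → Ω → ℝ≥0∞} (hY : ∀ N, AEMeasurable (Y N) P)
    (h : Tendsto (fun N => ∫⁻ ω, Y N ω ∂P) atTop (𝓝 0))
    (h' : Tendsto (fun N => ∫⁻ ω, Y' N ω ∂P) atTop (𝓝 0)) :
    Tendsto (fun N => ∫⁻ ω, (Y N ω + Y' N ω) ∂P) atTop (𝓝 0) := by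
  simp only [lintegral_add_left' (hY _)]
  simpa using h.add h'

lemma tendsto_lintegral_enorm_sq {f : ℕ → Ω → ℝ}
    (h : Tendsto (fun N => eLpNorm (f N) 2 P) atTop (𝓝 0)) :
    Tendsto (fun N => ∫⁻ ω, ‖f N ω‖ₑ ^ 2 ∂P) atTop (𝓝 0) := by
  simp only [← eLpNorm_two_sq]
  simpa using ENNReal.Tendsto.pow (n := 2) h

namespace IsItoDiffusion

lemma ae_intervalIntegrable_generator (h : IsItoDiffusion W P T x σ β X) (hL : IsC12 T V) :
    ∀ᵐ ω ∂P, ∀ t, 0 ≤ t → t < T →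
      IntervalIntegrable (fun r => itoGenerator T V σ r (X r ω) (β r ω)) volume 0 t := by
  filter_upwards [h.continuous, h.drift_integrable] with ω hX hβ t ht htT
  have hsub : Icc (0 : ℝ) t ⊆ Icc 0 T := Icc_subset_Icc_right htT.le
  have hA : ContinuousOn (fun r => σ r (X r ω)) (Icc 0 t) :=
    h.σ_continuous.comp (f := fun r => (r, X r ω)) (continuousOn_id.prodMk (hX.mono hsub))
      fun r hr => ⟨hsub hr, mem_univ _⟩
  have hβt : ∀ j, IntervalIntegrable (fun r => β r ω j) volume 0 t := fun j =>
    (hβ j).mono_set (by rw [uIcc_of_le ht, uIcc_of_le (ht.trans htT.le)]; exact hsub)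
  have hXt := hX.mono hsub
  have hp : ContinuousOn (fun r => spaceGrad V r (X r ω)) (Icc 0 t) :=
    continuousOn_along_path htT hL.continuousOn_spaceGrad hXt
  have hii : ∀ {f : ℝ → ℝ}, ContinuousOn f (Icc 0 t) → IntervalIntegrable f volume 0 t :=
    fun hf => (hf.mono (by rw [uIcc_of_le ht])).intervalIntegrable
  have h1 := IntervalIntegrable.sum Finset.univ fun j _ => (hβt j).continuousOn_mul
    (g := fun r => spaceGrad V r (X r ω) j)
    ((EuclideanSpace.proj j : Vec n →L[ℝ] ℝ).continuous.comp_continuousOn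
      (by rwa [uIcc_of_le ht]))
  rw [Finset.sum_fn] at h1
  have h2 := (hii (continuousOn_along_path htT hL.continuousOn_timeDeriv hXt)).add h1
  have h3 := h2.add ((hii (continuousOn_trace_mul_mul_transpose
    (continuousOn_along_path htT hL.continuousOn_spaceHess hXt) hA)).const_mul (1 / 2))
  refine h3.congr fun r _ => ?_
  simp [itoGenerator, inner_vec_eq_sum]

lemma itoRemainder_sub {ω : Ω} (hint : IntervalIntegrable
    (fun r => itoGenerator T V σ r (X r ω) (β r ω)) volume 0 t) {r s : ℝ} (hr : 0 ≤ r)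
    (hrs : r ≤ s) (hst : s ≤ t) :
    itoRemainder T V σ β X s ω - itoRemainder T V σ β X r ω
      = V s (X s ω) - V r (X r ω) - ∫ u in r..s, itoGenerator T V σ u (X u ω) (β u ω) := by
  have hsub : ∀ u ∈ Icc (0 : ℝ) t, IntervalIntegrable
      (fun r => itoGenerator T V σ r (X r ω) (β r ω)) volume 0 u :=
    fun u hu => hint.mono_set (by
      rw [uIcc_of_le hu.1, uIcc_of_le (hu.1.trans hu.2)]
      exact Icc_subset_Icc_right hu.2)
  rw [← intervalIntegral.integral_interval_sub_left (hsub s ⟨hr.trans hrs, hst⟩)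
    (hsub r ⟨hr, hrs.trans hst⟩), itoRemainder, itoRemainder]
  ring

variable [IsProbabilityMeasure P]

/-- Itô's formula: along a sequence of grids, almost surely, the stopped left-point sums of
`V_xᵀ σ` approximate the stopped increments of the martingale part of `V(s, X_s)`. -/
theorem exists_grid_tendsto (hW : IsBrownianMotion W P T) (h : IsItoDiffusion W P T x σ β X)
    (hL : IsC12 T V) (ht : 0 ≤ t) (htT : t < T) (l : ℝ) :
    ∃ Ns : ℕ → ℕ, StrictMono Ns ∧ ∀ᵐ ω ∂P, Tendsto (fun i => ∑ k ∈ Finset.range (Ns i),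
      itoWeight W V σ X l t (Ns i) k ω *
        (itoRemainder T V σ β X (grid t (Ns i) (k + 1)) ω
          - itoRemainder T V σ β X (grid t (Ns i) k) ω
          - inner ℝ (itoIntegrand V σ (grid t (Ns i) k) (X (grid t (Ns i) k) ω))
              (W (grid t (Ns i) (k + 1)) ω - W (grid t (Ns i) k) ω))) atTop (𝓝 0) := by
  let θ := itoWeight W V σ X l t
  let D : Fin n → ℝ → Ω → ℝ := fun i s ω => X s ω i - x i - ∫ r in (0 : ℝ)..s, β r ω i
  let ψ : Fin n → ℝ → Ω → Vec m := fun i s ω => WithLp.toLp 2 (σ s (X s ω) i)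
  let e : Fin n → ℕ → ℕ → Ω → ℝ := fun i N k ω =>
    incrementError W (ψ i) (D i) (grid t N k) (grid t N (k + 1)) ω
  have hψ : ∀ i, IsContinuousIto W P T (ψ i) (D i) := h.rows
  have he : ∀ i N k, AEStronglyMeasurable (e i N k) P := fun i N k =>
    ((hψ i).isL2Ito_increment hW (grid_mem ht k).1 (grid_mono ht k.le_succ)
      ((grid_mem ht _).2.trans htT.le)).integral
  have hp : ∀ i : Fin n, ContinuousOn (fun p : ℝ × Vec n => spaceGrad V p.1 p.2 i)
      (Ico 0 T ×ˢ univ) := fun i =>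
    (EuclideanSpace.proj i : Vec n →L[ℝ] ℝ).continuous.comp_continuousOn hL.continuousOn_spaceGrad
  let c : Fin n → ℕ → ℕ → Ω → ℝ := fun i N k ω =>
    θ N k ω * spaceGrad V (grid t N k) (X (grid t N k) ω) i
  have hcm : ∀ i N k, Measurable[augmentedSigma W P (grid t N k)] (c i N k) := fun i N k =>
    h.measurable_itoWeight_mul hL ht htT (hp i) N k
  let Y₁ : Fin n → ℕ → Ω → ℝ≥0∞ := fun i N ω => ∑ k ∈ Finset.range N, ‖e i N k ω‖ₑ ^ 2
  let s₂ : Fin n → ℕ → Ω → ℝ := fun i N ω => ∑ k ∈ Finset.range N, c i N k ω * e i N k ω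
  have hY₁ : ∀ i N, AEMeasurable (Y₁ i N) P := fun i N =>
    Finset.aemeasurable_fun_sum _ fun k _ => (he i N k).enorm.pow_const 2
  have hs₂ : ∀ i N, AEStronglyMeasurable (s₂ i N) P := fun i N =>
    Finset.aestronglyMeasurable_fun_sum _ fun k _ =>
      ((hcm i N k).mono (hW.augmentedSigma_le ((grid_mem ht k).2.trans htT.le))
        le_rfl).aestronglyMeasurable.mul (he i N k)
  have t₁ : ∀ i, Tendsto (fun N => ∫⁻ ω, Y₁ i N ω ∂P) atTop (𝓝 0) := fun i => by
    refine ENNReal.tendsto_zero_of_le ?_ fun N =>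
      (hψ i).lintegral_sum_incrementError_sq_le hW ht htT.le N
    simpa using ENNReal.Tendsto.pow (n := 2) ((hψ i).tendsto_eLpNorm_gridError hW ht htT.le)
  have t₂ : ∀ i, Tendsto (fun N => ∫⁻ ω, ‖s₂ i N ω‖ₑ ^ 2 ∂P) atTop (𝓝 0) := fun i => by
    obtain ⟨C, -, hC⟩ := exists_norm_itoWeight_smul_le (W := W) (V := V) (σ := σ) (X := X)
      ht htT (hp i) l
    exact tendsto_lintegral_enorm_sq ((hψ i).tendsto_eLpNorm_sum_incrementError hW ht htT.le
      (fun N k _ => hcm i N k) hC)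
  obtain ⟨m₃, t₃⟩ := h.tendsto_eLpNorm_sum_matrixForm hW hL ht htT l
    (G := fun p => spaceHess V p.1 p.2) hL.continuousOn_spaceHess
  -- With the identity as matrix, this controls the sum of the `‖q_k‖²`, whose boundedness the
  -- Taylor estimate needs.
  obtain ⟨m₄, t₄⟩ := h.tendsto_eLpNorm_sum_matrixForm hW hL ht htT l
    (G := fun _ => 1) continuousOn_const
  replace t₃ := tendsto_lintegral_enorm_sq t₃
  replace t₄ := tendsto_lintegral_enorm_sq t₄
  have m₃' := fun N => (m₃ N).enorm.pow_const 2
  have m₄' := fun N => (m₄ N).enorm.pow_const 2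
  have t₅ : Tendsto (fun N => ∫⁻ ω, ∑ i, (Y₁ i N ω + ‖s₂ i N ω‖ₑ ^ 2) ∂P) atTop (𝓝 0) := by
    have m₅ : ∀ i N, AEMeasurable (fun ω => Y₁ i N ω + ‖s₂ i N ω‖ₑ ^ 2) P := fun i N =>
      (hY₁ i N).add ((hs₂ i N).enorm.pow_const 2)
    simp only [lintegral_finsetSum' _ fun i _ => m₅ i _]
    simpa using tendsto_finsetSum Finset.univ fun i _ => tendsto_lintegral_add (hY₁ i) (t₁ i) (t₂ i)
  -- The errors are added before the extraction, so that one subsequence serves for all of them.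
  obtain ⟨Ns, hNs, hae⟩ := exists_subseq_ae_tendsto_zero
    (fun N => (m₃' N).add ((m₄' N).add (Finset.aemeasurable_fun_sum _ fun i _ =>
      (hY₁ i N).add ((hs₂ i N).enorm.pow_const 2))))
    (tendsto_lintegral_add m₃' t₃ (tendsto_lintegral_add m₄' t₄ t₅))
  refine ⟨Ns, hNs, ?_⟩
  filter_upwards [hae, h.ae_increment_eq, h.continuous, h.drift_integrable,
    h.ae_intervalIntegrable_generator hL] with ω hω hinc hX hβ hgen
  have hsub : Icc (0 : ℝ) t ⊆ Icc 0 T := Icc_subset_Icc_right htT.le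
  simp only [Pi.add_apply] at hω
  have l₃ := tendsto_zero_of_enorm_sq (ENNReal.tendsto_zero_of_le hω fun i => le_self_add)
  have hω' := ENNReal.tendsto_zero_of_le hω fun i => le_add_self
  have l₄ := tendsto_zero_of_enorm_sq (ENNReal.tendsto_zero_of_le hω' fun i => le_self_add)
  have l₅ : ∀ j, Tendsto (fun i => Y₁ j (Ns i) ω + ‖s₂ j (Ns i) ω‖ₑ ^ 2) atTop (𝓝 0) := fun j =>
    ENNReal.tendsto_zero_of_le (ENNReal.tendsto_zero_of_le hω' fun i => le_add_self) fun i =>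
      (Finset.single_le_sum (f := fun j => Y₁ j (Ns i) ω + ‖s₂ j (Ns i) ω‖ₑ ^ 2)
        (fun _ _ => zero_le) (Finset.mem_univ j))
  have l₂ := fun j => tendsto_zero_of_enorm_sq
    (ENNReal.tendsto_zero_of_le (l₅ j) fun i => le_add_self)
  have l₁ : ∀ j, Tendsto (fun i => ∑ k ∈ Finset.range (Ns i), e j (Ns i) k ω ^ 2) atTop
      (𝓝 0) := fun j => by
    have := (ENNReal.tendsto_toReal ENNReal.zero_ne_top).comp
      (ENNReal.tendsto_zero_of_le (l₅ j) fun i => le_self_add)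
    refine this.congr fun i => ?_
    simp only [Function.comp, Y₁]
    rw [ENNReal.toReal_sum fun k _ => by finiteness]
    simp
  have hA : ContinuousOn (fun r => σ r (X r ω)) (Icc 0 t) :=
    h.σ_continuous.comp (f := fun r => (r, X r ω)) (continuousOn_id.prodMk (hX.mono hsub))
      fun r hr => ⟨hsub hr, mem_univ _⟩
  have hβt : ∀ j, IntervalIntegrable (fun r => β r ω j) volume 0 t := fun j =>
    (hβ j).mono_set (by rw [uIcc_of_le ht, uIcc_of_le (ht.trans htT.le)]; exact hsub)
  have hE : ∀ i k, diffusionError W x σ β X (grid t (Ns i) k) (grid t (Ns i) (k + 1)) ω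
      = WithLp.toLp 2 (fun j => e j (Ns i) k ω) := fun i k => rfl
  have key := hL.tendsto_ito_sum ht htT hNs.tendsto_atTop
    (θ := fun i k => θ (Ns i) k ω) (fun i k => stopWeight_mem_Icc)
    (hX.mono hsub) hA hβt
    (E := fun i k => diffusionError W x σ β X (grid t (Ns i) k) (grid t (Ns i) (k + 1)) ω)
    (q := fun i k => diffusionIncrement W σ X (grid t (Ns i) k) (grid t (Ns i) (k + 1)) ω)
    (fun i k _ => hinc _ _ (grid_mem ht k).1 (grid_mono ht k.le_succ)
      ((grid_mem ht _).2.trans htT.le)) ?_ ?_ l₃ ?_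
  · refine key.congr fun i => Finset.sum_congr rfl fun k _ => ?_
    rw [inner_itoIntegrand, itoRemainder_sub (hgen t ht htT) (grid_mem ht k).1
      (grid_mono ht k.le_succ) (grid_mem ht _).2]
    rfl
  · have := tendsto_finsetSum Finset.univ fun j _ => l₁ j
    simp only [Finset.sum_const_zero] at this
    refine this.congr fun i => ?_
    rw [Finset.sum_comm]
    simp [hE, EuclideanSpace.norm_sq_eq]
  · have := tendsto_finsetSum Finset.univ fun j _ => l₂ j
    simp only [Finset.sum_const_zero] at this
    refine this.congr fun i => ?_
    simp only [s₂, c]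
    rw [Finset.sum_comm]
    simp [hE, inner_vec_eq_sum, Finset.mul_sum, mul_assoc]
  · simpa [norm_sq_eq_matrixForm_one] using l₄

end IsItoDiffusion

end GridItoFormula

/-! ### Simple processes as elementary processes. -/

section SimpleIsometry

set_option linter.unusedSectionVars false

variable {Ω : Type*} {m : ℕ} [mΩ : MeasurableSpace Ω] {W : ℝ → Ω → Vec m} {P : Measure Ω} {T : ℝ}

namespace SimpleProcess

lemma measurable_process (hW : IsBrownianMotion W P T)
    (S : SimpleProcess (augmentedSigma W P) m 0 T) :
    Measurable (fun p : ℝ × Ω => S.process p.1 p.2) := by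
  refine Finset.measurable_fun_sum _ fun k _ => ?_
  have h : Measurable (fun p : ℝ × Ω => S.ξ k p.2) :=
    ((S.ξ_measurable k).mono (hW.augmentedSigma_le (S.τ_mem k).2) le_rfl).comp measurable_snd
  exact h.indicator (s := Prod.fst ⁻¹' Ioc (S.τ k) (S.τ (k + 1)))
    (measurable_fst measurableSet_Ioc)

variable [IsProbabilityMeasure P]

lemma isElementary (hW : IsBrownianMotion W P T) (S : SimpleProcess (augmentedSigma W P) m 0 T) :
    IsElementary W P T (fun p => S.process p.1 p.2) (S.integral W) :=
  isElementary_sum S.τ_mono S.τ_mem (fun k _ => S.ξ_measurable k)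
    (fun k _ => S.memLp_ξ hW le_rfl k)

/-- Itô's isometry for simple processes. -/
lemma lintegral_lintegral_process (hW : IsBrownianMotion W P T)
    (S : SimpleProcess (augmentedSigma W P) m 0 T) :
    ∫⁻ ω, (∫⁻ r in Icc 0 T, ‖S.process r ω‖ₑ ^ 2) ∂P = ∫⁻ ω, ‖S.integral W ω‖ₑ ^ 2 ∂P := by
  rw [← eLpNorm_two_sq, (S.isElementary hW).eLpNorm_integral hW, eLpNorm_two_sq]
  exact (lintegral_prod_symm _
    ((S.measurable_process hW).enorm.pow_const 2).aemeasurable).symm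

end SimpleProcess

end SimpleIsometry

/-! ### Energy of the stopped discretizations of `V_xᵀ σ`. -/

section StoppedIntegrand

set_option linter.unusedSectionVars false

variable {Ω : Type*} {n m : ℕ} [mΩ : MeasurableSpace Ω] {W : ℝ → Ω → Vec m} {P : Measure Ω}
  {T t l : ℝ} {x : Vec n} {σ : ℝ → Vec n → Matrix (Fin n) (Fin m) ℝ} {β X : ℝ → Ω → Vec n}
  {V : ℝ → Vec n → ℝ}

namespace IsItoDiffusion

/-- The stopped left-point discretization of `V_xᵀ σ` over the grid of `[0, t]`. -/
noncomputable def simple (h : IsItoDiffusion W P T x σ β X) (hL : IsC12 T V) (ht : 0 ≤ t)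
    (htT : t < T) (l : ℝ) (N : ℕ) : SimpleProcess (augmentedSigma W P) m 0 T where
  N := N
  τ := grid t N
  τ_mono := grid_mono ht
  τ_mem k := ⟨(grid_mem ht k).1, (grid_mem ht k).2.trans htT.le⟩
  ξ k ω := itoWeight W V σ X l t N k ω • itoIntegrand V σ (grid t N k) (X (grid t N k) ω)
  ξ_measurable k :=
    h.measurable_itoWeight_smul hL ht htT (hL.continuousOn_itoIntegrand h.σ_continuous) N k
  ξ_bounded := by
    obtain ⟨C, -, hC⟩ := exists_norm_itoWeight_smul_le (W := W) (V := V) (σ := σ) (X := X)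
      ht htT (hL.continuousOn_itoIntegrand h.σ_continuous) l
    exact ⟨C, hC N⟩

variable [IsProbabilityMeasure P]

/-- Stopping makes the energy of the discretizations bounded, in the limit, by a constant that
depends only on the level `l`. -/
lemma eventually_lintegral_simple_le (hW : IsBrownianMotion W P T)
    (h : IsItoDiffusion W P T x σ β X) (hL : IsC12 T V) (ht : 0 ≤ t) (htT : t < T) (l : ℝ) :
    ∀ᶠ N in atTop, ∫⁻ ω, (∫⁻ r in Icc 0 T, ‖(h.simple hL ht htT l N).process r ω‖ₑ ^ 2) ∂P
      ≤ ENNReal.ofReal (2 * l ^ 2 + 3) := by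
  obtain ⟨C, -, hC⟩ := exists_norm_itoWeight_smul_le (W := W) (V := V) (σ := σ) (X := X)
    ht htT (hL.continuousOn_itoIntegrand h.σ_continuous) l
  -- Twice the sum of the fourth moments is of order `1 / N`; making it less than `1` turns `2 l² +
  -- 2` into `2 l² + 3`. The bound `C` depends on `t`, but the final bound does not.
  have hsmall := (tendsto_div_nat (2 * (C ^ 4 * (t ^ 2 * gaussianFourthMoment m)))).eventually
    (gt_mem_nhds zero_lt_one)
  filter_upwards [hsmall, eventually_gt_atTop 0] with N hN hN0
  set S := h.simple hL ht htT l N with hS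
  have hξ : ∀ k, Measurable (S.ξ k) := fun k =>
    (S.ξ_measurable k).mono (hW.augmentedSigma_le (S.τ_mem k).2) le_rfl
  have h4 := fun k => hW.integral_inner_increment_pow_four_le (S.τ_mem k).1
    (S.τ_mono k.le_succ) (S.τ_mem (k + 1)).2 (hξ k) (C := C) (hC N k)
  have hI : MemLp (S.integral W) 2 P := (S.isElementary hW).memLp_integral hW
  rw [S.lintegral_lintegral_process hW, hI.lintegral_enorm_sq]
  refine ENNReal.ofReal_le_ofReal ?_
  have hint : Integrable (fun ω => ∑ k ∈ Finset.range N,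
      inner ℝ (S.ξ k ω) (W (S.τ (k + 1)) ω - W (S.τ k) ω) ^ 4) P :=
    integrable_finsetSum _ fun k _ => (h4 k).1
  have hle : ∀ ω, S.integral W ω ^ 2 ≤ 2 * l ^ 2 + 2 + 2 * ∑ k ∈ Finset.range N,
      inner ℝ (S.ξ k ω) (W (S.τ (k + 1)) ω - W (S.τ k) ω) ^ 4 := fun ω => by
    have := sq_sum_stopped_le
      (q := fun k => inner ℝ (itoIntegrand V σ (grid t N k) (X (grid t N k) ω))
        (W (grid t N (k + 1)) ω - W (grid t N k) ω))
      (θ := fun k => itoWeight W V σ X l t N k ω) (L := l)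
      (fun k => stopWeight_eq_zero_or_one) (fun k hk => stopWeight_mono hk)
      (fun k hk => (stopWeight_eq_one_iff.1 hk k le_rfl).2) N
    simp only [← real_inner_smul_left] at this
    exact this
  have hsum : ∫ ω, ∑ k ∈ Finset.range N,
      inner ℝ (S.ξ k ω) (W (S.τ (k + 1)) ω - W (S.τ k) ω) ^ 4 ∂P
      ≤ C ^ 4 * (t ^ 2 * gaussianFourthMoment m) / N := by
    rw [integral_finsetSum _ fun k _ => (h4 k).1]
    have hk : ∀ k ∈ Finset.range N, ∫ ω,
        inner ℝ (S.ξ k ω) (W (S.τ (k + 1)) ω - W (S.τ k) ω) ^ 4 ∂P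
        ≤ C ^ 4 * ((t / N) ^ 2 * gaussianFourthMoment m) := fun k hk => by
      have := (h4 k).2
      rwa [show S.τ (k + 1) - S.τ k = t / N from grid_succ_sub (Finset.mem_range.1 hk)] at this
    refine (Finset.sum_le_sum hk).trans_eq ?_
    have : (N : ℝ) ≠ 0 := by exact_mod_cast hN0.ne'
    rw [Finset.sum_const, Finset.card_range, nsmul_eq_mul]
    field_simp
  have hint2 : Integrable (fun ω => 2 * l ^ 2 + 2 + 2 * ∑ k ∈ Finset.range N,
      inner ℝ (S.ξ k ω) (W (S.τ (k + 1)) ω - W (S.τ k) ω) ^ 4) P :=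
    (integrable_const _).add (hint.const_mul 2)
  calc ∫ ω, S.integral W ω ^ 2 ∂P
      ≤ ∫ ω, (2 * l ^ 2 + 2 + 2 * ∑ k ∈ Finset.range N,
          inner ℝ (S.ξ k ω) (W (S.τ (k + 1)) ω - W (S.τ k) ω) ^ 4) ∂P :=
        integral_mono hI.integrable_sq hint2 hle
    _ = 2 * l ^ 2 + 2 + 2 * ∫ ω, ∑ k ∈ Finset.range N,
          inner ℝ (S.ξ k ω) (W (S.τ (k + 1)) ω - W (S.τ k) ω) ^ 4 ∂P := by
        rw [integral_add (integrable_const _) (hint.const_mul 2), integral_const_mul]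
        simp
    _ ≤ 2 * l ^ 2 + 3 := by
        have h1 : 2 * (C ^ 4 * (t ^ 2 * gaussianFourthMoment m) / N) ≤ 1 := by
          rw [← mul_div_assoc]
          exact hN.le
        linarith

end IsItoDiffusion

end StoppedIntegrand

/-! ### Convergence of the stopped discretizations on bounded events. -/

section StoppedConvergence

set_option linter.unusedSectionVars false

variable {Ω : Type*} {n m : ℕ} [mΩ : MeasurableSpace Ω] {W : ℝ → Ω → Vec m} {P : Measure Ω}
  {T t l : ℝ} {x : Vec n} {σ : ℝ → Vec n → Matrix (Fin n) (Fin m) ℝ} {β X : ℝ → Ω → Vec n}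
  {V : ℝ → Vec n → ℝ}

lemma tendsto_setLIntegral_enorm_sq_zero {E : Type*} [SeminormedAddCommGroup E]
    {f : ℕ → ℝ → E} (h : ∀ ε > 0, ∀ᶠ i in atTop, ∀ r ∈ Ioc 0 t, ‖f i r‖ ≤ ε) :
    Tendsto (fun i => ∫⁻ r in Icc 0 t, ‖f i r‖ₑ ^ 2) atTop (𝓝 0) := by
  rw [ENNReal.tendsto_nhds_zero]
  intro δ hδ
  have hF : Tendsto (fun ε : ℝ => ENNReal.ofReal ε ^ 2 * ENNReal.ofReal t) (𝓝[>] 0) (𝓝 0) := by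
    have h1 : Tendsto (fun ε : ℝ => ENNReal.ofReal ε ^ 2) (𝓝[>] 0) (𝓝 0) := by
      have := ENNReal.Tendsto.pow (n := 2) (ENNReal.tendsto_ofReal
        (tendsto_nhdsWithin_of_tendsto_nhds (s := Ioi 0) (tendsto_id (x := 𝓝 (0 : ℝ)))))
      simpa using this
    simpa using ENNReal.Tendsto.mul_const h1 (Or.inr ENNReal.ofReal_ne_top)
  obtain ⟨ε, hεδ, hε⟩ := ((hF.eventually (ge_mem_nhds hδ)).and self_mem_nhdsWithin).exists
  filter_upwards [h ε hε] with i hi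
  rw [← setLIntegral_congr Ioc_ae_eq_Icc]
  calc ∫⁻ r in Ioc 0 t, ‖f i r‖ₑ ^ 2 ≤ ∫⁻ _ in Ioc 0 t, ENNReal.ofReal ε ^ 2 := by
        refine setLIntegral_mono' measurableSet_Ioc fun r hr => ?_
        gcongr
        rw [← ofReal_norm]
        exact ENNReal.ofReal_le_ofReal (hi r hr)
    _ = ENNReal.ofReal ε ^ 2 * ENNReal.ofReal t := by simp
    _ ≤ δ := hεδ

namespace IsItoDiffusion

variable [IsProbabilityMeasure P]

/-- On the event that `X` and the martingale part of `V(s, X_s)` stay bounded, the stopped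
discretizations are not stopped at all in the limit, and they converge. -/
theorem exists_grid_simple_tendsto (hW : IsBrownianMotion W P T)
    (h : IsItoDiffusion W P T x σ β X) (hL : IsC12 T V) (ht : 0 ≤ t) (htT : t < T) (l : ℝ) :
    ∃ Ns : ℕ → ℕ, StrictMono Ns ∧ ∀ᵐ ω ∂P,
      (∀ s ∈ Icc 0 t, ‖X s ω‖ ≤ l ∧ |itoRemainder T V σ β X s ω| ≤ l - 1) →
      Tendsto (fun i => (h.simple hL ht htT l (Ns i)).integral W ω) atTop
        (𝓝 (itoRemainder T V σ β X t ω)) ∧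
      Tendsto (fun i => ∫⁻ r in Icc 0 t, ‖(h.simple hL ht htT l (Ns i)).process r ω
        - itoIntegrand V σ r (X r ω)‖ₑ ^ 2) atTop (𝓝 0) ∧
      ∫⁻ r in Icc 0 t, ‖itoIntegrand V σ r (X r ω)‖ₑ ^ 2
        ≤ liminf (fun i => ∫⁻ r in Icc 0 T, ‖(h.simple hL ht htT l (Ns i)).process r ω‖ₑ ^ 2)
          atTop := by
  obtain ⟨Ns, hNs, hae⟩ := h.exists_grid_tendsto hW hL ht htT l
  refine ⟨Ns, hNs, ?_⟩
  filter_upwards [hae, h.continuous] with ω hω hX hA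
  have hXt := hX.mono (Icc_subset_Icc_right htT.le)
  have hξ : ContinuousOn (fun r => itoIntegrand V σ r (X r ω)) (Icc 0 t) :=
    continuousOn_along_path htT (hL.continuousOn_itoIntegrand h.σ_continuous) hXt
  have hM0 : itoRemainder T V σ β X 0 ω = 0 := by simp [itoRemainder]
  -- The weighted discrepancy between the left-point sums and the martingale part is eventually at
  -- most `1`. As the martingale part is at most `l - 1`, the sums cannot leave `[-l, l]`; the
  -- margin `1` is spent here.
  have hone : ∀ᶠ i in atTop, ∀ k < Ns i, itoWeight W V σ X l t (Ns i) k ω = 1 := by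
    filter_upwards [hω.eventually (Metric.closedBall_mem_nhds 0 one_pos)] with i hi
    refine stopped_eq_one (L := l)
      (q := fun k => inner ℝ (itoIntegrand V σ (grid t (Ns i) k) (X (grid t (Ns i) k) ω))
        (W (grid t (Ns i) (k + 1)) ω - W (grid t (Ns i) k) ω))
      (M := fun k => itoRemainder T V σ β X (grid t (Ns i) k) ω)
      (fun k => stopWeight_eq_zero_or_one) (by simpa only [grid_zero] using hM0)
      (fun k _ => (hA _ (grid_mem ht k)).2) (fun k _ hk => ?_) (fun k hk => stopWeight_mono hk)
      (fun k hk => (stopWeight_eq_one_iff.1 hk k le_rfl).2) ?_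
    · exact stopWeight_eq_one_iff.2 fun j hj => ⟨(hA _ (grid_mem ht j)).1, hk j hj⟩
    · simpa using hi
  have hclose : ∀ ε > 0, ∀ᶠ i in atTop, ∀ r ∈ Ioc 0 t,
      ‖(h.simple hL ht htT l (Ns i)).process r ω - itoIntegrand V σ r (X r ω)‖ ≤ ε := by
    intro ε hε
    filter_upwards [hone, eventually_grid_close ht hξ hNs.tendsto_atTop hε,
      hNs.tendsto_atTop.eventually_gt_atTop 0] with i hi hgrid hi0 r hr
    obtain ⟨k, hk, hkr⟩ := exists_mem_Ioc_grid hi0 hr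
    have hpr : (h.simple hL ht htT l (Ns i)).process r ω
        = itoIntegrand V σ (grid t (Ns i) k) (X (grid t (Ns i) k) ω) := by
      refine (sum_indicator_Ioc_eq (grid_mono ht) hk hkr fun j =>
        itoWeight W V σ X l t (Ns i) j ω •
          itoIntegrand V σ (grid t (Ns i) j) (X (grid t (Ns i) j) ω)).trans ?_
      rw [hi k hk, one_smul]
    rw [hpr, norm_sub_rev, ← dist_eq_norm]
    exact hgrid k hk r (Ioc_subset_Icc_self hkr)
  refine ⟨?_, tendsto_setLIntegral_enorm_sq_zero hclose, ?_⟩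
  · have hlim := (tendsto_const_nhds (x := itoRemainder T V σ β X t ω)).sub hω
    rw [sub_zero] at hlim
    refine hlim.congr' ?_
    filter_upwards [hone, hNs.tendsto_atTop.eventually_gt_atTop 0] with i hi hi0
    have hsum : ∑ k ∈ Finset.range (Ns i), itoWeight W V σ X l t (Ns i) k ω *
        (itoRemainder T V σ β X (grid t (Ns i) (k + 1)) ω
          - itoRemainder T V σ β X (grid t (Ns i) k) ω
          - inner ℝ (itoIntegrand V σ (grid t (Ns i) k) (X (grid t (Ns i) k) ω))
              (W (grid t (Ns i) (k + 1)) ω - W (grid t (Ns i) k) ω))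
        = itoRemainder T V σ β X t ω - (h.simple hL ht htT l (Ns i)).integral W ω := by
      have h1 := Finset.sum_range_sub
        (fun k => itoRemainder T V σ β X (grid t (Ns i) k) ω) (Ns i)
      rw [grid_zero, grid_self hi0, hM0, sub_zero] at h1
      rw [← h1, SimpleProcess.integral, show (h.simple hL ht htT l (Ns i)).N = Ns i from rfl,
        ← Finset.sum_sub_distrib]
      refine Finset.sum_congr rfl fun k hk => ?_
      simp only [simple, hi k (Finset.mem_range.1 hk), one_mul, one_smul]
    rw [hsum, sub_sub_cancel]
  -- Fatou in time. The energy is kept on `[0, T]` on the right, as that is the quantity bounded in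
  -- expectation.
  · have hpt : ∀ r ∈ Ioc 0 t, ‖itoIntegrand V σ r (X r ω)‖ₑ ^ 2 = liminf (fun i =>
        ‖(h.simple hL ht htT l (Ns i)).process r ω‖ₑ ^ 2) atTop := fun r hr => by
      have hr0 : Tendsto (fun i => (h.simple hL ht htT l (Ns i)).process r ω) atTop
          (𝓝 (itoIntegrand V σ r (X r ω))) := by
        rw [Metric.tendsto_nhds]
        intro ε hε
        filter_upwards [hclose (ε / 2) (half_pos hε)] with i hi
        rw [dist_eq_norm]
        exact (hi r hr).trans_lt (half_lt_self hε)
      exact (ENNReal.Tendsto.pow (n := 2) hr0.enorm).liminf_eq.symm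
    rw [← setLIntegral_congr Ioc_ae_eq_Icc, setLIntegral_congr_fun measurableSet_Ioc hpt]
    refine (lintegral_liminf_le fun i =>
      ((h.simple hL ht htT l (Ns i)).measurable_path ω).enorm.pow_const 2).trans ?_
    refine liminf_le_liminf (Eventually.of_forall fun i => lintegral_mono_set ?_)
    exact Ioc_subset_Icc_self.trans (Icc_subset_Icc_right htT.le)

end IsItoDiffusion

end StoppedConvergence

/-! ### Measurability of `V_xᵀ σ` and finiteness of its energy up to time `T`. -/

section ItoIntegrandProcess

set_option linter.unusedSectionVars false

variable {Ω : Type*} {n m : ℕ} [mΩ : MeasurableSpace Ω] {W : ℝ → Ω → Vec m} {P : Measure Ω}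
  {T t l : ℝ} {x : Vec n} {σ : ℝ → Vec n → Matrix (Fin n) (Fin m) ℝ} {β X : ℝ → Ω → Vec n}
  {V : ℝ → Vec n → ℝ}

/-- No smoothness of `V` in space is available at time `T`, yet the integrand must be measurable
there. Directional values of `fderiv` are measurable for an arbitrary function. -/
lemma measurable_itoIntegrand {s : ℝ} (hσ : Continuous (σ s)) :
    Measurable (itoIntegrand V σ s) := by
  refine (PiLp.continuous_toLp 2 _).measurable.comp (measurable_pi_lambda _ fun j => ?_)
  have hp : ∀ i, Measurable (fun y => spaceGrad V s y i) := fun i => by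
    have h : ∀ y, spaceGrad V s y i = fderiv ℝ (V s) y (EuclideanSpace.single i 1) := fun y => by
      rw [← inner_spaceGrad]
      simp [EuclideanSpace.inner_single_right]
    simp only [h]
    exact measurable_fderiv_apply_const ℝ (V s) _
  have hj : Measurable (fun y => ∑ i, spaceGrad V s y i * σ s y i j) :=
    Finset.measurable_fun_sum _ fun i _ => (hp i).mul
      ((continuous_apply_apply (ρ := fun _ _ => ℝ) i j).comp hσ).measurable
  exact hj

lemma IsC12.measurable_itoIntegrand_comp (hL : IsC12 T V)
    (hσ : ContinuousOn (fun p : ℝ × Vec n => σ p.1 p.2) (Icc 0 T ×ˢ univ)) (ht : t ∈ Icc 0 T)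
    {γ : Type*} {mγ : MeasurableSpace γ} {τ : γ → Icc 0 t} {Y : γ → Vec n} (hτ : Measurable τ)
    (hY : Measurable Y) : Measurable (fun p => itoIntegrand V σ (τ p) (Y p)) := by
  have hG := hL.continuousOn_itoIntegrand hσ
  have hp : Measurable (fun p => ((τ p : ℝ), Y p)) := hτ.subtype_val.prodMk hY
  rcases ht.2.lt_or_eq with hlt | rfl
  · have hmem : ∀ p, ((τ p : ℝ), Y p) ∈ Ico 0 T ×ˢ (univ : Set (Vec n)) := fun p =>
      ⟨⟨(τ p).2.1, (τ p).2.2.trans_lt hlt⟩, mem_univ _⟩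
    have h := hG.measurable_comp hp hmem
    exact h
  -- At `t = T` the slice where the time equals `T` is separated from `[0, T)`, on which the
  -- integrand is jointly continuous.
  · classical
    have hm : Measurable ((Ico 0 t ×ˢ univ).piecewise
        (fun p : ℝ × Vec n => itoIntegrand V σ p.1 p.2) (fun _ => 0)) :=
      hG.measurable_piecewise continuousOn_const (measurableSet_Ico.prod MeasurableSet.univ)
    have hσT : Continuous (σ t) := by
      rw [← continuousOn_univ]
      exact hσ.comp (f := fun y : Vec n => (t, y)) (by fun_prop) fun y _ => ⟨ht, mem_univ y⟩
    have heq : (fun p => itoIntegrand V σ (τ p) (Y p))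
        = fun p => if (τ p : ℝ) < t then (Ico 0 t ×ˢ univ).piecewise
            (fun p : ℝ × Vec n => itoIntegrand V σ p.1 p.2) (fun _ => 0) ((τ p : ℝ), Y p)
          else itoIntegrand V σ t (Y p) := by
      funext p
      split_ifs with h
      · have : ((τ p : ℝ), Y p) ∈ Ico 0 t ×ˢ (univ : Set (Vec n)) :=
          ⟨⟨(τ p).2.1, h⟩, mem_univ _⟩
        rw [piecewise_eq_of_mem _ _ _ this]
      · rw [le_antisymm (τ p).2.2 (not_lt.1 h)]
    rw [heq]
    have hset : MeasurableSet {p | (τ p : ℝ) < t} :=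
      measurableSet_lt hτ.subtype_val measurable_const
    have h1 := hm.comp hp
    have h2 := (measurable_itoIntegrand (V := V) hσT).comp hY
    exact Measurable.ite hset h1 h2

namespace IsItoDiffusion

lemma progressive_itoIntegrand (h : IsItoDiffusion W P T x σ β X) (hL : IsC12 T V) :
    IsProgressiveOn (augmentedSigma W P) 0 T (fun s ω => itoIntegrand V σ s (X s ω)) :=
  fun t ht => hL.measurable_itoIntegrand_comp h.σ_continuous ht
    (@measurable_fst _ _ _ (augmentedSigma W P t)) (h.progressive t ht)

lemma measurable_joint {E : Type*} [MeasurableSpace E] {Y : ℝ → Ω → E}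
    (hW : IsBrownianMotion W P T) (hY : IsProgressiveOn (augmentedSigma W P) 0 T Y)
    (ht : t ∈ Icc 0 T) : Measurable (fun p : Icc (0 : ℝ) t × Ω => Y p.1 p.2) :=
  (hY t ht).mono
    (sup_le_sup le_rfl (MeasurableSpace.comap_mono (hW.augmentedSigma_le ht.2))) le_rfl

lemma measurable_itoRemainder (hW : IsBrownianMotion W P T) (h : IsItoDiffusion W P T x σ β X)
    (hL : IsC12 T V) (ht : 0 ≤ t) (htT : t < T) : Measurable (itoRemainder T V σ β X t) := by
  have hX := measurable_joint hW h.progressive ⟨ht, htT.le⟩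
  have hpX : Measurable (fun p : Icc (0 : ℝ) t × Ω => ((p.1 : ℝ), X p.1 p.2)) :=
    measurable_fst.subtype_val.prodMk hX
  have hmem : ∀ p : Icc (0 : ℝ) t × Ω, ((p.1 : ℝ), X p.1 p.2) ∈ Ico 0 T ×ˢ (univ : Set (Vec n)) :=
    fun p => ⟨⟨p.1.2.1, p.1.2.2.trans_lt htT⟩, mem_univ _⟩
  have h1 := hL.continuousOn_timeDeriv.measurable_comp hpX hmem
  have h2 := hL.continuousOn_spaceGrad.measurable_comp hpX hmem
  have h3 := (continuousOn_trace_mul_mul_transpose hL.continuousOn_spaceHess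
    (h.σ_continuous.mono (prod_mono Ico_subset_Icc_self Subset.rfl))).measurable_comp hpX hmem
  have hβ : Measurable (fun p : Icc (0 : ℝ) t × Ω => β p.1 p.2) := by
    have hincl : Measurable (fun p : Icc (0 : ℝ) t × Ω =>
        ((⟨p.1, p.1.2.1, p.1.2.2.trans htT.le⟩ : Icc (0 : ℝ) T), p.2)) :=
      (measurable_fst.subtype_val.subtype_mk).prodMk measurable_snd
    exact h.drift_measurable.comp hincl
  have hgen : Measurable (fun p : Icc (0 : ℝ) t × Ω => itoGenerator T V σ p.1 (X p.1 p.2)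
      (β p.1 p.2)) := (h1.add (h2.inner hβ)).add (h3.const_mul _)
  have hV : ∀ s ∈ Ico 0 T, Measurable (fun ω => V s (X s ω)) := fun s hs =>
    (h.measurable_comp hL.continuousOn hs).mono (hW.augmentedSigma_le hs.2.le) le_rfl
  exact ((hV t ⟨ht, htT⟩).sub (hV 0 ⟨le_rfl, ht.trans_lt htT⟩)).sub
    (measurable_integral_process (Y := fun r ω => itoGenerator T V σ r (X r ω) (β r ω)) ht hgen)

/-- The square integrability of `V_xᵀ σ` along the path, on the event that `X` and the martingale
part of `V(s, X_s)` stay bounded. -/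
lemma ae_lintegral_lt_top_of_bounded [IsProbabilityMeasure P] (hW : IsBrownianMotion W P T)
    (h : IsItoDiffusion W P T x σ β X) (hL : IsC12 T V) (hT : 0 < T) (l : ℝ) :
    ∀ᵐ ω ∂P, (∀ s ∈ Ico 0 T, ‖X s ω‖ ≤ l ∧ |itoRemainder T V σ β X s ω| ≤ l - 1) →
      ∫⁻ r in Icc 0 T, ‖itoIntegrand V σ r (X r ω)‖ₑ ^ 2 < ∞ := by
  obtain ⟨u, hu, hmem, hlim⟩ := exists_seq_strictMono_tendsto' hT
  choose Ns hNs hae using fun j =>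
    h.exists_grid_simple_tendsto hW hL (hmem j).1.le (hmem j).2 l
  let e : ℕ → ℕ → Ω → ℝ≥0∞ := fun j i ω => ∫⁻ r in Icc 0 T,
    ‖(h.simple hL (hmem j).1.le (hmem j).2 l (Ns j i)).process r ω‖ₑ ^ 2
  have he : ∀ j i, Measurable (e j i) := fun j i =>
    (((SimpleProcess.measurable_process hW _).enorm.pow_const 2).comp
      measurable_swap).lintegral_prod_right'
  -- Fatou over the grids of `[0, u_j]`, then over the horizons `u_j ↑ T`: the bound is the same for
  -- all `j`, so nothing is lost as the horizon grows.
  have hG : ∀ j, ∫⁻ ω, liminf (fun i => e j i ω) atTop ∂P ≤ ENNReal.ofReal (2 * l ^ 2 + 3) :=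
    fun j => (lintegral_liminf_le (he j)).trans <| liminf_le_of_frequently_le' <|
      ((hNs j).tendsto_atTop.eventually
        (h.eventually_lintegral_simple_le hW hL (hmem j).1.le (hmem j).2 l)).frequently
  have hGm : ∀ j, Measurable fun ω => liminf (fun i => e j i ω) atTop := fun j =>
    Measurable.liminf (he j)
  have hfin : ∫⁻ ω, liminf (fun j => liminf (fun i => e j i ω) atTop) atTop ∂P
      ≤ ENNReal.ofReal (2 * l ^ 2 + 3) :=
    (lintegral_liminf_le hGm).trans <| liminf_le_of_frequently_le' <|
      (Eventually.of_forall hG).frequently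
  filter_upwards [ae_all_iff.2 hae,
    ae_lt_top (Measurable.liminf hGm) (hfin.trans_lt ENNReal.ofReal_lt_top).ne] with ω h1 h2 hA
  refine lt_of_le_of_lt ?_ h2
  have hun : ⋃ j, Icc 0 (u j) = Ico 0 T := by
    ext r
    simp only [mem_iUnion, mem_Icc, mem_Ico]
    refine ⟨fun ⟨j, hj⟩ => ⟨hj.1, hj.2.trans_lt (hmem j).2⟩, fun hr => ?_⟩
    obtain ⟨j, hj⟩ := (hlim.eventually (lt_mem_nhds hr.2)).exists
    exact ⟨j, hr.1, hj.le⟩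
  -- The energies over `[0, u_j]` increase to the energy over `[0, T)`, by continuity from below of
  -- the measure with density `‖V_xᵀ σ‖²`.
  have htend := tendsto_measure_iUnion_atTop
    (μ := volume.withDensity fun r => ‖itoIntegrand V σ r (X r ω)‖ₑ ^ 2)
    (s := fun j => Icc 0 (u j)) fun i j hij => Icc_subset_Icc_right (hu.monotone hij)
  rw [hun, withDensity_apply _ measurableSet_Ico] at htend
  rw [← setLIntegral_congr Ico_ae_eq_Icc, ← htend.liminf_eq]
  refine liminf_le_liminf (Eventually.of_forall fun j => ?_)
  rw [Function.comp, withDensity_apply _ measurableSet_Icc]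
  exact (h1 j fun s hs => hA s ⟨hs.1, hs.2.trans_lt (hmem j).2⟩).2.2

end IsItoDiffusion

end ItoIntegrandProcess

/-! ### Itô's formula up to the terminal time. -/

lemma tendsto_measure_le_of_ae_tendsto {α : Type*} {mα : MeasurableSpace α} {μ : Measure α}
    [IsFiniteMeasure μ] {f : ℕ → α → ℝ≥0∞} (hf : ∀ i, Measurable (f i))
    (h : ∀ᵐ a ∂μ, Tendsto (fun i => f i a) atTop (𝓝 0)) {ε : ℝ≥0∞} (hε : 0 < ε) :
    Tendsto (fun i => μ {a | ε ≤ f i a}) atTop (𝓝 0) := by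
  have hm : ∀ i, MeasurableSet {a | ε ≤ f i a} := fun i => measurableSet_le measurable_const (hf i)
  simp only [← lintegral_indicator_one (hm _)]
  rw [← lintegral_zero (μ := μ)]
  refine tendsto_lintegral_of_dominated_convergence 1 (fun i => measurable_one.indicator (hm i))
    (fun i => ae_of_all _ fun a => indicator_le_self _ _ a) (by simp) ?_
  filter_upwards [h] with a ha
  refine tendsto_const_nhds.congr' ?_
  filter_upwards [ha.eventually (gt_mem_nhds hε)] with i hi
  rw [indicator_of_notMem]
  exact not_le.2 hi

/-- At a fixed level convergence is known only on a bounded event. Multiplying by the indicator of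
the measurable set of convergence reduces to the almost sure case. -/
lemma exists_measure_tendsto_and_le {α : Type*} {mα : MeasurableSpace α} {μ : Measure α}
    [IsFiniteMeasure μ] {f : ℕ → α → ℝ≥0∞} (hf : ∀ i, Measurable (f i)) {ε δ : ℝ≥0∞} (hε : 0 < ε)
    (hδ : 0 < δ) :
    ∃ i, μ {a | Tendsto (fun i => f i a) atTop (𝓝 0) ∧ ε ≤ f i a} ≤ δ := by
  have hB : MeasurableSet {a | Tendsto (fun i => f i a) atTop (𝓝 0)} := measurableSet_tendsto _ hf
  set B := {a | Tendsto (fun i => f i a) atTop (𝓝 0)} with hB'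
  have hlim : ∀ᵐ a ∂μ, Tendsto (fun i => B.indicator (f i) a) atTop (𝓝 0) := by
    refine ae_of_all _ fun a => ?_
    by_cases ha : a ∈ B
    · simp only [indicator_of_mem ha]
      exact ha
    · simp only [indicator_of_notMem ha, tendsto_const_nhds]
  obtain ⟨i, hi⟩ := ((tendsto_measure_le_of_ae_tendsto (fun i => (hf i).indicator hB) hlim
    hε).eventually (ge_mem_nhds hδ)).exists
  refine ⟨i, (measure_mono fun a ha => ?_).trans hi⟩
  have haB : a ∈ B := ha.1
  change ε ≤ B.indicator (f i) a
  rw [indicator_of_mem haB]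
  exact ha.2

section ItoFormula

set_option linter.unusedSectionVars false

variable {Ω : Type*} {n m d : ℕ} [mΩ : MeasurableSpace Ω] {W : ℝ → Ω → Vec m} {P : Measure Ω}
  [IsProbabilityMeasure P] {T t l : ℝ} {x : Vec n} {σ : ℝ → Vec n → Matrix (Fin n) (Fin m) ℝ}
  {β X : ℝ → Ω → Vec n} {V : ℝ → Vec n → ℝ}

lemma SimpleProcess.measurable_integral (hW : IsBrownianMotion W P T)
    (S : SimpleProcess (augmentedSigma W P) m 0 T) : Measurable (S.integral W) :=
  Finset.measurable_fun_sum _ fun k _ =>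
    (IsBrownianMotion.measurable_inner_increment (S.τ_mem k).1 (S.τ_mono k.le_succ)
      (S.τ_mem (k + 1)).2 (S.ξ_measurable k)).mono (hW.augmentedSigma_le le_rfl) le_rfl

lemma SimpleProcess.measurable_lintegral_enorm_sub_sq (hW : IsBrownianMotion W P T)
    (S : SimpleProcess (augmentedSigma W P) m 0 T) {φ : ℝ → Ω → Vec m}
    (hφ : IsProgressiveOn (augmentedSigma W P) 0 T φ) (ht : t ∈ Icc 0 T) :
    Measurable (fun ω => ∫⁻ r in Icc 0 t, ‖S.process r ω - φ r ω‖ₑ ^ 2) := by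
  have h1 : Measurable (fun p : Icc (0 : ℝ) t × Ω => S.process p.1 p.2) :=
    (S.measurable_process hW).comp (measurable_fst.subtype_val.prodMk measurable_snd)
  have h2 := IsItoDiffusion.measurable_joint hW hφ ht
  exact measurable_lintegral_process (Y := fun r ω => ‖S.process r ω - φ r ω‖ₑ ^ 2) ht.1
    ((h1.sub h2).enorm.pow_const 2)

namespace IsItoDiffusion

lemma simple_process_eq_zero (h : IsItoDiffusion W P T x σ β X) (hL : IsC12 T V) (ht : 0 ≤ t)
    (htT : t < T) (N : ℕ) {r : ℝ} (hr : t < r) (ω : Ω) :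
    (h.simple hL ht htT l N).process r ω = 0 :=
  Finset.sum_eq_zero fun k _ => indicator_of_notMem
    (fun hk => absurd (hk.2.trans (grid_mem ht (k + 1)).2) (not_le.2 hr)) _

/-- Itô's formula on `[0, T]` for a function which is `C^{1,2}` on `[0, T)` only: if the martingale
part of `V(s, X_s)` extends continuously to time `T`, then its terminal value is the stochastic
integral of `V_xᵀ σ`. -/
theorem isItoIntegral (hW : IsBrownianMotion W P T) (h : IsItoDiffusion W P T x σ β X)
    (hL : IsC12 T V) (hT : 0 < T) {J : Ω → ℝ}
    (hJ : ∀ᵐ ω ∂P, ∃ f : ℝ → ℝ, ContinuousOn f (Icc 0 T) ∧ f T = J ω ∧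
      ∀ s ∈ Ico 0 T, itoRemainder T V σ β X s ω = f s) :
    IsItoIntegral W P 0 T (fun s ω => itoIntegrand V σ s (X s ω)) J := by
  -- Continuity up to time `T` of the state and of the extended martingale part bounds both on `[0,
  -- T)`, with a bound that depends on the path.
  have hbdd : ∀ᵐ ω ∂P, ∃ l₀ : ℕ, ∀ l : ℕ, l₀ ≤ l → ∀ s ∈ Ico 0 T,
      ‖X s ω‖ ≤ l ∧ |itoRemainder T V σ β X s ω| ≤ l - 1 := by
    filter_upwards [hJ, h.continuous] with ω hJω hX
    obtain ⟨f, hf, -, hfM⟩ := hJω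
    obtain ⟨A, hA⟩ := isCompact_Icc.exists_bound_of_continuousOn hX
    obtain ⟨B, hB⟩ := isCompact_Icc.exists_bound_of_continuousOn hf
    obtain ⟨l₀, hl₀⟩ := exists_nat_ge (max A (B + 1))
    refine ⟨l₀, fun l hl s hs => ?_⟩
    have hl' : max A (B + 1) ≤ l := hl₀.trans (by exact_mod_cast hl)
    refine ⟨(hA s (Ico_subset_Icc_self hs)).trans ((le_max_left _ _).trans hl'), ?_⟩
    rw [hfM s hs]
    have h1 := hB s (Ico_subset_Icc_self hs)
    have h2 := (le_max_right A (B + 1)).trans hl'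
    rw [Real.norm_eq_abs] at h1
    linarith
  have hfin : ∀ᵐ ω ∂P, ∫⁻ r in Icc 0 T, ‖itoIntegrand V σ r (X r ω)‖ₑ ^ 2 < ∞ := by
    filter_upwards [hbdd, ae_all_iff.2 fun l : ℕ => h.ae_lintegral_lt_top_of_bounded hW hL hT l]
      with ω hb hω
    obtain ⟨l₀, hl₀⟩ := hb
    exact hω l₀ (hl₀ l₀ le_rfl)
  have hprog := h.progressive_itoIntegrand hL
  refine ⟨hprog, hfin, ?_⟩
  obtain ⟨u, hu, hmem, hlim⟩ := exists_seq_strictMono_tendsto' hT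
  -- The level `j` and the horizon `u j` grow together, so each path is eventually unaffected by the
  -- stopping while the horizon tends to `T`.
  choose Ns hNs hae using fun j : ℕ =>
    h.exists_grid_simple_tendsto hW hL (hmem j).1.le (hmem j).2 j
  let S : ℕ → ℕ → SimpleProcess (augmentedSigma W P) m 0 T := fun j i =>
    h.simple hL (hmem j).1.le (hmem j).2 j (Ns j i)
  let φ : ℝ → Ω → Vec m := fun r ω => itoIntegrand V σ r (X r ω)
  have hR : ∀ j i t, t ∈ Icc 0 T →
      Measurable (fun ω => ∫⁻ r in Icc 0 t, ‖(S j i).process r ω - φ r ω‖ₑ ^ 2) :=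
    fun j i t ht => (S j i).measurable_lintegral_enorm_sub_sq hW hprog ht
  let F : ℕ → ℕ → Ω → ℝ≥0∞ := fun j i ω =>
    ‖(S j i).integral W ω - itoRemainder T V σ β X (u j) ω‖ₑ
      + ∫⁻ r in Icc 0 (u j), ‖(S j i).process r ω - φ r ω‖ₑ ^ 2
  have hF : ∀ j i, Measurable (F j i) := fun j i =>
    ((((S j i).measurable_integral hW).sub
      (h.measurable_itoRemainder hW hL (hmem j).1.le (hmem j).2)).enorm).add
      (hR j i _ ⟨(hmem j).1.le, (hmem j).2.le⟩)
  have hpos : ∀ j : ℕ, (0 : ℝ≥0∞) < 2⁻¹ ^ j := fun j => ENNReal.pow_pos (by simp) j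
  -- With threshold and probability both `2⁻ʲ`, Borel–Cantelli makes the diagonal errors `F j (I j)`
  -- at most `2⁻ʲ` eventually, on almost every path.
  choose I hI using fun j => exists_measure_tendsto_and_le (μ := P) (hF j) (hpos j) (hpos j)
  have hBC := ae_eventually_notMem (μ := P) (ne_top_of_le_ne_top
    (by rw [ENNReal.tsum_geometric]; simp) (ENNReal.tsum_le_tsum hI))
  have hF0 : ∀ᵐ ω ∂P, Tendsto (fun j => F j (I j) ω) atTop (𝓝 0) := by
    filter_upwards [hBC, ae_all_iff.2 hae, hbdd] with ω h1 h2 hb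
    obtain ⟨l₀, hl₀⟩ := hb
    refine tendsto_of_tendsto_of_tendsto_of_le_of_le' tendsto_const_nhds
      (ENNReal.tendsto_pow_atTop_nhds_zero_of_lt_one (r := 2⁻¹) (by simp))
      (Eventually.of_forall fun _ => zero_le) ?_
    filter_upwards [h1, eventually_ge_atTop l₀] with j hj hjl
    obtain ⟨h3, h4, -⟩ := h2 j fun s hs => hl₀ j hjl s ⟨hs.1, hs.2.trans_lt (hmem j).2⟩
    have h5 : Tendsto (fun i => F j i ω) atTop (𝓝 0) := by
      have h6 : Tendsto (fun i => ‖(S j i).integral W ω - itoRemainder T V σ β X (u j) ω‖ₑ)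
          atTop (𝓝 0) := by
        simpa using (h3.sub_const (itoRemainder T V σ β X (u j) ω)).enorm
      simpa using h6.add h4
    exact (not_le.1 fun hle => hj ⟨h5, hle⟩).le
  refine ⟨fun j => S j (I j), fun ε hε => ?_, ?_⟩
  · refine tendsto_measure_le_of_ae_tendsto (fun j => hR j (I j) T ⟨hT.le, le_rfl⟩) ?_ hε
    filter_upwards [hF0, hfin] with ω h1 h2
    -- After `u j` the simple process vanishes, so the error there is the tail of the energy of
    -- `V_xᵀ σ`, which tends to zero because the total is finite.
    have htail : Tendsto (fun j => ∫⁻ r in Ioc (u j) T, ‖φ r ω‖ₑ ^ 2 ∂(volume.restrict (Icc 0 T)))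
        atTop (𝓝 0) := by
      refine tendsto_setLIntegral_zero h2.ne ?_
      refine ENNReal.tendsto_zero_of_le (g := fun j => ENNReal.ofReal (T - u j)) ?_ fun j => ?_
      · have := ENNReal.tendsto_ofReal ((tendsto_const_nhds (x := T)).sub hlim)
        simpa using this
      · refine (Measure.restrict_apply_le _ _).trans ?_
        simp
    have hadd := (ENNReal.tendsto_zero_of_le h1 fun j => le_add_self).add htail
    rw [add_zero] at hadd
    refine ENNReal.tendsto_zero_of_le hadd fun j => ?_
    have hun : Icc 0 (u j) ∪ Ioc (u j) T = Icc 0 T :=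
      Icc_union_Ioc_eq_Icc (hmem j).1.le (hmem j).2.le
    have hinter : Ioc (u j) T ∩ Icc 0 T = Ioc (u j) T :=
      inter_eq_left.2 fun r hr => ⟨(hmem j).1.le.trans hr.1.le, hr.2⟩
    rw [Measure.restrict_restrict measurableSet_Ioc, hinter, ← hun]
    refine (lintegral_union_le _ _ _).trans (add_le_add le_rfl ?_)
    refine (setLIntegral_congr_fun measurableSet_Ioc fun r hr => ?_).le
    have h0 : (S j (I j)).process r ω = 0 := h.simple_process_eq_zero hL _ _ _ hr.1 ω
    simp only [h0, zero_sub, enorm_neg]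
  · refine tendstoInMeasure_of_tendsto_ae
      (fun j => ((S j (I j)).measurable_integral hW).aestronglyMeasurable) ?_
    filter_upwards [hF0, hJ] with ω h1 hJω
    obtain ⟨f, hf, hfT, hfM⟩ := hJω
    have h2 : Tendsto (fun j => (S j (I j)).integral W ω - itoRemainder T V σ β X (u j) ω) atTop
        (𝓝 0) := by
      refine tendsto_zero_of_enorm_sq ?_
      simpa using ENNReal.Tendsto.pow (n := 2)
        (ENNReal.tendsto_zero_of_le h1 fun j => le_self_add)
    have h3 : Tendsto (fun j => itoRemainder T V σ β X (u j) ω) atTop (𝓝 (J ω)) := by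
      rw [← hfT]
      have h4 : Tendsto (fun j => f (u j)) atTop (𝓝 (f T)) :=
        (hf T ⟨hT.le, le_rfl⟩).tendsto.comp (tendsto_nhdsWithin_iff.2
          ⟨hlim, Eventually.of_forall fun j => ⟨(hmem j).1.le, (hmem j).2.le⟩⟩)
      exact h4.congr fun j => (hfM _ ⟨(hmem j).1.le, (hmem j).2⟩).symm
    simpa using h2.add h3

end IsItoDiffusion

end ItoFormula

/-- Along the optimal path, the martingale part of `V(s, X_s)` extends continuously to time `T`,
where it is equal to the penalty. -/
lemma ControlProblem.SolvesHJB.exists_continuousOn_itoRemainder_eq {n m d : ℕ} {Ω : Type*}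
    {M : ControlProblem n m d} {V : ℝ → Vec n → ℝ} {ustar : ℝ → Vec n → Vec d}
    (h : M.SolvesHJB V ustar) (hT : 0 < M.T) {x : Vec n} {X : ℝ → Ω → Vec n} {ω : Ω}
    (hX : ContinuousOn (fun s => X s ω) (Icc 0 M.T)) (hX0 : X 0 ω = x)
    (hg : IntervalIntegrable (fun s => M.g s (X s ω) (ustar s (X s ω))) volume 0 M.T) :
    ∃ f : ℝ → ℝ, ContinuousOn f (Icc 0 M.T) ∧
      f M.T = M.penalty V x (fun t ω => ustar t (X t ω)) X ω ∧
      ∀ s ∈ Ico 0 M.T, itoRemainder M.T V M.σ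
        (fun r ω => M.b r (X r ω) (ustar r (X r ω))) X s ω = f s := by
  refine ⟨fun s => V s (X s ω) - V 0 x + ∫ r in (0 : ℝ)..s, M.g r (X r ω) (ustar r (X r ω)),
    ?_, ?_, fun s hs => ?_⟩
  · have hV : ContinuousOn (fun s => V s (X s ω)) (Icc 0 M.T) :=
      h.cp.continuousOn.comp (f := fun s => (s, X s ω)) (continuousOn_id.prodMk hX)
        fun s hs => ⟨hs, mem_univ _⟩
    have hI : ContinuousOn (fun s => ∫ r in (0 : ℝ)..s, M.g r (X r ω) (ustar r (X r ω)))
        (Icc 0 M.T) := by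
      rw [intervalIntegrable_iff_integrableOn_Icc_of_le hT.le] at hg
      rw [← uIcc_of_le hT.le] at hg ⊢
      exact intervalIntegral.continuousOn_primitive_interval hg
    exact (hV.sub continuousOn_const).add hI
  · simp only [ControlProblem.penalty, h.terminal]
    ring
  · have hgen : ∫ r in (0 : ℝ)..s, itoGenerator M.T V M.σ r (X r ω)
        (M.b r (X r ω) (ustar r (X r ω)))
        = -∫ r in (0 : ℝ)..s, M.g r (X r ω) (ustar r (X r ω)) := by
      rw [← intervalIntegral.integral_neg]
      refine intervalIntegral.integral_congr fun r hr => ?_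
      rw [uIcc_of_le hs.1] at hr
      -- `M.generator` at the optimal control unfolds to `itoGenerator` with the optimal drift. The
      -- HJB equation is used only on `[0, s]` with `s < T`.
      exact eq_neg_of_add_eq_zero_right (h.ustar_max r ⟨hr.1, hr.2.trans_lt hs.2⟩ (X r ω))
    rw [itoRemainder, hgen, hX0, sub_neg_eq_add]

theorem mainTheorem5 {n m d : ℕ} {Ω : Type*} [MeasurableSpace Ω] (P : Measure Ω)
    [IsProbabilityMeasure P] (M : ControlProblem n m d) (hM : M.StandingAssumptions)
    (W : ℝ → Ω → Vec m) (hW : IsBrownianMotion W P M.T)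
    -- `V` is the value function, and it satisfies the hypotheses of the verification theorem
    -- together with the feedback `ustar`
    (V : ℝ → Vec n → ℝ)
    (hV : ∀ t ∈ Ico (0 : ℝ) M.T, ∀ x : Vec n, (V t x : EReal) = M.valueFunction W P t x)
    (ustar : ℝ → Vec n → Vec d) (hHJB : M.SolvesHJB V ustar)
    -- `X` is the optimal trajectory started at `x`; the strategy `ustar (t, X_t)` is admissible
    (x : Vec n) (X : ℝ → Ω → Vec n)
    (hX : M.IsAdmissible W P 0 x (fun t ω => ustar t (X t ω)) X)
    -- the integral `∫_0^T g dt` in the definition of the penalty makes sense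
    (hg : M.RunningRewardDefined P 0 (fun t ω => ustar t (X t ω)) X) :
    IsItoIntegral W P 0 M.T
      (fun t ω => WithLp.toLp 2 (Matrix.vecMul (spaceGrad V t (X t ω)).ofLp (M.σ t (X t ω))))
      (M.penalty V x (fun t ω => ustar t (X t ω)) X) := by
  -- The integrand is `itoIntegrand` unfolded; what is left is the continuous extension of the
  -- martingale part to time `T`.
  refine (hX.isItoDiffusion hM hW).isItoIntegral hW hHJB.c12 hM.T_pos ?_
  filter_upwards [hX.solution.continuous_paths, hX.solution.start, hg] with ω h1 h2 h3
  exact hHJB.exists_continuousOn_itoRemainder_eq hM.T_pos h1 h2 h3
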